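/- Let $U$ be a ribbon Hopf algebra over $\mathbb{C}$, that is, a quasi-triangular Hopf algebra with universal $R$-matrix $\mathcal R=\sum r^+\otimes r^-\in U\otimes U$ and a ribbon element, and assume that the common annihilator of all finite-dimensional $U$-modules is zero. Write $\Delta(x)=x_1\otimes x_2$, $\epsilon$, $S$ for the coproduct, counit and antipode. Let $F\subset U^*$ be the restricted dual, spanned by the matrix coefficients $c_{f,v}(x)=f(xv)$ of finite-dimensional $U$-modules, with $((x\otimes y)\rhd\varphi)(h)=\varphi(S(x)hy)$ and $\operatorname{ad}(x)\varphi=\Delta(x)\rhd\varphi$. Let $A$ be the space $F$ with unit $\epsilon$ and product $\varphi\cdot\psi=\sum\operatorname{ad}(r^+)(\varphi)*\big((r^-\otimes1)\rhd\psi\big)$, where $*$ is the product of $F$, $(\varphi*\psi)(h)=\varphi(h_1)\psi(h_2)$. Let $D_U$ be the subalgebra $A\otimes U\otimes 1$ of $A\rtimes U^{[2]}$: it is generated by the algebras $A$ and $U$ with the relations $xa=\sum\big((x_1\otimes S(r_j^+)r_k^+)\rhd a\big)\,r_j^-x_2r_k^-$ for $x\in U$, $a\in A$. Let $\partial_\lhd:U\to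 D_U$ be the inclusion. Let $U'\subset U$ be the space of those $y$ for which $\{h_1yS(h_2):h\in U\}$ spans a finite-dimensional space, and let $\partial_\rhd(y)\in D_U$, for $y\in U'$, be the element that acts on the basic module $A$ by $(\partial_\rhd(y)\varphi)(h)=\varphi(hy)$; explicitly, $\partial_\rhd(y)=\sum_i\sum \operatorname{ad}(s^+)(f_i)\,s^-S^{-1}(y_i)$, where $\mathcal R^{-1}=\sum s^+\otimes s^-$ and $h_1yS(h_2)=\sum_i f_i(h)y_i$ with $f_i\in F$, $y_i\in U$. Put $\operatorname{ad}(x)=\partial_\lhd(x_1)\partial_\rhd(x_2)$ for $x\in U'$. Let $V$ be a finite-dimensional $U$-module, $n\ge0$, and let $\sigma_{VV}=\tau\circ\mathcal R$ be the braiding on $V\otimes V$, where $\tau$ is the flip. For a $D_U$-module $M$, let $W_M=(V^{\otimes n}\otimes M)^{inv}$ be the space of all $w\in V^{\otimes n}\otimes M$ such that $x\cdot w=\epsilon(x)w$ for all $x\in U'$, where $x\cdot(v_n\otimes\cdots\otimes v_1\otimes m)=x_1v_n\otimes\cdots\otimes x_nv_1\otimes\operatorname{ad}(x_{n+1})m$.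 Number the tensor factors from right to left, with $M$ at position $0$, and define operators on $V^{\otimes n}\otimes M$ by: $T_i$ is $\sigma_{VV}$ on the factors $i+1,i$; $Y_1=\mathcal R_{01}\mathcal R_{10}$ (with $U$ acting on $M$ through $\partial_\lhd$); $X_1(\cdots\otimes v\otimes m)=\sum_k\cdots\otimes e_k\otimes c_{e_k^*,v}m$ for a basis $(e_k)$ of $V$ with dual basis $(e_k^*)$; $Y_{i+1}=T_iY_iT_i$ and $X_{i+1}=T_iX_iT_i$. Let $B_n^{Ell}$ be the elliptic braid group, generated by $X_1,\dots,X_n$, $Y_1,\dots,Y_n$, $T_1,\dots,T_{n-1}$ with the relations: the $X_i$ commute with each other; the $Y_i$ commute with each other; $T_iT_{i+1}T_i=T_{i+1}T_iT_{i+1}$; $T_iT_j=T_jT_i$ for $|i-j|\ge2$; $T_iX_iT_i=X_{i+1}$; $T_iY_iT_i=Y_{i+1}$; $T_iX_j=X_jT_i$ and $T_iY_j=Y_jT_i$ for $j\ne i,i+1$; $X_1Y_2=Y_2X_1T_1^2$; and $\tilde YX_i=X_i\tilde Y$ with $\tilde Y=Y_1\cdots Y_n$. For $q,t\in\mathbb{C}\setminus\{0\}$,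 let the double affine Hecke algebra $\mathcal{H}\!\!\!\mathcal{H}_n(q,t)$ be the quotient of $\mathbb{C}B_n^{Ell}$ by the relations $(T_i-q^{-1}t)(T_i+q^{-1}t^{-1})=0$. Suppose that $(\sigma_{VV}-q^{-1}t)(\sigma_{VV}+q^{-1}t^{-1})=0$ on $V\otimes V$. Then, for every $D_U$-module $M$, the operators $T_i,X_i,Y_i$ preserve $W_M$ and define on it an action of $B_n^{Ell}$, which descends to an action of $\mathcal{H}\!\!\!\mathcal{H}_n(q,t)$; and $M\mapsto W_M$, $f\mapsto(\mathrm{id}\otimes f)|_{W_M}$, is a functor $D_U\text{-mod}\to\mathrm{Rep}(\mathcal{H}\!\!\!\mathcal{H}_n(q,t))$. -/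

import Mathlib

open scoped TensorProduct ModuleCat

universe u v w

noncomputable section

namespace QuantumD

/-! ### Quasi-triangular and ribbon Hopf algebras -/

section Hopf

variable {U : Type u} [Ring U] [HopfAlgebra ℂ U]

/-- `x ⊗ y ↦ x ⊗ y ⊗ 1`. -/
def leg12 (U : Type u) [Ring U] [HopfAlgebra ℂ U] : U ⊗[ℂ] U →ₐ[ℂ] U ⊗[ℂ] (U ⊗[ℂ] U) :=
  Algebra.TensorProduct.map (AlgHom.id ℂ U) Algebra.TensorProduct.includeLeft

/-- `x ⊗ y ↦ x ⊗ 1 ⊗ y`. -/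
def leg13 (U : Type u) [Ring U] [HopfAlgebra ℂ U] : U ⊗[ℂ] U →ₐ[ℂ] U ⊗[ℂ] (U ⊗[ℂ] U) :=
  Algebra.TensorProduct.map (AlgHom.id ℂ U) Algebra.TensorProduct.includeRight

/-- `x ⊗ y ↦ 1 ⊗ x ⊗ y`. -/
def leg23 (U : Type u) [Ring U] [HopfAlgebra ℂ U] : U ⊗[ℂ] U →ₐ[ℂ] U ⊗[ℂ] (U ⊗[ℂ] U) :=
  Algebra.TensorProduct.includeRight

/-- A quasi-triangular structure (universal `R`-matrix) on a Hopf algebra: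
`R Δ(x) = Δᵒᵖ(x) R`, `(Δ ⊗ id) R = R₁₃ R₂₃`, `(id ⊗ Δ) R = R₁₃ R₁₂`. -/
structure QuasiTriangular (U : Type u) [Ring U] [HopfAlgebra ℂ U] where
  R : (U ⊗[ℂ] U)ˣ
  mul_comul : ∀ x : U, (R : U ⊗[ℂ] U) * Coalgebra.comul x =
    TensorProduct.comm ℂ U U (Coalgebra.comul x) * (R : U ⊗[ℂ] U)
  comul_left : TensorProduct.assoc ℂ U U U
    ((Coalgebra.comul (R := ℂ) (A := U)).rTensor U (R : U ⊗[ℂ] U)) = leg13 U R * leg23 U R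
  comul_right : (Coalgebra.comul (R := ℂ) (A := U)).lTensor U (R : U ⊗[ℂ] U) =
    leg13 U R * leg12 U R

/-- A ribbon element: `ν` is central and invertible, `Δ(ν) = (R₂₁ R)⁻¹ (ν ⊗ ν)`, `ε(ν) = 1`,
`S(ν) = ν`. -/
structure RibbonElement (Q : QuasiTriangular U) where
  ν : Uˣ
  central : ∀ x : U, (ν : U) * x = x * ν
  comul_eq : TensorProduct.comm ℂ U U (Q.R : U ⊗[ℂ] U) * (Q.R : U ⊗[ℂ] U) *
    Coalgebra.comul (ν : U) = (ν : U) ⊗ₜ[ℂ] (ν : U)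
  counit_eq : Coalgebra.counit (R := ℂ) (ν : U) = 1
  antipode_eq : HopfAlgebra.antipode ℂ (ν : U) = ν

/-- The common annihilator of all finite-dimensional representations is zero. -/
def EnoughFinDimReps (U : Type u) [Ring U] [HopfAlgebra ℂ U] : Prop :=
  ∀ x : U, (∀ (k : ℕ) (ρ : U →ₐ[ℂ] Module.End ℂ (Fin k → ℂ)), ρ x = 0) → x = 0

/-- The inverse of the antipode (the antipode of a quasi-triangular Hopf algebra is bijective). -/
def antipodeInv (U : Type u) [Ring U] [HopfAlgebra ℂ U] : U →ₗ[ℂ] U :=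
  Ring.inverse (HopfAlgebra.antipode ℂ : Module.End ℂ U)

/-- Multiplication by `S(x)` on the right, as an algebra map in `x`. -/
def mulRightAntipode (U : Type u) [Ring U] [HopfAlgebra ℂ U] : U →ₐ[ℂ] Module.End ℂ U :=
  AlgHom.ofLinearMap ((LinearMap.mul ℂ U).flip ∘ₗ HopfAlgebra.antipode ℂ)
    (by ext y; simp)
    (by
      intro a b
      ext y
      simp [HopfAlgebra.antipode_mul_antidistrib, mul_assoc])

/-- The adjoint action of `U` on itself, `ad(x) y = x₁ y S(x₂)`. -/
def adj (U : Type u) [Ring U] [HopfAlgebra ℂ U] : U →ₐ[ℂ] Module.End ℂ U :=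
  (Algebra.TensorProduct.lift (Algebra.lmul ℂ U) (mulRightAntipode U)
    (fun a b => by
      ext y
      simp [mulRightAntipode, mul_assoc])).comp (Bialgebra.comulAlgHom ℂ U)

/-- `U'`: the elements `y` of `U` for which `ad(U) y` is finite-dimensional. -/
def locFin (U : Type u) [Ring U] [HopfAlgebra ℂ U] : Submodule ℂ U where
  carrier := {y | FiniteDimensional ℂ (LinearMap.range ((adj U).toLinearMap.flip y))}
  zero_mem' := by
    change FiniteDimensional ℂ (LinearMap.range ((adj U).toLinearMap.flip 0))
    rw [map_zero, LinearMap.range_zero]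
    infer_instance
  add_mem' := by
    intro a b ha hb
    change FiniteDimensional ℂ _ at ha hb
    change FiniteDimensional ℂ (LinearMap.range ((adj U).toLinearMap.flip (a + b)))
    refine Submodule.finiteDimensional_of_le
      (S₂ := LinearMap.range ((adj U).toLinearMap.flip a) ⊔
        LinearMap.range ((adj U).toLinearMap.flip b)) ?_
    rintro _ ⟨x, rfl⟩
    rw [map_add]
    exact Submodule.add_mem_sup (LinearMap.mem_range_self _ x) (LinearMap.mem_range_self _ x)
  smul_mem' := by
    intro c a ha
    change FiniteDimensional ℂ _ at ha
    change FiniteDimensional ℂ (LinearMap.range ((adj U).toLinearMap.flip (c • a)))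
    refine Submodule.finiteDimensional_of_le
      (S₂ := LinearMap.range ((adj U).toLinearMap.flip a)) ?_
    rintro _ ⟨x, rfl⟩
    rw [map_smul]
    exact Submodule.smul_mem _ c (LinearMap.mem_range_self _ x)

/-! ### The restricted dual `F` -/

/-- The matrix coefficient `c_{f,v}(x) = f(x v)`. -/
def coeff {E : Type*} [AddCommGroup E] [Module ℂ E] (ρ : U →ₐ[ℂ] Module.End ℂ E)
    (f : Module.Dual ℂ E) (e : E) : Module.Dual ℂ U :=
  f ∘ₗ LinearMap.applyₗ e ∘ₗ ρ.toLinearMap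

@[simp] theorem coeff_apply {E : Type*} [AddCommGroup E] [Module ℂ E]
    (ρ : U →ₐ[ℂ] Module.End ℂ E) (f : Module.Dual ℂ E) (e : E) (x : U) :
    coeff ρ f e x = f (ρ x e) := rfl

/-- The restricted dual `F` of `U`: the span of the matrix coefficients of the finite-dimensional
representations of `U` (every one of which is isomorphic to one on some `ℂᵏ`). -/
def RDual (U : Type u) [Ring U] [HopfAlgebra ℂ U] : Submodule ℂ (Module.Dual ℂ U) :=
  Submodule.span ℂ {φ | ∃ (k : ℕ) (ρ : U →ₐ[ℂ] Module.End ℂ (Fin k → ℂ))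
    (f : Module.Dual ℂ (Fin k → ℂ)) (e : Fin k → ℂ), φ = coeff ρ f e}

theorem coeff_mem {E : Type*} [AddCommGroup E] [Module ℂ E] [FiniteDimensional ℂ E]
    (ρ : U →ₐ[ℂ] Module.End ℂ E) (f : Module.Dual ℂ E) (e : E) : coeff ρ f e ∈ RDual U := by
  let φ : E ≃ₗ[ℂ] (Fin (Module.finrank ℂ E) → ℂ) := (Module.finBasis ℂ E).equivFun
  refine Submodule.subset_span ⟨Module.finrank ℂ E, (φ.conjAlgEquiv ℂ).toAlgHom.comp ρ,
    f ∘ₗ φ.symm.toLinearMap, φ e, ?_⟩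
  ext x
  simp

/-- The product of functionals dual to the comultiplication, `(φψ)(h) = φ(h₁) ψ(h₂)`. -/
def dualMul (U : Type u) [Ring U] [HopfAlgebra ℂ U] :
    Module.Dual ℂ U →ₗ[ℂ] Module.Dual ℂ U →ₗ[ℂ] Module.Dual ℂ U :=
  TensorProduct.curry
    ((Coalgebra.comul (R := ℂ) (A := U)).dualMap ∘ₗ TensorProduct.dualDistrib ℂ U U)

/-- The action of `U ⊗ U` on functionals, `((x ⊗ y) φ)(h) = φ(S(x) h y)`. -/
def dualAct (U : Type u) [Ring U] [HopfAlgebra ℂ U] :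
    U →ₗ[ℂ] U →ₗ[ℂ] Module.End ℂ (Module.Dual ℂ U) :=
  LinearMap.mk₂ ℂ
    (fun x y => (LinearMap.mulLeft ℂ (HopfAlgebra.antipode ℂ x) ∘ₗ LinearMap.mulRight ℂ y).dualMap)
    (by intros; ext; simp [add_mul])
    (by intros; ext; simp)
    (by intros; ext; simp [mul_add])
    (by intros; ext; simp)

theorem dualMul_mem {φ ψ : Module.Dual ℂ U} (hφ : φ ∈ RDual U) (hψ : ψ ∈ RDual U) :
    dualMul U φ ψ ∈ RDual U := by
  induction hφ using Submodule.span_induction with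
  | zero => simp
  | add a b _ _ ha hb => simpa using add_mem ha hb
  | smul c a _ ha => simpa using Submodule.smul_mem _ c ha
  | mem φ h =>
    obtain ⟨k, ρ, f, e, rfl⟩ := h
    induction hψ using Submodule.span_induction with
    | zero => simp
    | add a b _ _ ha hb => simpa using add_mem ha hb
    | smul c a _ ha => simpa using Submodule.smul_mem _ c ha
    | mem ψ h =>
      obtain ⟨l, ρ', f', e', rfl⟩ := h
      have := coeff_mem (U := U)
        ((Module.endTensorEndAlgHom (R := ℂ) (S := ℂ) (A := ℂ) (M := Fin k → ℂ)
          (N := Fin l → ℂ)).comp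
          ((Algebra.TensorProduct.map ρ ρ').comp (Bialgebra.comulAlgHom ℂ U)))
        (TensorProduct.dualDistrib ℂ _ _ (f ⊗ₜ f')) (e ⊗ₜ e')
      convert this using 1
      ext x
      have key : ∀ t : U ⊗[ℂ] U,
          TensorProduct.dualDistrib ℂ U U (coeff ρ f e ⊗ₜ coeff ρ' f' e') t =
          TensorProduct.dualDistrib ℂ _ _ (f ⊗ₜ f') (Module.endTensorEndAlgHom (R := ℂ) (S := ℂ) (A := ℂ)
            (M := Fin k → ℂ) (N := Fin l → ℂ) (Algebra.TensorProduct.map ρ ρ' t) (e ⊗ₜ e')) := by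
        intro t
        induction t with
        | zero => simp
        | add a b ha hb => simp only [map_add, ha, hb, LinearMap.add_apply]
        | tmul a b =>
          rw [Algebra.TensorProduct.map_tmul, Module.endTensorEndAlgHom_apply]
          simp
      exact key _

theorem dualAct_mem (x y : U) {φ : Module.Dual ℂ U} (hφ : φ ∈ RDual U) :
    dualAct U x y φ ∈ RDual U := by
  induction hφ using Submodule.span_induction with
  | zero => simp
  | add a b _ _ ha hb => simpa using add_mem ha hb
  | smul c a _ ha => simpa using Submodule.smul_mem _ c ha
  | mem φ h =>
    obtain ⟨k, ρ, f, e, rfl⟩ := h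
    have := coeff_mem ρ (f ∘ₗ ρ (HopfAlgebra.antipode ℂ x)) (ρ y e)
    convert this using 1
    ext h
    simp [dualAct]

/-- The multiplication of `F`. -/
def fMul (U : Type u) [Ring U] [HopfAlgebra ℂ U] :
    RDual U →ₗ[ℂ] RDual U →ₗ[ℂ] RDual U :=
  LinearMap.mk₂ ℂ (fun φ ψ => ⟨dualMul U φ ψ, dualMul_mem φ.2 ψ.2⟩)
    (by intros; ext; simp) (by intros; ext; simp)
    (by intros; ext; simp) (by intros; ext; simp)

/-- The action of `U ⊗ U` on `F`, `((x ⊗ y) φ)(h) = φ(S(x) h y)`. -/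
def fAct (U : Type u) [Ring U] [HopfAlgebra ℂ U] :
    U ⊗[ℂ] U →ₗ[ℂ] Module.End ℂ (RDual U) :=
  TensorProduct.lift (LinearMap.mk₂ ℂ
    (fun x y => (dualAct U x y).restrict (fun _ h => dualAct_mem x y h))
    (by intros; ext; simp) (by intros; ext; simp)
    (by intros; ext; simp) (by intros; ext; simp))

/-- The adjoint action `ad(x) φ = Δ(x) φ` of `U` on `F`. -/
def fAd (U : Type u) [Ring U] [HopfAlgebra ℂ U] : U →ₗ[ℂ] Module.End ℂ (RDual U) :=
  fAct U ∘ₗ Coalgebra.comul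

/-- The unit of `F` (and of `A`), i.e. the counit of `U`. -/
def fOne (U : Type u) [Ring U] [HopfAlgebra ℂ U] : RDual U :=
  ⟨Coalgebra.counit, by
    have := coeff_mem ((Algebra.lmul ℂ ℂ).comp (Bialgebra.counitAlgHom ℂ U))
      (LinearMap.id) (1 : ℂ)
    convert this using 1
    ext h
    simp⟩

/-- The functional `c_{f,v}` for a finite-dimensional `U`-module, as an element of `F`. -/
def fCoeff (U : Type u) [Ring U] [HopfAlgebra ℂ U] {V : Type v} [AddCommGroup V] [Module ℂ V]
    [Module U V] [IsScalarTower ℂ U V] [FiniteDimensional ℂ V] (f : Module.Dual ℂ V) (e : V) :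
    RDual U :=
  ⟨coeff (Algebra.lsmul ℂ ℂ V : U →ₐ[ℂ] Module.End ℂ V) f e, coeff_mem _ f e⟩

/-! ### The algebra `A`, the algebra `D_U` and its modules -/

/-- The product of the reflection equation algebra `A` (whose underlying space is `F`):
`φ · ψ = ∑ ad(r⁺)(φ) * ((r⁻ ⊗ 1) ψ)`, where `*` is the product of `F` and `R = ∑ r⁺ ⊗ r⁻`. -/
def aMul (Q : QuasiTriangular U) (φ ψ : RDual U) : RDual U :=
  TensorProduct.lift ((fMul U).compl₁₂ ((fAd U).flip φ)
    ((fAct U ∘ₗ (TensorProduct.mk ℂ U U).flip 1).flip ψ)) (Q.R : U ⊗[ℂ] U)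

/-- The comultiplication `Δ̃(h) = R₂₃⁻¹ τ₂₃(Δ ⊗ Δ)(h) R₂₃` of `U^[2]` on elements `h = x ⊗ 1`; it
takes values in `U ⊗ U ⊗ U ⊗ 1`, and the last factor is dropped:
`x ↦ R₂₃⁻¹ (x₁ ⊗ 1 ⊗ x₂) R₂₃`. -/
def comulTwo (Q : QuasiTriangular U) : U →ₗ[ℂ] U ⊗[ℂ] (U ⊗[ℂ] U) :=
  LinearMap.mulLeft ℂ (leg23 U (Q.R⁻¹ : (U ⊗[ℂ] U)ˣ)) ∘ₗ
    LinearMap.mulRight ℂ (leg23 U (Q.R : U ⊗[ℂ] U)) ∘ₗ (leg13 U).toLinearMap ∘ₗ Coalgebra.comul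

/-- The generators `a ∈ A` of `D_U`, before imposing relations. -/
def preA (U : Type u) [Ring U] [HopfAlgebra ℂ U] :
    RDual U →ₗ[ℂ] TensorAlgebra ℂ (RDual U × U) :=
  TensorAlgebra.ι ℂ ∘ₗ LinearMap.inl ℂ _ _

/-- The generators `x ∈ U` of `D_U`, before imposing relations. -/
def preU (U : Type u) [Ring U] [HopfAlgebra ℂ U] :
    U →ₗ[ℂ] TensorAlgebra ℂ (RDual U × U) :=
  TensorAlgebra.ι ℂ ∘ₗ LinearMap.inr ℂ _ _

/-- The relations of `D_U`: those of `A`, those of `U`, and the cross relation of the semidirect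
product `A ⋊ U^[2]`, `h a = (h₁ ▷ a) h₂` with `h₁ ⊗ h₂ = Δ̃(h)`, for `h = x ⊗ 1`. -/
inductive DURel (Q : QuasiTriangular U) :
    TensorAlgebra ℂ (RDual U × U) → TensorAlgebra ℂ (RDual U × U) → Prop
  | a_one : DURel Q (preA U (fOne U)) 1
  | a_mul (a b : RDual U) : DURel Q (preA U a * preA U b) (preA U (aMul Q a b))
  | u_one : DURel Q (preU U 1) 1
  | u_mul (x y : U) : DURel Q (preU U x * preU U y) (preU U (x * y))
  | cross (x : U) (a : RDual U) : DURel Q (preU U x * preA U a)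
      (TensorProduct.lift ((LinearMap.mul ℂ (TensorAlgebra ℂ (RDual U × U))).compl₁₂
        (preA U ∘ₗ (fAct U).flip a) (preU U))
        ((TensorProduct.assoc ℂ U U U).symm (comulTwo Q x)))

/-- The algebra `D_U` of quantum differential operators on `U`, i.e. the subalgebra `A ⊗ U ⊗ 1` of
`A ⋊ U^[2]`, given by generators `a ∈ A`, `x ∈ U` and relations. -/
def DU (Q : QuasiTriangular U) : Type u := RingQuot (DURel Q)

instance (Q : QuasiTriangular U) : Ring (DU Q) := inferInstanceAs (Ring (RingQuot (DURel Q)))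

instance (Q : QuasiTriangular U) : Algebra ℂ (DU Q) :=
  inferInstanceAs (Algebra ℂ (RingQuot (DURel Q)))

/-- The quotient map onto `D_U`. -/
def DU.mk (Q : QuasiTriangular U) : TensorAlgebra ℂ (RDual U × U) →ₐ[ℂ] DU Q :=
  RingQuot.mkAlgHom ℂ (DURel Q)

/-- The inclusion `A → D_U`. -/
def DU.iA (Q : QuasiTriangular U) : RDual U →ₗ[ℂ] DU Q := (DU.mk Q).toLinearMap ∘ₗ preA U

/-- The inclusion `∂_◁ : U → D_U`, `x ↦ x ⊗ 1`. -/
def DU.iU (Q : QuasiTriangular U) : U →ₗ[ℂ] DU Q := (DU.mk Q).toLinearMap ∘ₗ preU U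

/-! ### The right and adjoint actions of `U'` on `D_U`-modules -/

/-- `f ⊗ z ↦ (h ↦ f(h) z)`. -/
def evalHom (U : Type u) [Ring U] [HopfAlgebra ℂ U] : RDual U ⊗[ℂ] U →ₗ[ℂ] (U →ₗ[ℂ] U) :=
  dualTensorHom ℂ U U ∘ₗ (RDual U).subtype.rTensor U

theorem evalHom_injective : Function.Injective (evalHom U) := by
  have h1 : Function.Injective (dualTensorHom ℂ U U) := by
    rw [injective_iff_map_eq_zero]
    intro t ht
    classical
    let b := Module.Free.chooseBasis ℂ U
    apply (TensorProduct.equivFinsuppOfBasisRight (M := Module.Dual ℂ U) b).injective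
    rw [map_zero]
    ext i h
    rw [TensorProduct.equivFinsuppOfBasisRight_apply]
    have key : ∀ t : Module.Dual ℂ U ⊗[ℂ] U,
        TensorProduct.rid ℂ (Module.Dual ℂ U) ((b.coord i).lTensor _ t) h =
          b.coord i (dualTensorHom ℂ U U t h) := by
      intro t
      induction t with
      | zero => simp
      | add a c ha hc => simp only [map_add, LinearMap.add_apply, ha, hc]
      | tmul f z => simp [mul_comm]
    rw [key, ht]
    simp
  exact h1.comp (Module.Flat.rTensor_preserves_injective_linearMap _
    (RDual U).injective_subtype)

theorem adj_mem_range (y : locFin U) :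
    (adj U).toLinearMap.flip y ∈ LinearMap.range (evalHom U) := by
  obtain ⟨y, hy⟩ := y
  let N := LinearMap.range ((adj U).toLinearMap.flip y)
  have : FiniteDimensional ℂ N := hy
  have hN : ∀ (x : U), ∀ z ∈ N, adj U x z ∈ N := by
    rintro x _ ⟨h, rfl⟩
    exact ⟨x * h, by simp⟩
  let ρ : U →ₐ[ℂ] Module.End ℂ N := AlgHom.ofLinearMap
    { toFun := fun x => (adj U x).restrict (hN x)
      map_add' := by intros; ext; simp
      map_smul' := by intros; ext; simp }
    (by ext; simp) (by intros; ext; simp)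
  have hyN : y ∈ N := ⟨1, by simp⟩
  let b := Module.finBasis ℂ N
  refine ⟨∑ i, (⟨coeff ρ (b.coord i) ⟨y, hyN⟩, coeff_mem _ _ _⟩ : RDual U) ⊗ₜ (b i : U), ?_⟩
  ext h
  have h1 : ((∑ i, b.repr (ρ h ⟨y, hyN⟩) i • b i : N) : U) = adj U h y := by
    rw [b.sum_repr]
    rfl
  rw [Submodule.coe_sum] at h1
  simpa [evalHom] using h1

/-- The coadjoint map `U' → F ⊗ U`: the unique `∑ fᵢ ⊗ yᵢ` with `ad(h) y = ∑ fᵢ(h) yᵢ`. -/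
def coad (U : Type u) [Ring U] [HopfAlgebra ℂ U] : locFin U →ₗ[ℂ] RDual U ⊗[ℂ] U :=
  (LinearEquiv.ofInjective (evalHom U) evalHom_injective).symm.toLinearMap ∘ₗ
    LinearMap.codRestrict _ ((adj U).toLinearMap.flip ∘ₗ (locFin U).subtype) adj_mem_range

theorem evalHom_coad (y : locFin U) (h : U) : evalHom U (coad U y) h = adj U h y := by
  have := LinearEquiv.apply_symm_apply (LinearEquiv.ofInjective (evalHom U) evalHom_injective)
    ⟨_, adj_mem_range y⟩
  exact LinearMap.congr_fun (congrArg Subtype.val this) h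

section

open WithConv LinearMap

theorem convMul_const {B : Type u} [Ring B] [Algebra ℂ B] (f : WithConv (U →ₗ[ℂ] B)) (t : B) :
    f * toConv (LinearMap.toSpanSingleton ℂ B t ∘ₗ Coalgebra.counit) =
      toConv (LinearMap.mulRight ℂ t ∘ₗ f.ofConv) := by
  ext x
  have h1 : TensorProduct.map f.ofConv (LinearMap.toSpanSingleton ℂ B t ∘ₗ Coalgebra.counit) =
      TensorProduct.map f.ofConv (LinearMap.toSpanSingleton ℂ B t) ∘ₗ
        (Coalgebra.counit (R := ℂ) (A := U)).lTensor U := by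
    ext
    simp
  rw [convMul_apply]
  change LinearMap.mul' ℂ B (TensorProduct.map f.ofConv
    (LinearMap.toSpanSingleton ℂ B t ∘ₗ Coalgebra.counit) (Coalgebra.comul x)) = f.ofConv x * t
  rw [h1, LinearMap.comp_apply, Coalgebra.lTensor_counit_comul]
  simp

theorem adj_eq_conv (y : U) : (adj U).toLinearMap.flip y =
    (toConv (LinearMap.id : U →ₗ[ℂ] U) *
      toConv (LinearMap.toSpanSingleton ℂ U y ∘ₗ Coalgebra.counit) *
      toConv (HopfAlgebra.antipode ℂ)).ofConv := by
  rw [convMul_const]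
  ext x
  have h1 : ∀ t : U ⊗[ℂ] U, Algebra.TensorProduct.lift (Algebra.lmul ℂ U) (mulRightAntipode U)
      (fun a b => by ext y; simp [mulRightAntipode, mul_assoc]) t y =
      LinearMap.mul' ℂ U (TensorProduct.map (LinearMap.mulRight ℂ y ∘ₗ LinearMap.id)
        (HopfAlgebra.antipode ℂ) t) := by
    intro t
    induction t with
    | zero => simp
    | add a c ha hc => simp only [map_add, LinearMap.add_apply, ha, hc]
    | tmul p d => simp [mulRightAntipode, mul_assoc]
  exact h1 _

theorem comul_conj (y u : U) :
    (adj U u).lTensor U (Coalgebra.comul y) =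
      (toConv ((Algebra.TensorProduct.includeLeft (R := ℂ) (S := ℂ) (A := U) (B := U)).toLinearMap
          ∘ₗ HopfAlgebra.antipode ℂ) *
        toConv (Coalgebra.comul ∘ₗ (adj U).toLinearMap.flip y) *
        toConv (Algebra.TensorProduct.includeLeft (R := ℂ) (S := ℂ) (A := U)
          (B := U)).toLinearMap) u := by
  let jl : U →ₐ[ℂ] U ⊗[ℂ] U := Algebra.TensorProduct.includeLeft
  let jr : U →ₐ[ℂ] U ⊗[ℂ] U := Algebra.TensorProduct.includeRight
  let a : WithConv (U →ₗ[ℂ] U ⊗[ℂ] U) := toConv jl.toLinearMap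
  let b : WithConv (U →ₗ[ℂ] U ⊗[ℂ] U) := toConv jr.toLinearMap
  let a' : WithConv (U →ₗ[ℂ] U ⊗[ℂ] U) := toConv (jl.toLinearMap ∘ₗ HopfAlgebra.antipode ℂ)
  let b' : WithConv (U →ₗ[ℂ] U ⊗[ℂ] U) := toConv (jr.toLinearMap ∘ₗ HopfAlgebra.antipode ℂ)
  let kk : U ⊗[ℂ] U → WithConv (U →ₗ[ℂ] U ⊗[ℂ] U) := fun t =>
    toConv (LinearMap.toSpanSingleton ℂ _ t ∘ₗ Coalgebra.counit)
  have hinv : ∀ j : U →ₐ[ℂ] U ⊗[ℂ] U,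
      toConv (j.toLinearMap ∘ₗ HopfAlgebra.antipode ℂ) * toConv j.toLinearMap = 1 := by
    intro j
    have h := congrArg (fun f : WithConv (U →ₗ[ℂ] U) => j.toLinearMap ∘ₗ f.ofConv)
      (antipode_mul_id (R := ℂ) (C := U))
    simp only [algHom_comp_convMul_distrib] at h
    apply WithConv.ext
    rw [show (toConv (j.toLinearMap ∘ₗ HopfAlgebra.antipode ℂ) * toConv j.toLinearMap).ofConv
      = _ from h]
    ext x
    simp [LinearMap.convOne_def]
  have hab : a * b = toConv Coalgebra.comul := by
    ext x
    rw [(Coalgebra.Repr.arbitrary ℂ x).convMul_apply]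
    simp [a, b, jl, jr, (Coalgebra.Repr.arbitrary ℂ x).eq]
  have hS : toConv (Coalgebra.comul ∘ₗ HopfAlgebra.antipode ℂ) = b' * a' := by
    refine (left_inv_eq_right_inv (a := a * b) ?_ ?_).symm
    · rw [mul_assoc, ← mul_assoc a' a b, hinv jl, one_mul, hinv jr]
    · rw [hab]
      exact comul_right_inv
  have had : toConv (Coalgebra.comul ∘ₗ (adj U).toLinearMap.flip y) =
      a * b * kk (Coalgebra.comul y) * (b' * a') := by
    have h1 := algHom_comp_convMul_distrib (Bialgebra.comulAlgHom ℂ U)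
      (toConv (LinearMap.id : U →ₗ[ℂ] U) *
        toConv (LinearMap.toSpanSingleton ℂ U y ∘ₗ Coalgebra.counit))
      (toConv (HopfAlgebra.antipode ℂ))
    have h2 := algHom_comp_convMul_distrib (Bialgebra.comulAlgHom ℂ U)
      (toConv (LinearMap.id : U →ₗ[ℂ] U))
      (toConv (LinearMap.toSpanSingleton ℂ U y ∘ₗ Coalgebra.counit))
    have h3 : (Bialgebra.comulAlgHom ℂ U).toLinearMap ∘ₗ
        (LinearMap.toSpanSingleton ℂ U y ∘ₗ Coalgebra.counit) =
        LinearMap.toSpanSingleton ℂ (U ⊗[ℂ] U) (Coalgebra.comul y) ∘ₗ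
          Coalgebra.counit (R := ℂ) (A := U) := by
      ext x
      simp
    rw [hab, ← hS, adj_eq_conv]
    refine WithConv.ext (h1.trans ?_)
    rw [h2]
    simp only [h3]
    rfl
  have hl : (b * kk (Coalgebra.comul y) * b') u = (adj U u).lTensor U (Coalgebra.comul y) := by
    have h1 : ∀ t : U ⊗[ℂ] U, (adj U u).lTensor U t = (b * kk t * b') u := by
      intro t
      induction t with
      | zero =>
        rw [convMul_const]
        simp
      | add p d hp hd =>
        rw [map_add, hp, hd]
        simp only [kk, convMul_const]
        simp [(Coalgebra.Repr.arbitrary ℂ u).convMul_apply, mul_add, add_mul,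
          Finset.sum_add_distrib]
      | tmul p d =>
        have h2 : adj U u d = _ := LinearMap.congr_fun (adj_eq_conv d) u
        rw [LinearMap.lTensor_tmul, h2]
        simp only [kk, convMul_const]
        simp [(Coalgebra.Repr.arbitrary ℂ u).convMul_apply, b, b', jr, TensorProduct.tmul_sum]
    exact (h1 _).symm
  change _ = (a' * toConv (Coalgebra.comul ∘ₗ (adj U).toLinearMap.flip y) * a) u
  rw [had, ← hl]
  refine congrArg (fun f : WithConv (U →ₗ[ℂ] U ⊗[ℂ] U) => f u) ?_
  have e1 : a' * a = 1 := hinv jl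
  calc b * kk (Coalgebra.comul y) * b'
      = (a' * a) * (b * kk (Coalgebra.comul y) * b') * (a' * a) := by rw [e1, one_mul, mul_one]
    _ = _ := by simp only [mul_assoc]

theorem comul_mem_range (y : locFin U) :
    Coalgebra.comul (R := ℂ) (y : U) ∈ LinearMap.range ((locFin U).subtype.lTensor U) := by
  obtain ⟨y, hy⟩ := y
  let N := LinearMap.range ((adj U).toLinearMap.flip y)
  have hfin : FiniteDimensional ℂ N := hy
  let b := Module.finBasis ℂ N
  obtain ⟨D, hD, hND⟩ := TensorProduct.exists_finite_submodule_right_of_setFinite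
    (Set.range fun i => Coalgebra.comul (R := ℂ) (b i : U)) (Set.finite_range _)
  have hNP : ∀ z ∈ N, Coalgebra.comul (R := ℂ) z ∈ LinearMap.range (D.subtype.lTensor U) := by
    intro z hz
    have h1 : z = ∑ i, b.repr ⟨z, hz⟩ i • (b i : U) := by
      have := congrArg Subtype.val (b.sum_repr ⟨z, hz⟩)
      rw [Submodule.coe_sum] at this
      exact this.symm
    rw [h1, map_sum]
    refine Submodule.sum_mem _ fun i _ => ?_
    rw [map_smul]
    exact Submodule.smul_mem _ _ (hND ⟨i, rfl⟩)
  have hmull : ∀ (x : U), ∀ t ∈ LinearMap.range (D.subtype.lTensor U),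
      (x ⊗ₜ[ℂ] (1 : U)) * t ∈ LinearMap.range (D.subtype.lTensor U) := by
    rintro x _ ⟨s, rfl⟩
    refine ⟨(LinearMap.mulLeft ℂ x).rTensor D s, ?_⟩
    induction s with
    | zero => simp
    | add a c ha hc => simp only [map_add, ha, hc, mul_add]
    | tmul p d => simp
  have hmulr : ∀ (x : U), ∀ t ∈ LinearMap.range (D.subtype.lTensor U),
      t * (x ⊗ₜ[ℂ] (1 : U)) ∈ LinearMap.range (D.subtype.lTensor U) := by
    rintro x _ ⟨s, rfl⟩
    refine ⟨(LinearMap.mulRight ℂ x).rTensor D s, ?_⟩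
    induction s with
    | zero => simp
    | add a c ha hc => simp only [map_add, ha, hc, add_mul]
    | tmul p d => simp
  have hP : ∀ u, (adj U u).lTensor U (Coalgebra.comul y) ∈
      LinearMap.range (D.subtype.lTensor U) := by
    intro u
    rw [comul_conj, (Coalgebra.Repr.arbitrary ℂ u).convMul_apply]
    refine Submodule.sum_mem _ fun i _ => hmulr _ _ ?_
    rw [(Coalgebra.Repr.arbitrary ℂ _).convMul_apply]
    exact Submodule.sum_mem _ fun j _ => hmull _ _ (hNP _ ⟨_, rfl⟩)
  have hg : ∀ g : Module.Dual ℂ U,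
      TensorProduct.lid ℂ U (g.rTensor U (Coalgebra.comul y)) ∈ locFin U := by
    intro g
    refine Submodule.finiteDimensional_of_le (S₂ := D) ?_
    rintro _ ⟨u, rfl⟩
    obtain ⟨s, hs⟩ := hP u
    have e1 : ∀ t : U ⊗[ℂ] U, adj U u (TensorProduct.lid ℂ U (g.rTensor U t)) =
        TensorProduct.lid ℂ U (g.rTensor U ((adj U u).lTensor U t)) := by
      intro t
      induction t with
      | zero => simp
      | add a c ha hc => simp only [map_add, ha, hc]
      | tmul p d => simp
    have e2 : ∀ s : U ⊗[ℂ] D, TensorProduct.lid ℂ U (g.rTensor U (D.subtype.lTensor U s)) ∈ D := by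
      intro s
      induction s with
      | zero => simp
      | add a c ha hc => simpa only [map_add] using add_mem ha hc
      | tmul p d => simpa using D.smul_mem _ d.2
    change adj U u _ ∈ D
    rw [e1, ← hs]
    exact e2 s
  have hex := lTensor_exact (R := ℂ) U (LinearMap.exact_subtype_mkQ (locFin U))
    (locFin U).mkQ_surjective
  refine (hex _).1 ?_
  classical
  let c := Module.Free.chooseBasis ℂ U
  apply (TensorProduct.equivFinsuppOfBasisLeft (N := U ⧸ locFin U) c).injective
  rw [map_zero]
  ext i
  rw [TensorProduct.equivFinsuppOfBasisLeft_apply]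
  have e3 : ∀ t : U ⊗[ℂ] U, TensorProduct.lid ℂ (U ⧸ locFin U)
      ((c.coord i).rTensor _ ((locFin U).mkQ.lTensor U t)) =
      (locFin U).mkQ (TensorProduct.lid ℂ U ((c.coord i).rTensor U t)) := by
    intro t
    induction t with
    | zero => simp
    | add a c ha hc => simp only [map_add, ha, hc]
    | tmul p d => simp
  rw [e3]
  simpa using hg (c.coord i)

end

theorem lTensor_subtype_injective :
    Function.Injective ((locFin U).subtype.lTensor U : U ⊗[ℂ] locFin U →ₗ[ℂ] U ⊗[ℂ] U) :=
  Module.Flat.lTensor_preserves_injective_linearMap _ (locFin U).injective_subtype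

/-- The comultiplication restricts to a map `U' → U ⊗ U'`. -/
def comulLocFin (U : Type u) [Ring U] [HopfAlgebra ℂ U] : locFin U →ₗ[ℂ] U ⊗[ℂ] locFin U :=
  (LinearEquiv.ofInjective ((locFin U).subtype.lTensor U)
      lTensor_subtype_injective).symm.toLinearMap ∘ₗ
    LinearMap.codRestrict _ (Coalgebra.comul ∘ₗ (locFin U).subtype) comul_mem_range

theorem lTensor_comulLocFin (y : locFin U) :
    (locFin U).subtype.lTensor U (comulLocFin U y) = Coalgebra.comul (y : U) := by
  have := LinearEquiv.apply_symm_apply (LinearEquiv.ofInjective ((locFin U).subtype.lTensor U)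
    lTensor_subtype_injective) ⟨_, comul_mem_range y⟩
  exact congrArg Subtype.val this

/-- The inverse `Ξ⁻¹ : H(F, U) = F ⊗ U → D_U` of the isomorphism of `D_U` with the Heisenberg double,
`f ⊗ x ↦ ∑ ad(s⁺)(f) s⁻ x` with `R⁻¹ = ∑ s⁺ ⊗ s⁻`. It is the identity on `U`, and on `F` it
expresses multiplication in `F` through multiplication in `A`. -/
def xiInv (Q : QuasiTriangular U) : RDual U ⊗[ℂ] U →ₗ[ℂ] DU Q :=
  TensorProduct.lift ((LinearMap.mul ℂ (DU Q)).compl₁₂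
    (TensorProduct.lift (LinearMap.mk₂ ℂ
      (fun r s => LinearMap.mulRight ℂ (DU.iU Q s) ∘ₗ DU.iA Q ∘ₗ fAd U r)
      (by intros; ext; simp [add_mul]) (by intros; ext; simp)
      (by intros; ext; simp [mul_add]) (by intros; ext; simp))
      ((Q.R⁻¹ : (U ⊗[ℂ] U)ˣ) : U ⊗[ℂ] U))
    (DU.iU Q))

/-- The right action `∂_▷ : U' → D_U`: the coadjoint map `y ↦ ∑ fᵢ ⊗ yᵢ` with values in `F ⊗ U`,
read in the Heisenberg double, whose factor `U` acts through the antipode: `(x φ)(h) = φ(S(x) h)`.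
So `∂_▷(y) = Ξ⁻¹(∑ fᵢ ⊗ S⁻¹(yᵢ))`, and on the basic module `(∂_▷(y) φ)(h) = φ(h y)`. -/
def rightDer (Q : QuasiTriangular U) : locFin U →ₗ[ℂ] DU Q :=
  xiInv Q ∘ₗ (antipodeInv U).lTensor (RDual U) ∘ₗ coad U

/-- The adjoint map `ad : U' → D_U`, `ad(x) = ∂_◁(x₁) ∂_▷(x₂)`. -/
def adD (Q : QuasiTriangular U) : locFin U →ₗ[ℂ] DU Q :=
  TensorProduct.lift ((LinearMap.mul ℂ (DU Q)).compl₁₂ (DU.iU Q) (rightDer Q)) ∘ₗ comulLocFin U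

/-! ### The operators on `V^{⊗n} ⊗ M` -/

section Operators

/-- The action of `U` on a `U`-module. -/
abbrev actV (U : Type u) [Ring U] [HopfAlgebra ℂ U] (V : Type v) [AddCommGroup V] [Module ℂ V]
    [Module U V] [IsScalarTower ℂ U V] : U →ₐ[ℂ] Module.End ℂ V :=
  Algebra.lsmul ℂ ℂ V

/-- The braiding `σ_{VV} = τ ∘ R` on `V ⊗ V`. -/
def braiding (Q : QuasiTriangular U) (V : Type v) [AddCommGroup V] [Module ℂ V]
    [Module U V] [IsScalarTower ℂ U V] : Module.End ℂ (V ⊗[ℂ] V) :=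
  (TensorProduct.comm ℂ V V).toLinearMap ∘ₗ
    Module.endTensorEndAlgHom (R := ℂ) (S := ℂ) (A := ℂ) (M := V) (N := V)
      (Algebra.TensorProduct.map (actV U V) (actV U V) (Q.R : U ⊗[ℂ] U))

/-- The space `V^{⊗n} ⊗ M`. Its tensor factors are numbered from right to left,
`vₙ ⊗ ⋯ ⊗ v₁ ⊗ m`, with `M` at position `0`; the index `i : Fin n` stands for position `i + 1`. -/
abbrev TensorSpace (V : Type v) [AddCommGroup V] [Module ℂ V] (n : ℕ)
    (M : Type w) [AddCommGroup M] [Module ℂ M] : Type (max v w) :=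
  (⨂[ℂ] _ : Fin n, V) ⊗[ℂ] M

variable (V : Type v) [AddCommGroup V] [Module ℂ V] (n : ℕ)
variable (M : Type w) [AddCommGroup M] [Module ℂ M]

/-- An operator on `V`, acting on the factor `i` of `V^{⊗n} ⊗ M`. -/
def legV (i : Fin n) : Module.End ℂ V →ₗ[ℂ] Module.End ℂ (TensorSpace V n M) :=
  LinearMap.rTensorHom M ∘ₗ
    (PiTensorProduct.mapMultilinear ℂ (fun _ : Fin n => V) (fun _ : Fin n => V)).toLinearMap
      (fun _ => LinearMap.id) i

/-- The flip of the factors `i` and `j`. -/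
def swapV (i j : Fin n) : Module.End ℂ (TensorSpace V n M) :=
  LinearMap.rTensor M
    (PiTensorProduct.reindex ℂ (fun _ : Fin n => V) (Equiv.swap i j)).toLinearMap

/-- `x ⊗ y ↦ α(x) β(y)`, for linear maps `α`, `β` with values in operators. -/
def place {X : Type*} {Y : Type*} {Z : Type*} [AddCommGroup X] [Module ℂ X] [AddCommGroup Y]
    [Module ℂ Y] [AddCommGroup Z] [Module ℂ Z] (α : X →ₗ[ℂ] Module.End ℂ Z)
    (β : Y →ₗ[ℂ] Module.End ℂ Z) : X ⊗[ℂ] Y →ₗ[ℂ] Module.End ℂ Z :=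
  TensorProduct.lift ((LinearMap.mul ℂ (Module.End ℂ Z)).compl₁₂ α β)

variable (Q : QuasiTriangular U) [Module U V] [IsScalarTower ℂ U V] [FiniteDimensional ℂ V]
variable [Module (DU Q) M] [IsScalarTower ℂ (DU Q) M]

/-- `U` acting on the factor `i` of `V^{⊗n} ⊗ M`. -/
def legU (U : Type u) [Ring U] [HopfAlgebra ℂ U] (V : Type v) [AddCommGroup V] [Module ℂ V]
    [Module U V] [IsScalarTower ℂ U V] (n : ℕ) (M : Type w) [AddCommGroup M] [Module ℂ M]
    (i : Fin n) : U →ₗ[ℂ] Module.End ℂ (TensorSpace V n M) :=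
  legV V n M i ∘ₗ (actV U V).toLinearMap

/-- `D_U` acting on the factor `M` of `V^{⊗n} ⊗ M`. -/
def legM : DU Q →ₗ[ℂ] Module.End ℂ (TensorSpace V n M) :=
  LinearMap.lTensorHom (⨂[ℂ] _ : Fin n, V) ∘ₗ (Algebra.lsmul ℂ ℂ M).toLinearMap

/-- The operator `T_{i+1} = σ_{i+2,i+1}`, the braiding of the adjacent factors at these positions. -/
def opT (i : ℕ) (h : i + 1 < n) : Module.End ℂ (TensorSpace V n M) :=
  swapV V n M ⟨i, by omega⟩ ⟨i + 1, h⟩ *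
    place (legU U V n M ⟨i + 1, h⟩) (legU U V n M ⟨i, by omega⟩) (Q.R : U ⊗[ℂ] U)

/-- `Y₁ = R₀₁ R₁₀`, the double braiding of the last factor `V` with `M` (on which `U` acts through
`∂_◁`), and `Y_{i+1} = T_i Y_i T_i`. The index `i` stands for `Y_{i+1}`. -/
def opY : (i : ℕ) → i < n → Module.End ℂ (TensorSpace V n M)
  | 0, h =>
    place (legM V n M Q ∘ₗ DU.iU Q) (legU U V n M ⟨0, h⟩) (Q.R : U ⊗[ℂ] U) *
      place (legU U V n M ⟨0, h⟩) (legM V n M Q ∘ₗ DU.iU Q) (Q.R : U ⊗[ℂ] U)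
  | i + 1, h => opT V n M Q i h * opY i (by omega) * opT V n M Q i h

/-- `X₁ = L₀₁`, where `L(v) = ∑ₖ eₖ ⊗ c_{eₖ*, v}` is the coaction of `A` on `V`, i.e.
`L = ∑ₖₗ E_{kl} ⊗ c_{eₖ*, eₗ}` with `E_{kl} eₗ = eₖ`; and `X_{i+1} = T_i X_i T_i`. The index `i`
stands for `X_{i+1}`. -/
def opX : (i : ℕ) → i < n → Module.End ℂ (TensorSpace V n M)
  | 0, h => ∑ k, ∑ l,
    legV V n M ⟨0, h⟩
        (((Module.finBasis ℂ V).coord l).smulRight (Module.finBasis ℂ V k)) *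
      legM V n M Q (DU.iA Q (fCoeff U ((Module.finBasis ℂ V).coord k) (Module.finBasis ℂ V l)))
  | i + 1, h => opT V n M Q i h * opX i (by omega) * opT V n M Q i h

/-- The action of `x ∈ U'` on `v_k ⊗ ⋯ ⊗ v₁ ⊗ m`, with `U` acting on `V` as given and `U'` on `M` by
the adjoint action: `x₁ v_k ⊗ ⋯ ⊗ x_k v₁ ⊗ ad(x_{k+1}) m`. -/
def totalAd : (k : ℕ) → k ≤ n → locFin U →ₗ[ℂ] Module.End ℂ (TensorSpace V n M)
  | 0, _ => legM V n M Q ∘ₗ adD Q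
  | k + 1, h => place (legU U V n M ⟨k, h⟩) (totalAd k (by omega)) ∘ₗ comulLocFin U

/-- The space `W = (V^{⊗n} ⊗ M)^{inv}`. -/
def invariants : Submodule ℂ (TensorSpace V n M) where
  carrier := {z | ∀ x : locFin U,
    totalAd V n M Q n le_rfl x z = Coalgebra.counit (R := ℂ) (x : U) • z}
  zero_mem' := by intro x; simp
  add_mem' := by
    intro a b ha hb x
    rw [map_add, ha x, hb x, smul_add]
  smul_mem' := by
    intro c a ha x
    rw [map_smul, ha x, smul_comm]

end Operators

end Hopf

/-! ### The elliptic braid group and the double affine Hecke algebra -/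

/-- The generators of the elliptic braid group: `X i`, `Y i`, `T i` stand for `X_{i+1}`, `Y_{i+1}`,
`T_{i+1}`. -/
inductive EllGen (n : ℕ) : Type
  | X (i : Fin n) : EllGen n
  | Y (i : Fin n) : EllGen n
  | T (i : ℕ) (h : i + 1 < n) : EllGen n

namespace EllGen

variable {n : ℕ}

/-- `X_{i+1}` in the free group. -/
def fX (i : Fin n) : FreeGroup (EllGen n) := FreeGroup.of (X i)

/-- `Y_{i+1}` in the free group. -/
def fY (i : Fin n) : FreeGroup (EllGen n) := FreeGroup.of (Y i)

/-- `T_{i+1}` in the free group. -/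
def fT (i : ℕ) (h : i + 1 < n) : FreeGroup (EllGen n) := FreeGroup.of (T i h)

/-- The word `Ỹ = Y₁ Y₂ ⋯ Yₙ`. -/
def fYtot (n : ℕ) : FreeGroup (EllGen n) := (List.ofFn (fun i : Fin n => fY i)).prod

end EllGen

open EllGen in
/-- The defining relations of the elliptic braid group. -/
inductive EllRel (n : ℕ) : FreeGroup (EllGen n) → FreeGroup (EllGen n) → Prop
  | XX (i j : Fin n) : EllRel n (fX i * fX j) (fX j * fX i)
  | YY (i j : Fin n) : EllRel n (fY i * fY j) (fY j * fY i)
  | braid (i : ℕ) (h : i + 2 < n) :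
      EllRel n (fT i (by omega) * fT (i + 1) h * fT i (by omega))
        (fT (i + 1) h * fT i (by omega) * fT (i + 1) h)
  | far (i j : ℕ) (hi : i + 1 < n) (hj : j + 1 < n) (hij : i + 2 ≤ j) :
      EllRel n (fT i hi * fT j hj) (fT j hj * fT i hi)
  | TXT (i : ℕ) (h : i + 1 < n) :
      EllRel n (fT i h * fX ⟨i, by omega⟩ * fT i h) (fX ⟨i + 1, h⟩)
  | TYT (i : ℕ) (h : i + 1 < n) :
      EllRel n (fT i h * fY ⟨i, by omega⟩ * fT i h) (fY ⟨i + 1, h⟩)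
  | TX (i : ℕ) (h : i + 1 < n) (j : Fin n) (h1 : (j : ℕ) ≠ i) (h2 : (j : ℕ) ≠ i + 1) :
      EllRel n (fT i h * fX j) (fX j * fT i h)
  | TY (i : ℕ) (h : i + 1 < n) (j : Fin n) (h1 : (j : ℕ) ≠ i) (h2 : (j : ℕ) ≠ i + 1) :
      EllRel n (fT i h * fY j) (fY j * fT i h)
  | XY (h : 0 + 1 < n) :
      EllRel n (fX ⟨0, by omega⟩ * fY ⟨1, h⟩)
        (fY ⟨1, h⟩ * fX ⟨0, by omega⟩ * fT 0 h ^ 2)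
  | YtotX (i : Fin n) : EllRel n (fYtot n * fX i) (fX i * fYtot n)

/-- The elliptic braid group `B_n^{Ell}`. -/
abbrev EllBraid (n : ℕ) : Type :=
  PresentedGroup {r : FreeGroup (EllGen n) | ∃ a b, EllRel n a b ∧ r = a * b⁻¹}

namespace EllBraid

variable {n : ℕ}

/-- The element `X_{i+1}` of the elliptic braid group. -/
def X (i : Fin n) : EllBraid n := PresentedGroup.of (EllGen.X i)

/-- The element `Y_{i+1}` of the elliptic braid group. -/
def Y (i : Fin n) : EllBraid n := PresentedGroup.of (EllGen.Y i)

/-- The element `T_{i+1}` of the elliptic braid group. -/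
def T (i : ℕ) (h : i + 1 < n) : EllBraid n := PresentedGroup.of (EllGen.T i h)

end EllBraid

/-- The Hecke relations `(T_i - q⁻¹ t)(T_i + q⁻¹ t⁻¹) = 0` in the group algebra. -/
inductive DAHARel (n : ℕ) (q t : ℂ) :
    MonoidAlgebra ℂ (EllBraid n) → MonoidAlgebra ℂ (EllBraid n) → Prop
  | hecke (i : ℕ) (h : i + 1 < n) : DAHARel n q t
      ((MonoidAlgebra.of ℂ _ (EllBraid.T i h) - algebraMap ℂ _ (q⁻¹ * t)) *
        (MonoidAlgebra.of ℂ _ (EllBraid.T i h) + algebraMap ℂ _ (q⁻¹ * t⁻¹))) 0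

/-- The double affine Hecke algebra, the quotient of the group algebra `ℂ B_n^{Ell}` by the Hecke
relations. -/
def DAHA (n : ℕ) (q t : ℂ) : Type := RingQuot (DAHARel n q t)

instance (n : ℕ) (q t : ℂ) : Ring (DAHA n q t) :=
  inferInstanceAs (Ring (RingQuot (DAHARel n q t)))

instance (n : ℕ) (q t : ℂ) : Algebra ℂ (DAHA n q t) :=
  inferInstanceAs (Algebra ℂ (RingQuot (DAHARel n q t)))

/-- The quotient map from the group algebra of the elliptic braid group. -/
def DAHA.mk (n : ℕ) (q t : ℂ) : MonoidAlgebra ℂ (EllBraid n) →ₐ[ℂ] DAHA n q t :=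
  RingQuot.mkAlgHom ℂ (DAHARel n q t)

end QuantumD

end

/-! Everything is done in one calculus. For representations α, β of `U` in an algebra with commuting
images, `rOp Q α β` is (α ⊗ β)(R) and `cv α β` is the tensor product representation x ↦ α(x₁)β(x₂).
The axioms of R become the hexagon identities `rOp_cv_left`, `rOp_cv_right`, the intertwining
property `rOp_mul_cv` and, from these, the Yang–Baxter equation.

On V^{⊗n} ⊗ M the commuting representations are those on the tensor factors, with ∂_◁ at position 0.
The operator Y at position i is then the double braiding of that factor with the tensor product of
all factors to its right (`opY_eq_yOp`), and the relations between the T's and Y's are formal.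

The same calculus governs D_U. An identity with a variable a ∈ F is an equality of linear maps F →
D_U. Precomposition with the two actions of `U` on F and right multiplication by `U` in D_U are
commuting representations by right operators on such maps. The twist ξ(f) = ∑ ad(s⁺)(f) s⁻ is
multiplicative for the product of F (`xi_mul`) and turns the cross relation into that of the
Heisenberg double (`cross_xi`). There ∂_▷ commutes with ∂_◁ (`iU_rightDer`) and obeys a Leibniz rule
(`rightDer_cross`); untwisting gives ad(x)a = ∑ (ad(x₁)a) ad(x₂) for a ∈ A (`adD_cross`).

The operator X₁ is the contraction `lam` of the canonical element ∑ f ⊗ e ∈ F ⊗ End V with the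
inclusion A → D_U. As the canonical element represents the action map U → End V, the left and right
actions on F become multiplications by the action of `U` on V. So each identity in D_U yields one
for X₁: `adD_cross` shows that X₁ commutes with U' (`cvL_mul_lam_iA`), the product of A gives the
reflection equation (`reflection_equation`), the cross relation gives X₁Y₂ = Y₂X₁T₁²
(`lam_mul_doubleBraiding`), and multiplicativity of ξ together with the antipode gives invertibility
(`isUnit_lam_iA`). The remaining relations for the X's follow in the braid group from the reflection
equation (`braid_commute`).

The relation between Ỹ and X_i needs invariance. By Δ(ν) = (R₂₁R)⁻¹(ν ⊗ ν), the product Ỹ times the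
diagonal action of the ribbon element ν on V^{⊗n} ⊗ M is the action of ν on each factor separately.
On an invariant vector the diagonal action of ν equals ∂_▷(S(ν)) = ∂_▷(ν) = ∂_◁(ν), so Ỹ acts there
as ν ⊗ ⋯ ⊗ ν on V^{⊗n} (`yProd_apply_invariants`), and this commutes with every X_i because ν is
central. -/

noncomputable section

namespace QuantumD

/-! ### Products of linear maps into an algebra -/

section Pl

variable {X Y Z B : Type*} [AddCommGroup X] [Module ℂ X] [AddCommGroup Y] [Module ℂ Y]
  [AddCommGroup Z] [Module ℂ Z] [Ring B] [Algebra ℂ B]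

/-- `x ⊗ y ↦ α(x) β(y)`, for linear maps `α`, `β` with values in an algebra. -/
def pl (α : X →ₗ[ℂ] B) (β : Y →ₗ[ℂ] B) : X ⊗[ℂ] Y →ₗ[ℂ] B :=
  TensorProduct.lift ((LinearMap.mul ℂ B).compl₁₂ α β)

@[simp] theorem pl_tmul (α : X →ₗ[ℂ] B) (β : Y →ₗ[ℂ] B) (x : X) (y : Y) :
    pl α β (x ⊗ₜ y) = α x * β y := rfl

/-- Two linear maps into an algebra have commuting images. -/
def Cm (α : X →ₗ[ℂ] B) (β : Y →ₗ[ℂ] B) : Prop := ∀ x y, α x * β y = β y * α x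

theorem Cm.symm {α : X →ₗ[ℂ] B} {β : Y →ₗ[ℂ] B} (h : Cm α β) : Cm β α := fun y x => (h x y).symm

theorem Cm.comp_left {α : X →ₗ[ℂ] B} {β : Y →ₗ[ℂ] B} (h : Cm α β) (f : Z →ₗ[ℂ] X) :
    Cm (α ∘ₗ f) β := fun z y => h (f z) y

theorem Cm.comp_right {α : X →ₗ[ℂ] B} {β : Y →ₗ[ℂ] B} (h : Cm α β) (f : Z →ₗ[ℂ] Y) :
    Cm α (β ∘ₗ f) := fun x z => h x (f z)

theorem pl_commute {α : X →ₗ[ℂ] B} {β : Y →ₗ[ℂ] B} {c : B} (hα : ∀ x, α x * c = c * α x)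
    (hβ : ∀ y, β y * c = c * β y) (t : X ⊗[ℂ] Y) : pl α β t * c = c * pl α β t := by
  induction t with
  | zero => simp
  | add a b ha hb => simp only [map_add, add_mul, mul_add, ha, hb]
  | tmul x y => rw [pl_tmul, mul_assoc, hβ, ← mul_assoc, hα, mul_assoc]

theorem Cm.pl_left {α : X →ₗ[ℂ] B} {β : Y →ₗ[ℂ] B} {γ : Z →ₗ[ℂ] B} (h1 : Cm α γ) (h2 : Cm β γ) :
    Cm (pl α β) γ := fun t z => pl_commute (fun x => h1 x z) (fun y => h2 y z) t

theorem pl_comm {α : X →ₗ[ℂ] B} {β : Y →ₗ[ℂ] B} (h : Cm α β) (t : Y ⊗[ℂ] X) :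
    pl α β (TensorProduct.comm ℂ Y X t) = pl β α t := by
  induction t with
  | zero => simp
  | add a b ha hb => simp only [map_add, ha, hb]
  | tmul y x => simp [h x y]

theorem pl_conj {α α' : X →ₗ[ℂ] B} {β β' : Y →ₗ[ℂ] B} {c : B} (hα : ∀ x, c * α x = α' x * c)
    (hβ : ∀ y, c * β y = β' y * c) (t : X ⊗[ℂ] Y) : c * pl α β t = pl α' β' t * c := by
  induction t with
  | zero => simp
  | add a b ha hb => simp only [map_add, add_mul, mul_add, ha, hb]
  | tmul x y => rw [pl_tmul, pl_tmul, ← mul_assoc, hα, mul_assoc, hβ, mul_assoc]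

@[simp] theorem pl_zero_left (β : Y →ₗ[ℂ] B) (t : X ⊗[ℂ] Y) : pl (0 : X →ₗ[ℂ] B) β t = 0 := by
  induction t with
  | zero => simp
  | add a b ha hb => rw [map_add, ha, hb, add_zero]
  | tmul x y => simp

@[simp] theorem pl_zero_right (α : X →ₗ[ℂ] B) (t : X ⊗[ℂ] Y) : pl α (0 : Y →ₗ[ℂ] B) t = 0 := by
  induction t with
  | zero => simp
  | add a b ha hb => rw [map_add, ha, hb, add_zero]
  | tmul x y => simp

theorem pl_add_left (α α' : X →ₗ[ℂ] B) (β : Y →ₗ[ℂ] B) (t : X ⊗[ℂ] Y) :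
    pl (α + α') β t = pl α β t + pl α' β t := by
  induction t with
  | zero => simp
  | add a b ha hb => simp only [map_add, ha, hb]; abel
  | tmul x y => simp [add_mul]

theorem pl_add_right (α : X →ₗ[ℂ] B) (β β' : Y →ₗ[ℂ] B) (t : X ⊗[ℂ] Y) :
    pl α (β + β') t = pl α β t + pl α β' t := by
  induction t with
  | zero => simp
  | add a b ha hb => simp only [map_add, ha, hb]; abel
  | tmul x y => simp [mul_add]

end Pl

/-! ### Algebra homomorphisms as a property of linear maps -/

/-- A linear map between algebras is unital and multiplicative. -/
structure IsHom {X B : Type*} [Ring X] [Algebra ℂ X] [Ring B] [Algebra ℂ B] (α : X →ₗ[ℂ] B) :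
    Prop where
  one : α 1 = 1
  mul : ∀ x y, α (x * y) = α x * α y

theorem isHom_algHom {X B : Type*} [Ring X] [Algebra ℂ X] [Ring B] [Algebra ℂ B]
    (f : X →ₐ[ℂ] B) : IsHom f.toLinearMap := ⟨map_one f, map_mul f⟩

theorem IsHom.comp {X B C : Type*} [Ring X] [Algebra ℂ X] [Ring B] [Algebra ℂ B] [Ring C]
    [Algebra ℂ C] {β : B →ₗ[ℂ] C} {α : X →ₗ[ℂ] B} (hβ : IsHom β) (hα : IsHom α) :
    IsHom (β ∘ₗ α) :=
  ⟨by simp [hα.one, hβ.one], fun x y => by simp [hα.mul, hβ.mul]⟩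

theorem pl_one {X Y B : Type*} [Ring X] [Algebra ℂ X] [Ring Y] [Algebra ℂ Y] [Ring B] [Algebra ℂ B]
    {α : X →ₗ[ℂ] B} {β : Y →ₗ[ℂ] B} (hα : IsHom α) (hβ : IsHom β) : pl α β 1 = 1 := by
  rw [Algebra.TensorProduct.one_def, pl_tmul, hα.one, hβ.one, mul_one]

theorem pl_mul {X Y B : Type*} [Ring X] [Algebra ℂ X] [Ring Y] [Algebra ℂ Y] [Ring B] [Algebra ℂ B]
    {α : X →ₗ[ℂ] B} {β : Y →ₗ[ℂ] B} (hα : IsHom α) (hβ : IsHom β) (h : Cm α β)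
    (s t : X ⊗[ℂ] Y) : pl α β (s * t) = pl α β s * pl α β t := by
  induction s with
  | zero => simp
  | add a b ha hb => simp only [map_add, add_mul, ha, hb]
  | tmul x y =>
    induction t with
    | zero => simp
    | add a b ha hb => simp only [map_add, mul_add, ha, hb]
    | tmul x' y' =>
      simp only [Algebra.TensorProduct.tmul_mul_tmul, pl_tmul, hα.mul, hβ.mul]
      rw [mul_assoc, ← mul_assoc (α x'), h x' y, mul_assoc, mul_assoc]

/-! ### Convolution -/

section Conv

variable {U : Type u} [Ring U] [HopfAlgebra ℂ U] {B : Type*} [Ring B] [Algebra ℂ B]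

/-- The convolution `x ↦ α(x₁) β(x₂)`. -/
def cv (α β : U →ₗ[ℂ] B) : U →ₗ[ℂ] B := pl α β ∘ₗ Coalgebra.comul

theorem cv_apply (α β : U →ₗ[ℂ] B) (x : U) : cv α β x = pl α β (Coalgebra.comul x) := rfl

/-- The convolution `x ↦ α(x₁) δ(x₂)` for `δ` defined on `U'` only. -/
def cvL (α : U →ₗ[ℂ] B) (δ : locFin U →ₗ[ℂ] B) : locFin U →ₗ[ℂ] B := pl α δ ∘ₗ comulLocFin U

theorem cvL_apply (α : U →ₗ[ℂ] B) (δ : locFin U →ₗ[ℂ] B) (x : locFin U) :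
    cvL α δ x = pl α δ (comulLocFin U x) := rfl

/-- The unit of convolution, `x ↦ ε(x) 1`. -/
def cvOne (U : Type u) [Ring U] [HopfAlgebra ℂ U] (B : Type*) [Ring B] [Algebra ℂ B] :
    U →ₗ[ℂ] B := Algebra.linearMap ℂ B ∘ₗ Coalgebra.counit

@[simp] theorem cvOne_apply (x : U) :
    cvOne U B x = algebraMap ℂ B (Coalgebra.counit (R := ℂ) x) := rfl

theorem cvOne_isHom : IsHom (cvOne U B) := ⟨by simp, fun x y => by simp⟩

theorem cm_cvOne {X : Type*} [AddCommGroup X] [Module ℂ X] (α : X →ₗ[ℂ] B) : Cm α (cvOne U B) :=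
  fun _ _ => (Algebra.commutes _ _).symm

theorem Cm.cv_left {Z : Type*} [AddCommGroup Z] [Module ℂ Z] {α β : U →ₗ[ℂ] B} {γ : Z →ₗ[ℂ] B}
    (h1 : Cm α γ) (h2 : Cm β γ) : Cm (cv α β) γ := (h1.pl_left h2).comp_left _

theorem Cm.cv_right {Z : Type*} [AddCommGroup Z] [Module ℂ Z] {α β : U →ₗ[ℂ] B} {γ : Z →ₗ[ℂ] B}
    (h1 : Cm γ α) (h2 : Cm γ β) : Cm γ (cv α β) := (h1.symm.cv_left h2.symm).symm

theorem Cm.cvL_left {Z : Type*} [AddCommGroup Z] [Module ℂ Z] {α : U →ₗ[ℂ] B}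
    {δ : locFin U →ₗ[ℂ] B} {γ : Z →ₗ[ℂ] B} (h1 : Cm α γ) (h2 : Cm δ γ) : Cm (cvL α δ) γ :=
  (h1.pl_left h2).comp_left _

theorem cv_isHom {α β : U →ₗ[ℂ] B} (hα : IsHom α) (hβ : IsHom β) (h : Cm α β) : IsHom (cv α β) :=
  ⟨by rw [cv_apply, Bialgebra.comul_one, pl_one hα hβ],
   fun x y => by rw [cv_apply, Bialgebra.comul_mul, pl_mul hα hβ h]; rfl⟩

theorem pl_assoc {X Y Z : Type*} [AddCommGroup X] [Module ℂ X] [AddCommGroup Y] [Module ℂ Y]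
    [AddCommGroup Z] [Module ℂ Z] (α : X →ₗ[ℂ] B) (β : Y →ₗ[ℂ] B) (γ : Z →ₗ[ℂ] B) :
    pl (pl α β) γ = pl α (pl β γ) ∘ₗ (TensorProduct.assoc ℂ X Y Z).toLinearMap := by
  ext x y z
  simp [mul_assoc]

theorem pl_comp_left {X Y Z : Type*} [AddCommGroup X] [Module ℂ X] [AddCommGroup Y] [Module ℂ Y]
    [AddCommGroup Z] [Module ℂ Z] (α : X →ₗ[ℂ] B) (β : Y →ₗ[ℂ] B) (f : Z →ₗ[ℂ] X) :
    pl (α ∘ₗ f) β = pl α β ∘ₗ f.rTensor Y := by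
  ext x y
  simp

theorem pl_comp_right {X Y Z : Type*} [AddCommGroup X] [Module ℂ X] [AddCommGroup Y] [Module ℂ Y]
    [AddCommGroup Z] [Module ℂ Z] (α : X →ₗ[ℂ] B) (β : Y →ₗ[ℂ] B) (f : Z →ₗ[ℂ] Y) :
    pl α (β ∘ₗ f) = pl α β ∘ₗ f.lTensor X := by
  ext x y
  simp

theorem pl_cv_left (α β γ : U →ₗ[ℂ] B) (t : U ⊗[ℂ] U) : pl (cv α β) γ t =
    pl α (pl β γ) (TensorProduct.assoc ℂ U U U (Coalgebra.comul.rTensor U t)) := by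
  rw [cv, pl_comp_left, pl_assoc]
  rfl

theorem pl_cv_right (α β γ : U →ₗ[ℂ] B) (t : U ⊗[ℂ] U) : pl α (cv β γ) t =
    pl α (pl β γ) (Coalgebra.comul.lTensor U t) := by
  rw [cv, pl_comp_right]
  rfl

theorem cv_assoc (α β γ : U →ₗ[ℂ] B) : cv (cv α β) γ = cv α (cv β γ) := by
  ext x
  rw [cv_apply, pl_cv_left, cv_apply, pl_cv_right, Coalgebra.coassoc_apply]

theorem cvOne_cv (α : U →ₗ[ℂ] B) : cv (cvOne U B) α = α := by
  ext x
  rw [cv_apply, cvOne, pl_comp_left, LinearMap.comp_apply, Coalgebra.rTensor_counit_comul]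
  simp

theorem cv_cvOne (α : U →ₗ[ℂ] B) : cv α (cvOne U B) = α := by
  ext x
  rw [cv_apply, cvOne, pl_comp_right, LinearMap.comp_apply, Coalgebra.lTensor_counit_comul]
  simp

theorem lTensor_comulLocFin_comp :
    (locFin U).subtype.lTensor U ∘ₗ comulLocFin U = Coalgebra.comul ∘ₗ (locFin U).subtype :=
  LinearMap.ext lTensor_comulLocFin

/-- U' is only a left coideal, so coassociativity has to be pulled back from `U`, along U ⊗ U ⊗ U' →
U ⊗ U ⊗ U, which is injective by flatness. -/
theorem comulLocFin_coassoc (y : locFin U) :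
    TensorProduct.assoc ℂ U U (locFin U) (Coalgebra.comul.rTensor _ (comulLocFin U y)) =
      (comulLocFin U).lTensor U (comulLocFin U y) := by
  have hinj : Function.Injective (((locFin U).subtype.lTensor U).lTensor U) :=
    Module.Flat.lTensor_preserves_injective_linearMap _ lTensor_subtype_injective
  apply hinj
  rw [← LinearMap.comp_apply (LinearMap.lTensor U _) (LinearMap.lTensor U _),
    ← LinearMap.lTensor_comp, lTensor_comulLocFin_comp, LinearMap.lTensor_comp,
    LinearMap.comp_apply, lTensor_comulLocFin, ← Coalgebra.coassoc_apply, ← lTensor_comulLocFin]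
  have h : ∀ t : U ⊗[ℂ] locFin U, ((locFin U).subtype.lTensor U).lTensor U
      (TensorProduct.assoc ℂ U U (locFin U) (Coalgebra.comul.rTensor _ t)) =
      TensorProduct.assoc ℂ U U U (Coalgebra.comul.rTensor U ((locFin U).subtype.lTensor U t)) := by
    intro t
    induction t with
    | zero => simp
    | add a b ha hb => simp only [map_add, ha, hb]
    | tmul x y =>
      have h : ∀ s : U ⊗[ℂ] U, ((locFin U).subtype.lTensor U).lTensor U
          (TensorProduct.assoc ℂ U U (locFin U) (s ⊗ₜ y)) =
          TensorProduct.assoc ℂ U U U (s ⊗ₜ (y : U)) := by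
        intro s
        induction s with
        | zero => simp
        | add a b ha hb => simp only [map_add, TensorProduct.add_tmul, ha, hb]
        | tmul a b => simp
      simpa using h _
  exact h _

theorem cvL_assoc (α β : U →ₗ[ℂ] B) (δ : locFin U →ₗ[ℂ] B) :
    cvL (cv α β) δ = cvL α (cvL β δ) := by
  ext x
  rw [cvL_apply, cvL_apply, cvL, cv, pl_comp_left, pl_comp_right, pl_assoc, LinearMap.comp_apply,
    LinearMap.comp_apply, LinearMap.comp_apply, ← comulLocFin_coassoc]
  rfl

theorem rTensor_counit_comulLocFin (y : locFin U) :
    Coalgebra.counit.rTensor (locFin U) (comulLocFin U y) = (1 : ℂ) ⊗ₜ[ℂ] y := by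
  have hinj : Function.Injective ((locFin U).subtype.lTensor ℂ) :=
    Module.Flat.lTensor_preserves_injective_linearMap _ (locFin U).injective_subtype
  apply hinj
  have h : (locFin U).subtype.lTensor ℂ (Coalgebra.counit.rTensor (locFin U) (comulLocFin U y)) =
      Coalgebra.counit.rTensor U ((locFin U).subtype.lTensor U (comulLocFin U y)) := by
    rw [← LinearMap.comp_apply, LinearMap.lTensor_comp_rTensor, ← LinearMap.rTensor_comp_lTensor,
      LinearMap.comp_apply]
  rw [h, lTensor_comulLocFin, Coalgebra.rTensor_counit_comul]
  simp

theorem cvOne_cvL (δ : locFin U →ₗ[ℂ] B) : cvL (cvOne U B) δ = δ := by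
  ext x
  rw [cvL_apply, cvOne, pl_comp_left, LinearMap.comp_apply, rTensor_counit_comulLocFin]
  simp

theorem cvL_subtype (α β : U →ₗ[ℂ] B) :
    cvL α (β ∘ₗ (locFin U).subtype) = cv α β ∘ₗ (locFin U).subtype := by
  ext x
  rw [cvL_apply, pl_comp_right, LinearMap.comp_apply, lTensor_comulLocFin]
  rfl

/-! ### Universal `R`-matrices in an algebra -/

variable (Q : QuasiTriangular U)

/-- The image of the universal `R`-matrix under `α ⊗ β`. -/
def rOp (α β : U →ₗ[ℂ] B) : B := pl α β (Q.R : U ⊗[ℂ] U)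

/-- The image of the inverse of the universal `R`-matrix under `α ⊗ β`. -/
def rInv (α β : U →ₗ[ℂ] B) : B := pl α β ((Q.R⁻¹ : (U ⊗[ℂ] U)ˣ) : U ⊗[ℂ] U)

variable {Q}

theorem rOp_mul_rInv {α β : U →ₗ[ℂ] B} (hα : IsHom α) (hβ : IsHom β) (h : Cm α β) :
    rOp Q α β * rInv Q α β = 1 := by
  rw [rOp, rInv, ← pl_mul hα hβ h, Units.mul_inv, pl_one hα hβ]

theorem rInv_mul_rOp {α β : U →ₗ[ℂ] B} (hα : IsHom α) (hβ : IsHom β) (h : Cm α β) :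
    rInv Q α β * rOp Q α β = 1 := by
  rw [rOp, rInv, ← pl_mul hα hβ h, Units.inv_mul, pl_one hα hβ]

/-- This is (Δ ⊗ id)R = R₁₃R₂₃. Both factors meet in the third leg, so γ must be multiplicative, and
β must pass γ; nothing is required of α. -/
theorem rOp_cv_left {α β γ : U →ₗ[ℂ] B} (hγ : IsHom γ) (h : Cm β γ) :
    rOp Q (cv α β) γ = rOp Q α γ * rOp Q β γ := by
  have key : ∀ s t : U ⊗[ℂ] U, pl α (pl β γ) (leg13 U s * leg23 U t) = pl α γ s * pl β γ t := by
    intro s t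
    induction s with
    | zero => simp
    | add a b ha hb => simp only [map_add, add_mul, ha, hb]
    | tmul x y =>
      induction t with
      | zero => simp
      | add a b ha hb => simp only [map_add, mul_add, ha, hb]
      | tmul x' y' =>
        simp only [leg13, leg23, Algebra.TensorProduct.map_tmul, AlgHom.id_apply,
          Algebra.TensorProduct.includeRight_apply, Algebra.TensorProduct.tmul_mul_tmul, pl_tmul,
          mul_one, one_mul, hγ.mul]
        rw [← mul_assoc (β x'), h x' y]
        simp only [mul_assoc]
  rw [rOp, pl_cv_left, Q.comul_left, key]
  rfl

theorem rOp_cv_right {α β γ : U →ₗ[ℂ] B} (hα : IsHom α) (h : Cm α γ) (h' : Cm β γ) :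
    rOp Q α (cv β γ) = rOp Q α γ * rOp Q α β := by
  have key : ∀ s t : U ⊗[ℂ] U, pl α (pl β γ) (leg13 U s * leg12 U t) = pl α γ s * pl α β t := by
    intro s t
    induction s with
    | zero => simp
    | add a b ha hb => simp only [map_add, add_mul, ha, hb]
    | tmul x y =>
      induction t with
      | zero => simp
      | add a b ha hb => simp only [map_add, mul_add, ha, hb]
      | tmul x' y' =>
        simp only [leg13, leg12, Algebra.TensorProduct.map_tmul, AlgHom.id_apply,
          Algebra.TensorProduct.includeRight_apply, Algebra.TensorProduct.includeLeft_apply,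
          Algebra.TensorProduct.tmul_mul_tmul, pl_tmul, mul_one, one_mul, hα.mul]
        rw [h' y' y, mul_assoc, ← mul_assoc (α x'), h x' y]
        simp only [mul_assoc]
  rw [rOp, pl_cv_right, Q.comul_right, key]
  rfl

-- Apply the algebra homomorphism Δ ⊗ id to the unit R and invert; the order of the two legs is
-- reversed.
variable (Q) in
theorem comul_left_inv : TensorProduct.assoc ℂ U U U
    ((Coalgebra.comul (R := ℂ) (A := U)).rTensor U ((Q.R⁻¹ : (U ⊗[ℂ] U)ˣ) : U ⊗[ℂ] U)) =
      leg23 U (Q.R⁻¹ : (U ⊗[ℂ] U)ˣ) * leg13 U (Q.R⁻¹ : (U ⊗[ℂ] U)ˣ) := by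
  let f : U ⊗[ℂ] U →ₐ[ℂ] U ⊗[ℂ] (U ⊗[ℂ] U) :=
    (Algebra.TensorProduct.assoc ℂ ℂ ℂ U U U).toAlgHom.comp
      (Algebra.TensorProduct.map (Bialgebra.comulAlgHom ℂ U) (AlgHom.id ℂ U))
  have hf : ∀ t : U ⊗[ℂ] U, f t = TensorProduct.assoc ℂ U U U
      ((Coalgebra.comul (R := ℂ) (A := U)).rTensor U t) := fun t => rfl
  have h1 : Units.map f.toMonoidHom Q.R =
      Units.map (leg13 U).toMonoidHom Q.R * Units.map (leg23 U).toMonoidHom Q.R :=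
    Units.ext ((hf _).trans Q.comul_left)
  have h2 := congrArg (fun z : (U ⊗[ℂ] (U ⊗[ℂ] U))ˣ => ((z⁻¹ : _ˣ) : U ⊗[ℂ] (U ⊗[ℂ] U))) h1
  simp only [mul_inv_rev, ← map_inv] at h2
  exact h2

variable (Q) in
theorem comul_right_inv' :
    (Coalgebra.comul (R := ℂ) (A := U)).lTensor U ((Q.R⁻¹ : (U ⊗[ℂ] U)ˣ) : U ⊗[ℂ] U) =
      leg12 U (Q.R⁻¹ : (U ⊗[ℂ] U)ˣ) * leg13 U (Q.R⁻¹ : (U ⊗[ℂ] U)ˣ) := by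
  let f : U ⊗[ℂ] U →ₐ[ℂ] U ⊗[ℂ] (U ⊗[ℂ] U) :=
      (Algebra.TensorProduct.map (AlgHom.id ℂ U) (Bialgebra.comulAlgHom ℂ U))
  have hf : ∀ t : U ⊗[ℂ] U, f t = 
      ((Coalgebra.comul (R := ℂ) (A := U)).lTensor U t) := fun t => rfl
  have h1 : Units.map f.toMonoidHom Q.R =
      Units.map (leg13 U).toMonoidHom Q.R * Units.map (leg12 U).toMonoidHom Q.R :=
    Units.ext ((hf _).trans Q.comul_right)
  have h2 := congrArg (fun z : (U ⊗[ℂ] (U ⊗[ℂ] U))ˣ => ((z⁻¹ : _ˣ) : U ⊗[ℂ] (U ⊗[ℂ] U))) h1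
  simp only [mul_inv_rev, ← map_inv] at h2
  exact h2

theorem rInv_cv_left {α β γ : U →ₗ[ℂ] B} (hγ : IsHom γ) (h : Cm α β) (h' : Cm α γ) :
    rInv Q (cv α β) γ = rInv Q β γ * rInv Q α γ := by
  have key : ∀ s t : U ⊗[ℂ] U, pl α (pl β γ) (leg23 U s * leg13 U t) = pl β γ s * pl α γ t := by
    intro s t
    induction s with
    | zero => simp
    | add a b ha hb => simp only [map_add, add_mul, ha, hb]
    | tmul x y =>
      induction t with
      | zero => simp
      | add a b ha hb => simp only [map_add, mul_add, ha, hb]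
      | tmul x' y' =>
        simp only [leg13, leg23, Algebra.TensorProduct.map_tmul, AlgHom.id_apply,
          Algebra.TensorProduct.includeRight_apply, Algebra.TensorProduct.tmul_mul_tmul, pl_tmul,
          mul_one, one_mul, hγ.mul]
        rw [← mul_assoc, h x' x, mul_assoc, ← mul_assoc (α x'), h' x' y]
        simp only [mul_assoc]
  rw [rInv, pl_cv_left, comul_left_inv, key]
  rfl

theorem rInv_cv_right {α β γ : U →ₗ[ℂ] B} (hα : IsHom α) (h : Cm α β) :
    rInv Q α (cv β γ) = rInv Q α β * rInv Q α γ := by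
  have key : ∀ s t : U ⊗[ℂ] U, pl α (pl β γ) (leg12 U s * leg13 U t) = pl α β s * pl α γ t := by
    intro s t
    induction s with
    | zero => simp
    | add a b ha hb => simp only [map_add, add_mul, ha, hb]
    | tmul x y =>
      induction t with
      | zero => simp
      | add a b ha hb => simp only [map_add, mul_add, ha, hb]
      | tmul x' y' =>
        simp only [leg13, leg12, Algebra.TensorProduct.map_tmul, AlgHom.id_apply,
          Algebra.TensorProduct.includeRight_apply, Algebra.TensorProduct.includeLeft_apply,
          Algebra.TensorProduct.tmul_mul_tmul, pl_tmul, mul_one, one_mul, hα.mul]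
        rw [mul_assoc, ← mul_assoc (α x'), h x' y]
        simp only [mul_assoc]
  rw [rInv, pl_cv_right, comul_right_inv', key]
  rfl

theorem rOp_mul_cv {α β : U →ₗ[ℂ] B} (hα : IsHom α) (hβ : IsHom β) (h : Cm α β) (x : U) :
    rOp Q α β * cv α β x = cv β α x * rOp Q α β := by
  rw [cv_apply, rOp, ← pl_mul hα hβ h, Q.mul_comul, pl_mul hα hβ h, pl_comm h]
  rfl

/-- R reverses the coproduct on its own two legs; a third leg, here defined on U' only, is untouched
because it commutes with both. -/
theorem rOp_mul_cvL {α β : U →ₗ[ℂ] B} {δ : locFin U →ₗ[ℂ] B} (hα : IsHom α) (hβ : IsHom β)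
    (h : Cm α β) (hαδ : Cm α δ) (hβδ : Cm β δ) (x : locFin U) :
    rOp Q α β * cvL (cv α β) δ x = cvL (cv β α) δ x * rOp Q α β :=
  pl_conj (rOp_mul_cv hα hβ h)
    (fun y => pl_commute (fun x => hαδ x y) (fun x => hβδ x y) _) _

theorem cv_mul_rInv {α β : U →ₗ[ℂ] B} (hα : IsHom α) (hβ : IsHom β) (h : Cm α β) (x : U) :
    cv α β x * rInv Q α β = rInv Q α β * cv β α x := by
  calc cv α β x * rInv Q α β = rInv Q α β * (rOp Q α β * cv α β x) * rInv Q α β := by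
        rw [← mul_assoc, rInv_mul_rOp hα hβ h, one_mul]
    _ = _ := by
        rw [rOp_mul_cv hα hβ h, mul_assoc, mul_assoc, rOp_mul_rInv hα hβ h, mul_one]

/-- By the hexagon the last two factors are R between α ⊗ β and γ, and the first factor intertwines
α ⊗ β with β ⊗ α. -/
theorem rOp_yangBaxter {α β γ : U →ₗ[ℂ] B} (hα : IsHom α) (hβ : IsHom β) (hγ : IsHom γ)
    (hαβ : Cm α β) (hαγ : Cm α γ) (hβγ : Cm β γ) :
    rOp Q α β * rOp Q α γ * rOp Q β γ = rOp Q β γ * rOp Q α γ * rOp Q α β := by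
  rw [mul_assoc, ← rOp_cv_left hγ hβγ, ← rOp_cv_left hγ hαγ, rOp, rOp, rOp]
  exact pl_conj (rOp_mul_cv hα hβ hαβ)
    (fun y => (pl_commute (fun x => hαγ x y) (fun x => hβγ x y) _)) _

theorem rInv_yangBaxter {α β γ : U →ₗ[ℂ] B} (hα : IsHom α) (hβ : IsHom β) (hγ : IsHom γ)
    (hαβ : Cm α β) (hαγ : Cm α γ) (hβγ : Cm β γ) :
    rInv Q β γ * rInv Q α γ * rInv Q α β = rInv Q α β * rInv Q α γ * rInv Q β γ := by
  refine left_inv_eq_right_inv (a := rOp Q α β * rOp Q α γ * rOp Q β γ) ?_ ?_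
  · simp only [mul_assoc]
    rw [← mul_assoc (rInv Q α β), rInv_mul_rOp hα hβ hαβ, one_mul,
      ← mul_assoc (rInv Q α γ), rInv_mul_rOp hα hγ hαγ, one_mul, rInv_mul_rOp hβ hγ hβγ]
  · rw [rOp_yangBaxter hα hβ hγ hαβ hαγ hβγ]
    simp only [mul_assoc]
    rw [← mul_assoc (rOp Q α β), rOp_mul_rInv hα hβ hαβ, one_mul,
      ← mul_assoc (rOp Q α γ), rOp_mul_rInv hα hγ hαγ, one_mul, rOp_mul_rInv hβ hγ hβγ]

theorem rOp_commute {α β : U →ₗ[ℂ] B} {c : B} (hα : ∀ x, α x * c = c * α x)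
    (hβ : ∀ y, β y * c = c * β y) : rOp Q α β * c = c * rOp Q α β := pl_commute hα hβ _

theorem rInv_commute {α β : U →ₗ[ℂ] B} {c : B} (hα : ∀ x, α x * c = c * α x)
    (hβ : ∀ y, β y * c = c * β y) : rInv Q α β * c = c * rInv Q α β := pl_commute hα hβ _

/-- The trivial representation is idempotent for convolution, so by the hexagon (ε ⊗ id)R is
idempotent; being invertible, it is 1. -/
theorem rOp_cvOne_left {γ : U →ₗ[ℂ] B} (hγ : IsHom γ) : rOp Q (cvOne U B) γ = 1 := by
  have h := rOp_cv_left (Q := Q) (α := cvOne U B) (β := cvOne U B) hγ (cm_cvOne γ).symm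
  rw [cvOne_cv] at h
  have h1 := rOp_mul_rInv (Q := Q) cvOne_isHom hγ (cm_cvOne γ).symm
  calc rOp Q (cvOne U B) γ = rOp Q (cvOne U B) γ * (rOp Q (cvOne U B) γ * rInv Q (cvOne U B) γ) := by
        rw [h1, mul_one]
    _ = 1 := by rw [← mul_assoc, ← h, h1]

theorem rInv_cvOne_left {γ : U →ₗ[ℂ] B} (hγ : IsHom γ) : rInv Q (cvOne U B) γ = 1 := by
  have h1 := rOp_mul_rInv (Q := Q) cvOne_isHom hγ (cm_cvOne γ).symm
  rwa [rOp_cvOne_left hγ, one_mul] at h1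

theorem rInv_cvOne_right {γ : U →ₗ[ℂ] B} (hγ : IsHom γ) : rInv Q γ (cvOne U B) = 1 := by
  have h := rInv_cv_right (Q := Q) (β := cvOne U B) (γ := cvOne U B) hγ (cm_cvOne γ)
  rw [cvOne_cv] at h
  have h1 := rOp_mul_rInv (Q := Q) hγ cvOne_isHom (cm_cvOne γ)
  have h2 := congrArg (rOp Q γ (cvOne U B) * ·) h
  simp only [← mul_assoc] at h2
  rw [h1, one_mul] at h2
  exact h2.symm

/-! ### The antipode and the `R`-matrix -/

/-- The antipode as a linear map. -/
abbrev anti (U : Type u) [Ring U] [HopfAlgebra ℂ U] : U →ₗ[ℂ] U := HopfAlgebra.antipode ℂ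

theorem cv_anti_left {α : U →ₗ[ℂ] B} (hα : IsHom α) : cv (α ∘ₗ anti U) α = cvOne U B := by
  ext x
  have h : ∀ t : U ⊗[ℂ] U, pl (α ∘ₗ anti U) α t =
      α (LinearMap.mul' ℂ U ((anti U).rTensor U t)) := by
    intro t
    induction t with
    | zero => simp
    | add a b ha hb => simp only [map_add, ha, hb]
    | tmul a b => simp [hα.mul]
  rw [cv_apply, h, HopfAlgebra.mul_antipode_rTensor_comul_apply, Algebra.algebraMap_eq_smul_one,
    map_smul, hα.one, cvOne_apply, Algebra.algebraMap_eq_smul_one]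

theorem cv_anti_right {α : U →ₗ[ℂ] B} (hα : IsHom α) : cv α (α ∘ₗ anti U) = cvOne U B := by
  ext x
  have h : ∀ t : U ⊗[ℂ] U, pl α (α ∘ₗ anti U) t =
      α (LinearMap.mul' ℂ U ((anti U).lTensor U t)) := by
    intro t
    induction t with
    | zero => simp
    | add a b ha hb => simp only [map_add, ha, hb]
    | tmul a b => simp [hα.mul]
  rw [cv_apply, h, HopfAlgebra.mul_antipode_lTensor_comul_apply, Algebra.algebraMap_eq_smul_one,
    map_smul, hα.one, cvOne_apply, Algebra.algebraMap_eq_smul_one]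

/-- α ∘ S is the convolution inverse of α, so the hexagon makes its R-matrix the inverse one. -/
theorem rOp_anti_left {α γ : U →ₗ[ℂ] B} (hα : IsHom α) (hγ : IsHom γ) (h : Cm α γ) :
    rOp Q (α ∘ₗ anti U) γ = rInv Q α γ := by
  refine left_inv_eq_right_inv (a := rOp Q α γ) ?_ (rOp_mul_rInv hα hγ h)
  rw [← rOp_cv_left hγ h, cv_anti_left hα, rOp_cvOne_left hγ]

theorem rInv_anti_right {α γ : U →ₗ[ℂ] B} (hα : IsHom α) (hγ : IsHom γ) (h : Cm α γ) :
    rInv Q α (γ ∘ₗ anti U) = rOp Q α γ := by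
  refine left_inv_eq_right_inv (a := rInv Q α γ) ?_ (rInv_mul_rOp hα hγ h)
  rw [← rInv_cv_right hα (h.comp_right _), cv_anti_left hγ, rInv_cvOne_right hα]

theorem rOp_anti_anti_tensor : pl ((Algebra.TensorProduct.includeLeft (R := ℂ) (S := ℂ) (A := U)
      (B := U)).toLinearMap ∘ₗ anti U)
    ((Algebra.TensorProduct.includeRight (R := ℂ) (A := U) (B := U)).toLinearMap ∘ₗ anti U)
      (Q.R : U ⊗[ℂ] U) = Q.R := by
  set jl := (Algebra.TensorProduct.includeLeft (R := ℂ) (S := ℂ) (A := U) (B := U)).toLinearMap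
  set jr := (Algebra.TensorProduct.includeRight (R := ℂ) (A := U) (B := U)).toLinearMap
  have hl : IsHom jl := isHom_algHom _
  have hr : IsHom jr := isHom_algHom _
  have hlr : Cm jl jr := fun x y => by simp [jl, jr]
  have hid : ∀ t : U ⊗[ℂ] U, pl jl jr t = t := by
    intro t
    induction t with
    | zero => simp
    | add a b ha hb => simp only [map_add, ha, hb]
    | tmul a b => simp [jl, jr]
  have hS := rOp_anti_left (Q := Q) hl hr hlr
  have hS' := rInv_anti_right (Q := Q) hl hr hlr
  have h1 : ∀ t : U ⊗[ℂ] U, pl (jl ∘ₗ anti U) (jr ∘ₗ anti U) t =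
      pl jl (jr ∘ₗ anti U) (pl (jl ∘ₗ anti U) jr t) := by
    intro t
    induction t with
    | zero => simp
    | add a b ha hb => simp only [map_add, ha, hb]
    | tmul a b => simp [jl, jr]
  rw [rOp, rInv, hid] at hS
  rw [rInv, rOp, hid] at hS'
  rw [h1, hS, hS']

variable (Q) in
theorem rTensor_lTensor_anti :
    (anti U).rTensor U ((anti U).lTensor U (Q.R : U ⊗[ℂ] U)) = Q.R := by
  conv_rhs => rw [← rOp_anti_anti_tensor (Q := Q)]
  generalize (Q.R : U ⊗[ℂ] U) = t
  induction t with
  | zero => simp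
  | add a b ha hb => simp only [map_add, ha, hb]
  | tmul a b => simp

/-- Since (S ⊗ S)R = R was established in U ⊗ U itself, neither multiplicativity nor commutation of
α and γ is needed. -/
theorem rOp_anti_anti (α γ : U →ₗ[ℂ] B) :
    rOp Q (α ∘ₗ anti U) (γ ∘ₗ anti U) = rOp Q α γ := by
  rw [rOp, pl_comp_left, pl_comp_right, LinearMap.comp_apply, LinearMap.comp_apply,
    ← LinearMap.comp_apply (LinearMap.lTensor _ _), LinearMap.lTensor_comp_rTensor,
    ← LinearMap.rTensor_comp_lTensor, LinearMap.comp_apply, rTensor_lTensor_anti]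
  rfl

end Conv

/-! ### Right actions -/

section RightAction

variable {X Y H : Type*} [AddCommGroup X] [Module ℂ X] [AddCommGroup Y] [Module ℂ Y]
  [AddCommGroup H] [Module ℂ H]

/-- The opposite of the endomorphism algebra of `H`, acting on `H` from the right. -/
def ROp (H : Type*) [AddCommGroup H] [Module ℂ H] : Type _ := (Module.End ℂ H)ᵐᵒᵖ

instance : Ring (ROp H) := inferInstanceAs (Ring (Module.End ℂ H)ᵐᵒᵖ)

instance : Algebra ℂ (ROp H) := inferInstanceAs (Algebra ℂ (Module.End ℂ H)ᵐᵒᵖ)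

/-- The endomorphism underlying a right operator. -/
def ROp.toEnd : ROp H →ₗ[ℂ] H →ₗ[ℂ] H := (MulOpposite.opLinearEquiv ℂ).symm.toLinearMap

/-- The right action of right operators. -/
def ract (m : H) : ROp H →ₗ[ℂ] H := LinearMap.applyₗ m ∘ₗ ROp.toEnd

theorem ract_mul (m : H) (b c : ROp H) : ract m (b * c) = ract (ract m b) c := rfl

@[simp] theorem ract_one (m : H) : ract m (1 : ROp H) = m := rfl

theorem ROp.ext {b c : ROp H} (h : ∀ m, ract m b = ract m c) : b = c :=
  MulOpposite.unop_injective (LinearMap.ext h)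

/-- A linear map into endomorphisms, read as right operators. -/
def opL (f : X →ₗ[ℂ] H →ₗ[ℂ] H) : X →ₗ[ℂ] ROp H :=
  (MulOpposite.opLinearEquiv ℂ : Module.End ℂ H ≃ₗ[ℂ] (Module.End ℂ H)ᵐᵒᵖ).toLinearMap ∘ₗ f

@[simp] theorem ract_opL (f : X →ₗ[ℂ] H →ₗ[ℂ] H) (m : H) (x : X) : ract m (opL f x) = f x m := rfl

/-- In a product of right operators the left factor acts first, so agreement on the single vector m
survives multiplication by any β on the right. -/
theorem ract_pl_congr {m : H} {α α' : X →ₗ[ℂ] ROp H}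
    (h : ∀ x, ract m (α x) = ract m (α' x)) (β : Y →ₗ[ℂ] ROp H) (t : X ⊗[ℂ] Y) :
    ract m (pl α β t) = ract m (pl α' β t) := by
  induction t with
  | zero => simp
  | add a b ha hb => simp only [map_add, ha, hb]
  | tmul x y => rw [pl_tmul, pl_tmul, ract_mul, ract_mul, h]

end RightAction

/-! ### The Drinfeld element and the inverse of the antipode -/

section Drinfeld

variable {U : Type u} [Ring U] [HopfAlgebra ℂ U] (Q : QuasiTriangular U)

/-- `a ⊗ b ↦ S(b) w a`. -/
def sandwich (w : U) : U ⊗[ℂ] U →ₗ[ℂ] U :=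
  TensorProduct.lift (LinearMap.mk₂ ℂ (fun a b => anti U b * w * a)
    (by intros; simp [mul_add]) (by intros; simp)
    (by intros; simp [add_mul]) (by intros; simp))

@[simp] theorem sandwich_tmul (w a b : U) : sandwich w (a ⊗ₜ b) = anti U b * w * a := rfl

/-- The Drinfeld element `∑ S(r⁻) r⁺`. -/
def drinfeld : U := sandwich 1 (Q.R : U ⊗[ℂ] U)

theorem sandwich_mul (s t : U ⊗[ℂ] U) : sandwich 1 (s * t) = sandwich (sandwich 1 s) t := by
  induction t with
  | zero => simp
  | add a b ha hb => simp only [mul_add, map_add, ha, hb]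
  | tmul x y =>
    induction s with
    | zero => simp [sandwich_tmul]
    | add a b ha hb => simp only [add_mul, map_add, ha, hb, sandwich_tmul, mul_add]
    | tmul a b => simp [HopfAlgebra.antipode_mul_antidistrib, mul_assoc]

/-- The flipped coproduct puts S(x₁)x₂ in the middle of the sandwich, where it collapses to ε(x). -/
theorem sandwich_comm_comul_mul (x : U) (s : U ⊗[ℂ] U) :
    sandwich 1 (TensorProduct.comm ℂ U U (Coalgebra.comul x) * s) =
      Coalgebra.counit (R := ℂ) x • sandwich 1 s := by
  induction s with
  | zero => simp
  | add a b ha hb => simp only [mul_add, map_add, ha, hb, smul_add]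
  | tmul a b =>
    have h : ∀ t : U ⊗[ℂ] U, sandwich 1 (TensorProduct.comm ℂ U U t * a ⊗ₜ b) =
        anti U b * LinearMap.mul' ℂ U ((anti U).rTensor U t) * a := by
      intro t
      induction t with
      | zero => simp
      | add a b ha hb => simp only [map_add, add_mul, mul_add, ha, hb]
      | tmul c d => simp [HopfAlgebra.antipode_mul_antidistrib, mul_assoc]
    rw [h, HopfAlgebra.mul_antipode_rTensor_comul_apply]
    simp [Algebra.algebraMap_eq_smul_one]

theorem sandwich_drinfeld_comul (x : U) :
    sandwich (drinfeld Q) (Coalgebra.comul x) = Coalgebra.counit (R := ℂ) x • drinfeld Q := by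
  rw [drinfeld, ← sandwich_mul, Q.mul_comul, sandwich_comm_comul_mul]

/-- The axiom RΔ = ΔᵒᵖR gives S(x₂)ux₁ = ε(x)u. In right operators this says that the convolution of
"multiply by x on the right" and "multiply by S(x) on the left" is trivial on u. Convolving with the
inverse of the second factor leaves ux = S²(x)u. -/
theorem anti_anti_mul_drinfeld (x : U) :
    anti U (anti U x) * drinfeld Q = drinfeld Q * x := by
  let τ : U →ₗ[ℂ] ROp U := opL (LinearMap.mul ℂ U).flip
  let σ : U →ₗ[ℂ] ROp U := opL (LinearMap.mul ℂ U ∘ₗ anti U)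
  have hσ : IsHom σ := by
    constructor
    · exact ROp.ext fun y => by simp [σ]
    · exact fun a b => ROp.ext fun y => by
        simp [σ, ract_mul, HopfAlgebra.antipode_mul_antidistrib, mul_assoc]
  have h1 : ∀ x, ract (drinfeld Q) (cv τ σ x) = ract (drinfeld Q) (cvOne U (ROp U) x) := by
    intro x
    have h : ∀ t : U ⊗[ℂ] U, ract (drinfeld Q) (pl τ σ t) = sandwich (drinfeld Q) t := by
      intro t
      induction t with
      | zero => simp
      | add a b ha hb => simp only [map_add, ha, hb]
      | tmul a b => simp [τ, σ, ract_mul, mul_assoc]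
    rw [cv_apply, h, sandwich_drinfeld_comul, cvOne_apply, Algebra.algebraMap_eq_smul_one,
      map_smul, ract_one]
  have h2 := ract_pl_congr h1 (σ ∘ₗ anti U) (Coalgebra.comul x)
  rw [← cv_apply, ← cv_apply, cv_assoc, cv_anti_right hσ, cv_cvOne, cvOne_cv] at h2
  simpa [τ, σ] using h2.symm

/-- The inverse `∑ r⁻ S²(r⁺)` of the Drinfeld element. -/
def drinfeldInv : U :=
  pl (B := U) LinearMap.id (anti U ∘ₗ anti U) (TensorProduct.comm ℂ U U (Q.R : U ⊗[ℂ] U))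

theorem lTensor_anti_rInv :
    (anti U).lTensor U ((Q.R⁻¹ : (U ⊗[ℂ] U)ˣ) : U ⊗[ℂ] U) = Q.R := by
  set jl := (Algebra.TensorProduct.includeLeft (R := ℂ) (S := ℂ) (A := U) (B := U)).toLinearMap
    with hjl
  set jr := (Algebra.TensorProduct.includeRight (R := ℂ) (A := U) (B := U)).toLinearMap with hjr
  have hid : ∀ t : U ⊗[ℂ] U, pl jl jr t = t := by
    intro t
    induction t with
    | zero => simp
    | add a b ha hb => simp only [map_add, ha, hb]
    | tmul a b => simp [hjl, hjr]
  have h := rInv_anti_right (Q := Q) (isHom_algHom _) (isHom_algHom _)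
    (fun x y => by simp [hjl, hjr] : Cm jl jr)
  rwa [rOp, rInv, pl_comp_right, LinearMap.comp_apply, hid, hid] at h

/-- Write R = (id ⊗ S)R⁻¹ in the first factor and move S² across u: the result is the sandwich of
RR⁻¹ = 1. -/
theorem drinfeldInv_mul : drinfeldInv Q * drinfeld Q = 1 := by
  have h1 : ∀ t : U ⊗[ℂ] U,
      pl (B := U) LinearMap.id (anti U ∘ₗ anti U) (TensorProduct.comm ℂ U U
        ((anti U).lTensor U t)) * drinfeld Q = sandwich (drinfeld Q) t := by
    intro t
    induction t with
    | zero => simp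
    | add a b ha hb => simp only [map_add, add_mul, ha, hb]
    | tmul a b =>
      have := anti_anti_mul_drinfeld Q a
      simp only [LinearMap.lTensor_tmul, TensorProduct.comm_tmul, pl_tmul, LinearMap.id_apply,
        LinearMap.comp_apply, sandwich_tmul, mul_assoc, this]
  have h2 := h1 ((Q.R⁻¹ : (U ⊗[ℂ] U)ˣ) : U ⊗[ℂ] U)
  rw [lTensor_anti_rInv] at h2
  rw [drinfeldInv, h2, drinfeld, ← sandwich_mul, Units.mul_inv, Algebra.TensorProduct.one_def]
  simp

theorem anti_anti_drinfeldInv : anti U (anti U (drinfeldInv Q)) = drinfeldInv Q := by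
  have h1 : ∀ t : U ⊗[ℂ] U, anti U (anti U (pl (B := U) LinearMap.id (anti U ∘ₗ anti U)
      (TensorProduct.comm ℂ U U t))) =
      pl (B := U) LinearMap.id (anti U ∘ₗ anti U) (TensorProduct.comm ℂ U U
        ((anti U).rTensor U ((anti U).lTensor U ((anti U).rTensor U ((anti U).lTensor U t))))) := by
    intro t
    induction t with
    | zero => simp
    | add a b ha hb => simp only [map_add, ha, hb]
    | tmul a b => simp [HopfAlgebra.antipode_mul_antidistrib]
  rw [drinfeldInv, h1, rTensor_lTensor_anti, rTensor_lTensor_anti]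

/-- As (S ⊗ S)R = R, the left inverse is fixed by S²; moving it across u makes it a right inverse.
-/
theorem drinfeld_mul_inv : drinfeld Q * drinfeldInv Q = 1 := by
  rw [← anti_anti_mul_drinfeld, anti_anti_drinfeldInv, drinfeldInv_mul]

theorem anti_bijective (Q : QuasiTriangular U) : Function.Bijective (anti U) := by
  have h1 := drinfeldInv_mul Q
  have h2 := drinfeld_mul_inv Q
  have key : ∀ x, anti U (anti U x) = drinfeld Q * x * drinfeldInv Q := by
    intro x
    rw [← anti_anti_mul_drinfeld, mul_assoc, h2, mul_one]
  constructor
  · intro x y hxy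
    have h3 : drinfeld Q * x * drinfeldInv Q = drinfeld Q * y * drinfeldInv Q := by
      rw [← key, ← key, hxy]
    have h4 := congrArg (fun z => drinfeldInv Q * z * drinfeld Q) h3
    simp only [mul_assoc, h1, mul_one] at h4
    simpa only [← mul_assoc, h1, one_mul] using h4
  · intro y
    refine ⟨anti U (drinfeldInv Q * y * drinfeld Q), ?_⟩
    rw [key]
    simp only [mul_assoc, h2, mul_one]
    rw [← mul_assoc, h2, one_mul]

/-- `Ring.inverse` returns 0 on a non-unit, so `antipodeInv` is meaningful only because S² is inner
and hence S bijective. -/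
theorem anti_antipodeInv (Q : QuasiTriangular U) (x : U) : anti U (antipodeInv U x) = x := by
  have h : IsUnit (anti U : Module.End ℂ U) := (Module.End.isUnit_iff _).2 (anti_bijective Q)
  exact LinearMap.congr_fun (Ring.mul_inverse_cancel _ h) x

end Drinfeld

/-! ### Operators on spaces of linear maps -/

section PrePost

variable (F N : Type*) [AddCommGroup F] [Module ℂ F] [AddCommGroup N] [Module ℂ N]

/-- Precomposition with endomorphisms, as right operators. -/
def preL : Module.End ℂ F →ₗ[ℂ] ROp (F →ₗ[ℂ] N) := opL (LinearMap.llcomp ℂ F F N).flip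

/-- Postcomposition with right operators. -/
def postL : ROp N →ₗ[ℂ] ROp (F →ₗ[ℂ] N) := opL (LinearMap.llcomp ℂ F N N ∘ₗ ROp.toEnd)

variable {F N}

@[simp] theorem ract_preL (m : F →ₗ[ℂ] N) (φ : Module.End ℂ F) :
    ract m (preL F N φ) = m ∘ₗ φ := rfl

theorem ract_postL (m : F →ₗ[ℂ] N) (c : ROp N) (f : F) :
    ract m (postL F N c) f = ract (m f) c := rfl

theorem preL_isHom : IsHom (preL F N) := ⟨rfl, fun _ _ => rfl⟩

theorem postL_isHom : IsHom (postL F N) := ⟨rfl, fun _ _ => rfl⟩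

theorem preL_postL : Cm (preL F N) (postL F N) := fun _ _ => rfl

variable (B : Type*) [Ring B] [Algebra ℂ B]

/-- Multiplication from the right, as a right operator. -/
def mulR : B →ₗ[ℂ] ROp B := opL (LinearMap.mul ℂ B).flip

/-- Multiplication from the left, as a right operator. -/
def mulL : B →ₗ[ℂ] ROp B := opL (LinearMap.mul ℂ B)

variable {B}

@[simp] theorem ract_mulR (b c : B) : ract b (mulR B c) = b * c := rfl

@[simp] theorem ract_mulL (b c : B) : ract b (mulL B c) = c * b := rfl

theorem mulR_isHom : IsHom (mulR B) :=
  ⟨ROp.ext fun m => by simp, fun a b => ROp.ext fun m => by simp [ract_mul, mul_assoc]⟩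

theorem mulL_mul (a b : B) : mulL B (a * b) = mulL B b * mulL B a :=
  ROp.ext fun m => by simp [ract_mul, mul_assoc]

theorem mulL_mulR : Cm (mulL B) (mulR B) := fun a b => ROp.ext fun m => by
  simp [ract_mul, mul_assoc]

end PrePost

section Dual

variable {U : Type u} [Ring U] [HopfAlgebra ℂ U]

/-! ### The restricted dual -/

/-- Both sides are convolution inverses of Δ, regarded as a map from `U` to the algebra U ⊗ U. -/
theorem comul_anti (x : U) : Coalgebra.comul (R := ℂ) (anti U x) =
    TensorProduct.map (anti U) (anti U) (TensorProduct.comm ℂ U U (Coalgebra.comul x)) := by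
  set jl := (Algebra.TensorProduct.includeLeft (R := ℂ) (S := ℂ) (A := U) (B := U)).toLinearMap
    with hjl
  set jr := (Algebra.TensorProduct.includeRight (R := ℂ) (A := U) (B := U)).toLinearMap with hjr
  have hl : IsHom jl := isHom_algHom _
  have hr : IsHom jr := isHom_algHom _
  have hΔ : cv jl jr = (Bialgebra.comulAlgHom ℂ U).toLinearMap := by
    have hid : ∀ t : U ⊗[ℂ] U, pl jl jr t = t := by
      intro t
      induction t with
      | zero => simp
      | add a b ha hb => simp only [map_add, ha, hb]
      | tmul a b => simp [hjl, hjr]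
    ext x
    exact hid _
  have h1 : cv ((Bialgebra.comulAlgHom ℂ U).toLinearMap ∘ₗ anti U) (cv jl jr) = cvOne U _ := by
    rw [hΔ]
    exact cv_anti_left (isHom_algHom _)
  have h2 : cv (cv jl jr) (cv (jr ∘ₗ anti U) (jl ∘ₗ anti U)) = cvOne U _ := by
    rw [cv_assoc, ← cv_assoc jr, cv_anti_right hr, cvOne_cv, cv_anti_right hl]
  have h3 : (Bialgebra.comulAlgHom ℂ U).toLinearMap ∘ₗ anti U =
      cv (jr ∘ₗ anti U) (jl ∘ₗ anti U) := by
    rw [← cv_cvOne ((Bialgebra.comulAlgHom ℂ U).toLinearMap ∘ₗ anti U), ← h2, ← cv_assoc, h1,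
      cvOne_cv]
  have h4 : ∀ t : U ⊗[ℂ] U, pl (jr ∘ₗ anti U) (jl ∘ₗ anti U) t =
      TensorProduct.map (anti U) (anti U) (TensorProduct.comm ℂ U U t) := by
    intro t
    induction t with
    | zero => simp
    | add a b ha hb => simp only [map_add, ha, hb]
    | tmul a b => simp [hjl, hjr]
  exact (LinearMap.congr_fun h3 x).trans (h4 _)

@[simp] theorem fAct_apply (x y : U) (φ : RDual U) (h : U) :
    (fAct U (x ⊗ₜ y) φ : Module.Dual ℂ U) h = (φ : Module.Dual ℂ U) (anti U x * h * y) := by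
  change (φ : Module.Dual ℂ U) (anti U x * (h * y)) = _
  rw [mul_assoc]

theorem fMul_apply (f g : RDual U) (h : U) : (fMul U f g : Module.Dual ℂ U) h =
    pl (f : Module.Dual ℂ U) (g : Module.Dual ℂ U) (Coalgebra.comul h) := by
  have key : ∀ t : U ⊗[ℂ] U, TensorProduct.dualDistrib ℂ U U
      ((f : Module.Dual ℂ U) ⊗ₜ (g : Module.Dual ℂ U)) t = pl (f : Module.Dual ℂ U) g t := by
    intro t
    induction t with
    | zero => simp
    | add a b ha hb => simp only [map_add, ha, hb]
    | tmul a b => simp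
  exact key _

/-- The left factor of the action of `U ⊗ U` on `F`, `(p φ)(h) = φ(S(p) h)`. -/
def actL (U : Type u) [Ring U] [HopfAlgebra ℂ U] : U →ₗ[ℂ] Module.End ℂ (RDual U) :=
  fAct U ∘ₗ (TensorProduct.mk ℂ U U).flip 1

/-- The right factor of the action of `U ⊗ U` on `F`, `(q φ)(h) = φ(h q)`. -/
def actR (U : Type u) [Ring U] [HopfAlgebra ℂ U] : U →ₗ[ℂ] Module.End ℂ (RDual U) :=
  fAct U ∘ₗ TensorProduct.mk ℂ U U 1

@[simp] theorem actL_apply (p : U) (φ : RDual U) (h : U) :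
    (actL U p φ : Module.Dual ℂ U) h = (φ : Module.Dual ℂ U) (anti U p * h) := by
  simp [actL]

@[simp] theorem actR_apply (q : U) (φ : RDual U) (h : U) :
    (actR U q φ : Module.Dual ℂ U) h = (φ : Module.Dual ℂ U) (h * q) := by
  simp [actR]

theorem actL_isHom : IsHom (B := Module.End ℂ (RDual U)) (actL U) := by
  constructor
  · ext; simp
  · intro a b
    ext
    simp [HopfAlgebra.antipode_mul_antidistrib, mul_assoc]

theorem actR_isHom : IsHom (B := Module.End ℂ (RDual U)) (actR U) := by
  constructor
  · ext; simp
  · intro a b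
    ext
    simp [mul_assoc]

theorem actL_actR : Cm (B := Module.End ℂ (RDual U)) (actL U) (actR U) := by
  intro a b
  ext
  simp [mul_assoc]

theorem pl_actL_actR (t : U ⊗[ℂ] U) : pl (B := Module.End ℂ (RDual U)) (actL U) (actR U) t = fAct U t := by
  induction t with
  | zero => simp
  | add a b ha hb => simp only [map_add, ha, hb]
  | tmul a b =>
    ext
    simp [mul_assoc]

theorem actR_fMul (q : U) (f g : RDual U) : actR U q (fMul U f g) =
    TensorProduct.lift ((fMul U).compl₁₂ ((actR U).flip f) ((actR U).flip g))
      (Coalgebra.comul q) := by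
  ext h
  rw [actR_apply, fMul_apply, Bialgebra.comul_mul]
  generalize (Coalgebra.comul (R := ℂ) q : U ⊗[ℂ] U) = t
  induction t with
  | zero => simp
  | add a b ha hb =>
    simp only [map_add, mul_add, ha, hb, Submodule.coe_add, LinearMap.add_apply]
  | tmul a b =>
    simp only [TensorProduct.lift.tmul, LinearMap.compl₁₂_apply, LinearMap.flip_apply, fMul_apply]
    generalize (Coalgebra.comul (R := ℂ) h : U ⊗[ℂ] U) = s
    induction s with
    | zero => simp
    | add a b ha hb => simp only [map_add, add_mul, ha, hb]
    | tmul c d => simp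

/-- The coproduct appears flipped, in contrast to `actR_fMul`, because the left action goes through
S, which reverses Δ. -/
theorem actL_fMul (p : U) (f g : RDual U) : actL U p (fMul U f g) =
    TensorProduct.lift ((fMul U).compl₁₂ ((actL U).flip f) ((actL U).flip g))
      (TensorProduct.comm ℂ U U (Coalgebra.comul p)) := by
  ext h
  rw [actL_apply, fMul_apply, Bialgebra.comul_mul, comul_anti]
  generalize TensorProduct.comm ℂ U U (Coalgebra.comul (R := ℂ) p : U ⊗[ℂ] U) = t
  induction t with
  | zero => simp
  | add a b ha hb =>
    simp only [map_add, add_mul, ha, hb, Submodule.coe_add, LinearMap.add_apply]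
  | tmul a b =>
    simp only [TensorProduct.lift.tmul, LinearMap.compl₁₂_apply, LinearMap.flip_apply, fMul_apply]
    generalize (Coalgebra.comul (R := ℂ) h : U ⊗[ℂ] U) = s
    induction s with
    | zero => simp
    | add a b ha hb => simp only [map_add, mul_add, ha, hb]
    | tmul c d => simp

/-- Evaluation of the first factor of `F ⊗ Z` at `h`. -/
def evalAt (Z : Type*) [AddCommGroup Z] [Module ℂ Z] (h : U) : RDual U ⊗[ℂ] Z →ₗ[ℂ] Z :=
  TensorProduct.lift (LinearMap.lsmul ℂ Z ∘ₗ LinearMap.applyₗ h ∘ₗ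
    (RDual U).subtype)

@[simp] theorem evalAt_tmul {Z : Type*} [AddCommGroup Z] [Module ℂ Z] (h : U) (f : RDual U)
    (z : Z) : evalAt Z h (f ⊗ₜ z) = (f : Module.Dual ℂ U) h • z := rfl

theorem evalAt_lTensor {Z Z' : Type*} [AddCommGroup Z] [Module ℂ Z] [AddCommGroup Z']
    [Module ℂ Z'] (h : U) (φ : Z →ₗ[ℂ] Z') (t : RDual U ⊗[ℂ] Z) :
    evalAt Z' h (φ.lTensor _ t) = φ (evalAt Z h t) := by
  induction t with
  | zero => simp
  | add a b ha hb => simp only [map_add, ha, hb]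
  | tmul a b => simp

/-- Over a field F ⊗ Z embeds into the linear maps U → Z, as coordinates in a basis of Z show. All
later identities in F ⊗ Z are checked pointwise through this. -/
theorem eq_of_evalAt {Z : Type*} [AddCommGroup Z] [Module ℂ Z] {s t : RDual U ⊗[ℂ] Z}
    (h : ∀ x : U, evalAt Z x s = evalAt Z x t) : s = t := by
  have h1 : Function.Injective ((RDual U).subtype.rTensor Z) :=
    Module.Flat.rTensor_preserves_injective_linearMap _ (RDual U).injective_subtype
  apply h1
  let b := Module.Free.chooseBasis ℂ Z
  classical
  apply (TensorProduct.equivFinsuppOfBasisRight (M := Module.Dual ℂ U) b).injective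
  ext i x
  rw [TensorProduct.equivFinsuppOfBasisRight_apply, TensorProduct.equivFinsuppOfBasisRight_apply]
  have key : ∀ t : RDual U ⊗[ℂ] Z,
      TensorProduct.rid ℂ (Module.Dual ℂ U) ((b.coord i).lTensor _
        ((RDual U).subtype.rTensor Z t)) x = b.coord i (evalAt Z x t) := by
    intro t
    induction t with
    | zero => simp
    | add a c ha hc => simp only [map_add, LinearMap.add_apply, ha, hc]
    | tmul f z => simp [mul_comm]
  rw [key, key, h]

theorem evalAt_eq_evalHom (h : U) (t : RDual U ⊗[ℂ] U) : evalAt U h t = evalHom U t h := by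
  induction t with
  | zero => simp
  | add a c ha hc => simp only [map_add, LinearMap.add_apply, ha, hc]
  | tmul f z => rfl

/-! ### The adjoint action -/

theorem adj_flip_eq_cv (y : U) :
    (adj U).toLinearMap.flip y = cv (LinearMap.mulRight ℂ y) (anti U) := by
  ext x
  have h1 : ∀ t : U ⊗[ℂ] U, Algebra.TensorProduct.lift (Algebra.lmul ℂ U) (mulRightAntipode U)
      (fun a b => by ext y; simp [mulRightAntipode, mul_assoc]) t y =
      pl (LinearMap.mulRight ℂ y) (anti U) t := by
    intro t
    induction t with
    | zero => simp
    | add a c ha hc => simp only [map_add, LinearMap.add_apply, ha, hc]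
    | tmul p d => simp [mulRightAntipode, mul_assoc]
  exact h1 _

/-- In x₁ y S(x₂) x₃ the last two factors cancel. This is what makes ∂_◁ and ∂_▷ commute. -/
theorem cv_adj_id (y : U) : cv ((adj U).toLinearMap.flip y) LinearMap.id =
    LinearMap.mulRight ℂ y := by
  have h := cv_anti_left (U := U) (B := U) (α := LinearMap.id) ⟨rfl, fun _ _ => rfl⟩
  rw [LinearMap.id_comp] at h
  rw [adj_flip_eq_cv, cv_assoc, h, cv_cvOne]

theorem cv_eq_convMul {B : Type u} [Ring B] [Algebra ℂ B] (α β : U →ₗ[ℂ] B) :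
    cv α β = (WithConv.toConv α * WithConv.toConv β).ofConv := by
  ext x
  rw [LinearMap.convMul_def]
  change pl α β _ = LinearMap.mul' ℂ B (TensorProduct.map α β _)
  generalize (Coalgebra.comul (R := ℂ) x : U ⊗[ℂ] U) = t
  induction t with
  | zero => simp
  | add a c ha hc => simp only [map_add, ha, hc]
  | tmul p d => simp

/-- The map `h ↦ (1 ⊗ ad(h)) Δ(y)`. -/
def adComul (y : U) : U →ₗ[ℂ] U ⊗[ℂ] U :=
  (LinearMap.applyₗ (Coalgebra.comul y)) ∘ₗ LinearMap.lTensorHom U ∘ₗ (adj U).toLinearMap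

/-- `comul_conj` with the conjugating factors h ⊗ 1 moved to one side: Δ(ad(h₁)y)(h₂ ⊗ 1) = (h₁ ⊗
1)(id ⊗ ad(h₂))Δ(y). It is the source of the Leibniz rule for ∂_▷. -/
theorem cv_comul_adj (y : U) :
    cv (Coalgebra.comul ∘ₗ (adj U).toLinearMap.flip y)
      (Algebra.TensorProduct.includeLeft (R := ℂ) (S := ℂ) (A := U) (B := U)).toLinearMap =
    cv (Algebra.TensorProduct.includeLeft (R := ℂ) (S := ℂ) (A := U) (B := U)).toLinearMap
      (adComul y) := by
  have h : adComul y = cv (cv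
      ((Algebra.TensorProduct.includeLeft (R := ℂ) (S := ℂ) (A := U) (B := U)).toLinearMap
          ∘ₗ anti U) (Coalgebra.comul ∘ₗ (adj U).toLinearMap.flip y))
        (Algebra.TensorProduct.includeLeft (R := ℂ) (S := ℂ) (A := U) (B := U)).toLinearMap := by
    rw [cv_eq_convMul, cv_eq_convMul]
    exact LinearMap.ext (comul_conj y)
  rw [h, cv_assoc (_ ∘ₗ anti U), ← cv_assoc _ (_ ∘ₗ anti U), cv_anti_right (isHom_algHom _),
    cvOne_cv]

end Dual

/-! ### The algebra `D_U` -/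

section DUAlg

variable {U : Type u} [Ring U] [HopfAlgebra ℂ U] (Q : QuasiTriangular U)

theorem iU_isHom : IsHom (DU.iU Q) := by
  constructor
  · exact (RingQuot.mkAlgHom_rel ℂ (DURel.u_one (Q := Q))).trans (map_one _)
  · intro x y
    exact ((map_mul (DU.mk Q) _ _).symm.trans
      (RingQuot.mkAlgHom_rel ℂ (DURel.u_mul (Q := Q) x y))).symm

theorem iA_one : DU.iA Q (fOne U) = 1 :=
  (RingQuot.mkAlgHom_rel ℂ (DURel.a_one (Q := Q))).trans (map_one _)

theorem iA_mul (a b : RDual U) : DU.iA Q a * DU.iA Q b = DU.iA Q (aMul Q a b) :=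
  (map_mul (DU.mk Q) _ _).symm.trans (RingQuot.mkAlgHom_rel ℂ (DURel.a_mul (Q := Q) a b))

/-! ### Right operators on linear maps out of `F` -/

section Legs

variable (U) (N : Type*) [AddCommGroup N] [Module ℂ N]

/-- Precomposition of `F → N` with the left action of `U` on `F`. -/
def preActL : U →ₗ[ℂ] ROp (RDual U →ₗ[ℂ] N) := preL (RDual U) N ∘ₗ actL U

/-- Precomposition of `F → N` with the right action of `U` on `F`. -/
def preActR : U →ₗ[ℂ] ROp (RDual U →ₗ[ℂ] N) := preL (RDual U) N ∘ₗ actR U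

/-- Precomposition of `F → N` with the adjoint action of `U` on `F`. -/
def preAd : U →ₗ[ℂ] ROp (RDual U →ₗ[ℂ] N) := cv (preActL U N) (preActR U N)

variable {U N}

@[simp] theorem ract_preActL (m : RDual U →ₗ[ℂ] N) (p : U) (a : RDual U) :
    ract m (preActL U N p) a = m (actL U p a) := rfl

@[simp] theorem ract_preActR (m : RDual U →ₗ[ℂ] N) (p : U) (a : RDual U) :
    ract m (preActR U N p) a = m (actR U p a) := rfl

theorem ract_pl_preAct (m : RDual U →ₗ[ℂ] N) (t : U ⊗[ℂ] U) (a : RDual U) :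
    ract m (pl (preActL U N) (preActR U N) t) a = m (fAct U t a) := by
  induction t with
  | zero => simp
  | add a b ha hb => simp only [map_add, LinearMap.add_apply, ha, hb]
  | tmul p q =>
    rw [pl_tmul, ract_mul, ract_preActR, ract_preActL, ← pl_actL_actR]
    rfl

@[simp] theorem ract_preAd (m : RDual U →ₗ[ℂ] N) (x : U) (a : RDual U) :
    ract m (preAd U N x) a = m (fAd U x a) := ract_pl_preAct _ _ _

theorem preActL_isHom : IsHom (preActL U N) := preL_isHom.comp actL_isHom

theorem preActR_isHom : IsHom (preActR U N) := preL_isHom.comp actR_isHom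

theorem preActL_preActR : Cm (preActL U N) (preActR U N) := by
  intro p q
  have h := actL_actR (U := U) p q
  rw [preActL, preActR, LinearMap.comp_apply, LinearMap.comp_apply, ← preL_isHom.mul,
    ← preL_isHom.mul, h]

theorem preAd_isHom : IsHom (preAd U N) := cv_isHom preActL_isHom preActR_isHom preActL_preActR

variable {X : Type*} [AddCommGroup X] [Module ℂ X]

theorem preActL_postL (g : X →ₗ[ℂ] ROp N) :
    Cm (preActL U N) (postL (RDual U) N ∘ₗ g) := fun p x => preL_postL (actL U p) (g x)

theorem preActR_postL (g : X →ₗ[ℂ] ROp N) :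
    Cm (preActR U N) (postL (RDual U) N ∘ₗ g) := fun p x => preL_postL (actR U p) (g x)

theorem preAd_postL (g : X →ₗ[ℂ] ROp N) :
    Cm (preAd U N) (postL (RDual U) N ∘ₗ g) := (preActL_postL g).cv_left (preActR_postL g)

end Legs

/-- Multiplication of `F → D_U` from the right by elements of `D_U`. -/
def postR : DU Q →ₗ[ℂ] ROp (RDual U →ₗ[ℂ] DU Q) :=
  postL (RDual U) (DU Q) ∘ₗ mulR (DU Q)

/-- Multiplication of `F → D_U` from the left by elements of `D_U`. -/
def postM : DU Q →ₗ[ℂ] ROp (RDual U →ₗ[ℂ] DU Q) :=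
  postL (RDual U) (DU Q) ∘ₗ mulL (DU Q)

/-- Multiplication of `F → D_U` from the right by elements of `U`. -/
def postU : U →ₗ[ℂ] ROp (RDual U →ₗ[ℂ] DU Q) := postR Q ∘ₗ DU.iU Q

variable {Q}

@[simp] theorem ract_postR (m : RDual U →ₗ[ℂ] DU Q) (d : DU Q) (a : RDual U) :
    ract m (postR Q d) a = m a * d := rfl

@[simp] theorem ract_postM (m : RDual U →ₗ[ℂ] DU Q) (d : DU Q) (a : RDual U) :
    ract m (postM Q d) a = d * m a := rfl

@[simp] theorem ract_postU (m : RDual U →ₗ[ℂ] DU Q) (x : U) (a : RDual U) :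
    ract m (postU Q x) a = m a * DU.iU Q x := rfl

theorem postR_isHom : IsHom (postR Q) := postL_isHom.comp mulR_isHom

theorem postU_isHom : IsHom (postU Q) := postR_isHom.comp (iU_isHom Q)

theorem postM_mul (a b : DU Q) : postM Q (a * b) = postM Q b * postM Q a := by
  rw [postM, LinearMap.comp_apply, mulL_mul, postL_isHom.mul]
  rfl

theorem postM_postR : Cm (postM Q) (postR Q) := by
  intro a b
  rw [postM, postR, LinearMap.comp_apply, LinearMap.comp_apply, ← postL_isHom.mul,
    ← postL_isHom.mul, mulL_mulR]

theorem preActL_postR : Cm (preActL U (DU Q)) (postR Q) := preActL_postL (mulR (DU Q))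

theorem preActR_postR : Cm (preActR U (DU Q)) (postR Q) := preActR_postL (mulR (DU Q))

theorem preActL_postU : Cm (preActL U (DU Q)) (postU Q) := preActL_postR.comp_right _

theorem preActR_postU : Cm (preActR U (DU Q)) (postU Q) := preActR_postR.comp_right _

theorem preAd_postU : Cm (preAd U (DU Q)) (postU Q) := preActL_postU.cv_left preActR_postU

theorem preActL_postM : Cm (preActL U (DU Q)) (postM Q) := preActL_postL (mulL (DU Q))

theorem preActR_postM : Cm (preActR U (DU Q)) (postM Q) := preActR_postL (mulL (DU Q))

theorem preAd_postM : Cm (preAd U (DU Q)) (postM Q) := preActL_postM.cv_left preActR_postM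

theorem postM_postU : Cm (postM Q) (postU Q) := postM_postR.comp_right _

/-- The defining cross relation, in operator form: the first two legs of R₂₃⁻¹(x₁ ⊗ 1 ⊗ x₂)R₂₃ act
on the variable a ∈ A, the third multiplies from the right. These three actions of `U` commute and
are multiplicative, so the product in U ⊗ U ⊗ U goes to the product of operators. -/
theorem cross_iA (x : U) : ract (DU.iA Q) (postM Q (DU.iU Q x)) =
    ract (DU.iA Q) (rInv Q (preActR U _) (postU Q) *
      (cv (preActL U _) (postU Q) x * rOp Q (preActR U _) (postU Q))) := by
  set α := preActL U (DU Q) with hα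
  set β := preActR U (DU Q) with hβ
  set γ := postU Q with hγ
  have h1 : ∀ t : U ⊗[ℂ] (U ⊗[ℂ] U), ∀ a, DU.mk Q (TensorProduct.lift
      ((LinearMap.mul ℂ (TensorAlgebra ℂ (RDual U × U))).compl₁₂
        (preA U ∘ₗ (fAct U).flip a) (preU U)) ((TensorProduct.assoc ℂ U U U).symm t)) =
      ract (DU.iA Q) (pl α (pl β γ) t) a := by
    intro t a
    induction t with
    | zero => simp
    | add s t hs ht => simp only [map_add, LinearMap.add_apply, hs, ht]
    | tmul p t =>
      induction t with
      | zero => simp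
      | add s t hs ht => simp only [map_add, LinearMap.add_apply, hs, ht, TensorProduct.tmul_add]
      | tmul q r =>
        rw [pl_tmul, pl_tmul, ← mul_assoc, ract_mul, hγ, ract_postU, ← pl_tmul α β, hα, hβ,
          ract_pl_preAct]
        simp only [TensorProduct.assoc_symm_tmul, TensorProduct.lift.tmul,
          LinearMap.compl₁₂_apply, LinearMap.mul_apply', map_mul, LinearMap.comp_apply,
          LinearMap.flip_apply]
        rfl
  have h2 : ∀ t : U ⊗[ℂ] U, pl α (pl β γ) (leg23 U t) = pl β γ t := by
    intro t
    rw [leg23, Algebra.TensorProduct.includeRight_apply, pl_tmul, preActL_isHom.one, one_mul]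
  have h3 : ∀ t : U ⊗[ℂ] U, pl α (pl β γ) (leg13 U t) = pl α γ t := by
    intro t
    induction t with
    | zero => simp
    | add a b ha hb => simp only [map_add, ha, hb]
    | tmul a b => simp [leg13, preActR_isHom.one, hβ]
  have hαβ : Cm α β := preActL_preActR
  have hαγ : Cm α γ := preActL_postU
  have hβγ : Cm β γ := preActR_postU
  have h4 : IsHom (pl β γ) :=
    ⟨pl_one preActR_isHom postU_isHom, pl_mul preActR_isHom postU_isHom hβγ⟩
  have h5 : Cm α (pl β γ) := (hαβ.symm.pl_left hαγ.symm).symm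
  ext a
  rw [ract_postM]
  refine ((map_mul (DU.mk Q) _ _).symm.trans
    ((RingQuot.mkAlgHom_rel ℂ (DURel.cross (Q := Q) x a)).trans (h1 _ _))).trans ?_
  congr 2
  simp only [comulTwo, LinearMap.comp_apply, LinearMap.mulLeft_apply, LinearMap.mulRight_apply]
  rw [pl_mul preActL_isHom h4 h5, pl_mul preActL_isHom h4 h5, h2, h2]
  erw [h3]
  rfl

variable (Q) in
/-- The embedding `F → D_U`, `f ↦ ∑ ad(s⁺)(f) s⁻`, which is multiplicative for the product of `F`. -/
def xi : RDual U →ₗ[ℂ] DU Q := ract (DU.iA Q) (rInv Q (preAd U _) (postU Q))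

theorem xiInv_tmul (f : RDual U) (z : U) : xiInv Q (f ⊗ₜ z) = xi Q f * DU.iU Q z := by
  have h : ∀ t : U ⊗[ℂ] U, (TensorProduct.lift (LinearMap.mk₂ ℂ
      (fun r s => LinearMap.mulRight ℂ (DU.iU Q s) ∘ₗ DU.iA Q ∘ₗ fAd U r)
      (by intros; ext; simp [add_mul]) (by intros; ext; simp)
      (by intros; ext; simp [mul_add]) (by intros; ext; simp)) t) f =
      ract (DU.iA Q) (pl (preAd U _) (postU Q) t) f := by
    intro t
    induction t with
    | zero => simp
    | add s t hs ht => simp only [map_add, LinearMap.add_apply, hs, ht]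
    | tmul r s =>
      rw [pl_tmul, ract_mul, ract_postU, ract_preAd]
      rfl
  rw [xiInv, TensorProduct.lift.tmul, LinearMap.compl₁₂_apply, h]
  rfl

/-- The twist by R⁻¹ is undone by R, so statements proved for ξ transfer back to A. -/
theorem iA_eq_ract_xi : DU.iA Q = ract (xi Q) (rOp Q (preAd U _) (postU Q)) := by
  rw [xi, ← ract_mul, rInv_mul_rOp preAd_isHom postU_isHom preAd_postU, ract_one]

/-- The twist R⁻¹ between ad = L ⊗ R and `U` splits into an R-part and an L-part. The R-part cancels
the conjugation in the cross relation of A, and the L-part reverses the coproduct. What remains is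
the Heisenberg rule xξ(f) = ∑ ξ(x₂f)x₁, with x₂ acting from the left. -/
theorem cross_xi (x : U) : ract (xi Q) (postM Q (DU.iU Q x)) =
    ract (xi Q) (cv (postU Q) (preActL U _) x) := by
  rw [xi, ← ract_mul, ← ract_mul]
  have h : rInv Q (preAd U (DU Q)) (postU Q) * postM Q (DU.iU Q x) =
      postM Q (DU.iU Q x) * rInv Q (preAd U (DU Q)) (postU Q) :=
    rInv_commute (fun y => preAd_postM y _) (fun y => (postM_postU _ y).symm)
  rw [h, ract_mul, cross_iA, ← ract_mul, preAd, rInv_cv_left postU_isHom preActL_preActR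
    preActL_postU]
  congr 1
  simp only [mul_assoc]
  rw [← mul_assoc (rOp Q _ _) (rInv Q _ _), rOp_mul_rInv preActR_isHom postU_isHom preActR_postU,
    one_mul, cv_mul_rInv preActL_isHom postU_isHom preActL_postU]

/-- The counit is invariant under ad, so only (ε ⊗ id)R⁻¹ = 1 contributes. -/
theorem xi_one : xi Q (fOne U) = 1 := by
  have h1 : ∀ x, ract (DU.iA Q) (preAd U _ x) (fOne U) = ract (DU.iA Q) (cvOne U _ x) (fOne U) := by
    intro x
    rw [ract_preAd, cvOne_apply, Algebra.algebraMap_eq_smul_one, map_smul, LinearMap.smul_apply,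
      ract_one, ← map_smul]
    congr 1
    ext h
    rw [fAd, LinearMap.comp_apply]
    have h2 : ∀ t : U ⊗[ℂ] U, (fAct U t (fOne U) : Module.Dual ℂ U) h =
        Coalgebra.counit (R := ℂ) h * pl (Coalgebra.counit (R := ℂ) ∘ₗ anti U)
          (Coalgebra.counit (R := ℂ)) t := by
      intro t
      induction t with
      | zero => simp
      | add s t hs ht => simp only [map_add, LinearMap.add_apply, Submodule.coe_add, hs, ht, mul_add]
      | tmul r s => simp [fOne]; ring
    rw [h2, ← cv_apply]
    have h3 := cv_anti_left (isHom_algHom (Bialgebra.counitAlgHom ℂ U))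
    rw [show cv (Coalgebra.counit (R := ℂ) ∘ₗ anti U) (Coalgebra.counit (R := ℂ)) = _ from h3]
    simp [fOne, mul_comm]
  have h2 : ∀ t : U ⊗[ℂ] U, ract (DU.iA Q) (pl (preAd U _) (postU Q) t) (fOne U) =
      ract (DU.iA Q) (pl (cvOne U _) (postU Q) t) (fOne U) := by
    intro t
    induction t with
    | zero => simp
    | add s t hs ht => simp only [map_add, LinearMap.add_apply, hs, ht]
    | tmul r s => rw [pl_tmul, ract_mul, ract_postU, h1, pl_tmul, ract_mul, ract_postU]
  rw [xi, rInv, h2, ← rInv, rInv_cvOne_left postU_isHom, ract_one, iA_one]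

/-! ### Multiplicativity of the embedding of `F` -/

section TwoVariables

variable (Q)

/-- `(f, g) ↦ φ(f * g)`. -/
def mulPair (φ : RDual U →ₗ[ℂ] DU Q) : RDual U →ₗ[ℂ] RDual U →ₗ[ℂ] DU Q :=
  (fMul U).compr₂ φ

@[simp] theorem mulPair_apply (φ : RDual U →ₗ[ℂ] DU Q) (f g : RDual U) :
    mulPair Q φ f g = φ (fMul U f g) := rfl

/-- `(f, g) ↦ φ(f) ψ(g)`. -/
def prodPair (φ ψ : RDual U →ₗ[ℂ] DU Q) : RDual U →ₗ[ℂ] RDual U →ₗ[ℂ] DU Q :=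
  (LinearMap.mul ℂ (DU Q)).compl₁₂ φ ψ

@[simp] theorem prodPair_apply (φ ψ : RDual U →ₗ[ℂ] DU Q) (f g : RDual U) :
    prodPair Q φ ψ f g = φ f * ψ g := rfl

/-- Operators on the second variable of bilinear maps `F × F → D_U`. -/
abbrev snd2 : ROp (RDual U →ₗ[ℂ] DU Q) →ₗ[ℂ]
    ROp (RDual U →ₗ[ℂ] RDual U →ₗ[ℂ] DU Q) := postL (RDual U) (RDual U →ₗ[ℂ] DU Q)

/-- The left action on the first variable. -/
abbrev fstL : U →ₗ[ℂ] ROp (RDual U →ₗ[ℂ] RDual U →ₗ[ℂ] DU Q) :=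
  preActL U (RDual U →ₗ[ℂ] DU Q)

/-- The right action on the first variable. -/
abbrev fstR : U →ₗ[ℂ] ROp (RDual U →ₗ[ℂ] RDual U →ₗ[ℂ] DU Q) :=
  preActR U (RDual U →ₗ[ℂ] DU Q)

/-- The adjoint action on the first variable. -/
abbrev fstAd : U →ₗ[ℂ] ROp (RDual U →ₗ[ℂ] RDual U →ₗ[ℂ] DU Q) :=
  preAd U (RDual U →ₗ[ℂ] DU Q)

/-- The left action on the second variable. -/
abbrev sndL : U →ₗ[ℂ] ROp (RDual U →ₗ[ℂ] RDual U →ₗ[ℂ] DU Q) :=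
  snd2 Q ∘ₗ preActL U (DU Q)

/-- The right action on the second variable. -/
abbrev sndR : U →ₗ[ℂ] ROp (RDual U →ₗ[ℂ] RDual U →ₗ[ℂ] DU Q) :=
  snd2 Q ∘ₗ preActR U (DU Q)

/-- Multiplication of bilinear maps `F × F → D_U` from the right by elements of `U`. -/
abbrev valU : U →ₗ[ℂ] ROp (RDual U →ₗ[ℂ] RDual U →ₗ[ℂ] DU Q) := snd2 Q ∘ₗ postU Q

variable {Q}

theorem snd2_cv (α β : U →ₗ[ℂ] ROp (RDual U →ₗ[ℂ] DU Q)) :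
    cv (snd2 Q ∘ₗ α) (snd2 Q ∘ₗ β) = snd2 Q ∘ₗ cv α β := by
  ext x : 1
  simp only [cv_apply, LinearMap.comp_apply]
  generalize (Coalgebra.comul (R := ℂ) x : U ⊗[ℂ] U) = t
  induction t with
  | zero => simp
  | add s t hs ht => simp only [map_add, hs, ht]
  | tmul r s => rw [pl_tmul, pl_tmul, postL_isHom.mul]; rfl

theorem snd2_cm {α β : U →ₗ[ℂ] ROp (RDual U →ₗ[ℂ] DU Q)} (h : Cm α β) :
    Cm (snd2 Q ∘ₗ α) (snd2 Q ∘ₗ β) := by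
  intro x y
  rw [LinearMap.comp_apply, LinearMap.comp_apply, ← postL_isHom.mul, h, postL_isHom.mul]

theorem fstL_snd2 (α : U →ₗ[ℂ] ROp (RDual U →ₗ[ℂ] DU Q)) :
    Cm (fstL Q) (snd2 Q ∘ₗ α) := preActL_postL _

theorem fstR_snd2 (α : U →ₗ[ℂ] ROp (RDual U →ₗ[ℂ] DU Q)) :
    Cm (fstR Q) (snd2 Q ∘ₗ α) := preActR_postL _

theorem fstAd_snd2 (α : U →ₗ[ℂ] ROp (RDual U →ₗ[ℂ] DU Q)) :
    Cm (fstAd Q) (snd2 Q ∘ₗ α) := preAd_postL _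

theorem snd2_isHom {α : U →ₗ[ℂ] ROp (RDual U →ₗ[ℂ] DU Q)} (h : IsHom α) :
    IsHom (snd2 Q ∘ₗ α) := postL_isHom.comp h

theorem prodPair_iA : prodPair Q (DU.iA Q) (DU.iA Q) =
    ract (mulPair Q (DU.iA Q)) (rOp Q (fstAd Q) (sndL Q)) := by
  ext f g
  rw [prodPair_apply, iA_mul, aMul, rOp]
  generalize (Q.R : U ⊗[ℂ] U) = t
  induction t with
  | zero => simp
  | add s t hs ht => simp only [map_add, LinearMap.add_apply, hs, ht]
  | tmul r s =>
    rw [pl_tmul, ract_mul]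
    simp only [TensorProduct.lift.tmul, LinearMap.compl₁₂_apply, LinearMap.flip_apply]
    rw [LinearMap.comp_apply (snd2 Q), ract_postL, ract_preActL, ract_preAd]
    rfl

theorem prodPair_xi_right : prodPair Q (DU.iA Q) (xi Q) =
    ract (prodPair Q (DU.iA Q) (DU.iA Q)) (rInv Q (snd2 Q ∘ₗ preAd U (DU Q)) (valU Q)) := by
  ext f g
  rw [prodPair_apply, xi, rInv, rInv]
  generalize ((Q.R⁻¹ : (U ⊗[ℂ] U)ˣ) : U ⊗[ℂ] U) = t
  induction t with
  | zero => simp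
  | add s t hs ht => simp only [map_add, LinearMap.add_apply, mul_add, hs, ht]
  | tmul r s =>
    rw [pl_tmul, pl_tmul, ract_mul, ract_mul, ract_postU, LinearMap.comp_apply (snd2 Q),
      LinearMap.comp_apply (snd2 Q), ract_postL, ract_postU, ract_postL, ract_preAd, ract_preAd,
      prodPair_apply, mul_assoc]

/-- In ξ(f)ξ(g) the factor s⁻ coming from ξ(f) stands between the two; moving it past ξ(g) by
`cross_xi` splits it into a multiplication on the right and a left action on g. Hence the
convolution in the second leg. -/
theorem prodPair_xi : prodPair Q (xi Q) (xi Q) =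
    ract (prodPair Q (DU.iA Q) (xi Q)) (rInv Q (fstAd Q) (cv (valU Q) (sndL Q))) := by
  ext f g
  rw [snd2_cv, prodPair_apply, rInv]
  have h0 : xi Q f * xi Q g = ract (DU.iA Q)
      (pl (preAd U _) (postU Q) ((Q.R⁻¹ : (U ⊗[ℂ] U)ˣ) : U ⊗[ℂ] U)) f * xi Q g := rfl
  rw [h0]
  generalize ((Q.R⁻¹ : (U ⊗[ℂ] U)ˣ) : U ⊗[ℂ] U) = t
  induction t with
  | zero => simp
  | add s t hs ht => simp only [map_add, LinearMap.add_apply, add_mul, hs, ht]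
  | tmul r s =>
    rw [pl_tmul, pl_tmul, ract_mul, ract_mul, ract_postU, ract_preAd, mul_assoc,
      LinearMap.comp_apply (snd2 Q), ract_postL, ract_preAd]
    have h1 : DU.iU Q s * xi Q g = ract (xi Q) (cv (postU Q) (preActL U _) s) g := by
      rw [← cross_xi, ract_postM]
    have h2 : prodPair Q (DU.iA Q) (xi Q) (fAd U r f) =
        ract (xi Q) (postM Q (DU.iA Q (fAd U r f))) := rfl
    rw [h1, h2, ← ract_mul, ← (postM_postU.symm.cv_left preActL_postM) s, ract_mul, ract_postM]

theorem ract_mulPair_left (φ : RDual U →ₗ[ℂ] DU Q) (p : U) :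
    ract (mulPair Q φ) (cv (sndL Q) (fstL Q) p) = mulPair Q (φ ∘ₗ actL U p) := by
  ext f g
  rw [mulPair_apply, LinearMap.comp_apply φ, actL_fMul, cv_apply]
  generalize (Coalgebra.comul (R := ℂ) p : U ⊗[ℂ] U) = t
  induction t with
  | zero => simp
  | add s t hs ht => simp only [map_add, LinearMap.add_apply, hs, ht]
  | tmul r s =>
    rw [pl_tmul, ract_mul, ract_preActL, LinearMap.comp_apply (snd2 Q), ract_postL, ract_preActL]
    rfl

theorem ract_mulPair_right (φ : RDual U →ₗ[ℂ] DU Q) (q : U) :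
    ract (mulPair Q φ) (cv (fstR Q) (sndR Q) q) = mulPair Q (φ ∘ₗ actR U q) := by
  ext f g
  rw [mulPair_apply, LinearMap.comp_apply φ, actR_fMul, cv_apply]
  generalize (Coalgebra.comul (R := ℂ) q : U ⊗[ℂ] U) = t
  induction t with
  | zero => simp
  | add s t hs ht => simp only [map_add, LinearMap.add_apply, hs, ht]
  | tmul r s =>
    rw [pl_tmul, ract_mul, LinearMap.comp_apply (snd2 Q), ract_postL, ract_preActR, ract_preActR]
    rfl

theorem mulPair_xi : mulPair Q (xi Q) = ract (mulPair Q (DU.iA Q))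
    (rInv Q (cv (cv (sndL Q) (fstL Q)) (cv (fstR Q) (sndR Q))) (valU Q)) := by
  ext f g
  rw [mulPair_apply, xi, rInv, rInv]
  generalize ((Q.R⁻¹ : (U ⊗[ℂ] U)ˣ) : U ⊗[ℂ] U) = t
  induction t with
  | zero => simp
  | add s t hs ht => simp only [map_add, LinearMap.add_apply, hs, ht]
  | tmul r s =>
    rw [pl_tmul, pl_tmul, ract_mul, ract_mul, ract_postU, ract_preAd, LinearMap.comp_apply (snd2 Q),
      ract_postL, ract_postU]
    congr 1
    rw [fAd, LinearMap.comp_apply, cv_apply]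
    generalize (Coalgebra.comul (R := ℂ) r : U ⊗[ℂ] U) = t
    induction t with
    | zero => simp
    | add s t hs ht => simp only [map_add, LinearMap.add_apply, hs, ht]
    | tmul p q =>
      rw [pl_tmul, ract_mul, ract_mulPair_left, ract_mulPair_right, mulPair_apply, ← pl_actL_actR]
      rfl

/-- Both sides are the map (f, g) ↦ ι(f * g), with ι : F → D_U the inclusion of A, acted on by a
product of R-matrices in five commuting legs: left and right actions on f and on g, and
multiplication by `U`. The hexagon expands the two products, and one use of Yang–Baxter identifies
them. -/
theorem xi_mul (f g : RDual U) : xi Q f * xi Q g = xi Q (fMul U f g) := by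
  have h : prodPair Q (xi Q) (xi Q) = mulPair Q (xi Q) := by
    have e35 : Cm (sndL Q) (valU Q) := snd2_cm preActL_postU
    have e45 : Cm (sndR Q) (valU Q) := snd2_cm preActR_postU
    have e34 : Cm (sndL Q) (sndR Q) := snd2_cm preActL_preActR
    have e12 : Cm (fstL Q) (fstR Q) := preActL_preActR
    have e13 : Cm (fstL Q) (sndL Q) := fstL_snd2 _
    have e14 : Cm (fstL Q) (sndR Q) := fstL_snd2 _
    have e15 : Cm (fstL Q) (valU Q) := fstL_snd2 _
    have e23 : Cm (fstR Q) (sndL Q) := fstR_snd2 _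
    have e24 : Cm (fstR Q) (sndR Q) := fstR_snd2 _
    have e25 : Cm (fstR Q) (valU Q) := fstR_snd2 _
    have ea3 : Cm (fstAd Q) (sndL Q) := fstAd_snd2 _
    have ea4 : Cm (fstAd Q) (sndR Q) := fstAd_snd2 _
    have ea5 : Cm (fstAd Q) (valU Q) := fstAd_snd2 _
    have ha : IsHom (fstAd Q) := preAd_isHom
    have h3 : IsHom (sndL Q) := snd2_isHom preActL_isHom
    have h5 : IsHom (valU Q) := snd2_isHom postU_isHom
    rw [prodPair_xi, prodPair_xi_right, prodPair_iA, mulPair_xi, ← ract_mul, ← ract_mul]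
    congr 1
    rw [preAd, ← snd2_cv, rInv_cv_left h5 e34 e35, rInv_cv_right ha ea5,
      rInv_cv_left (α := cv (sndL Q) (fstL Q)) h5
        ((e23.symm.cv_right e34).cv_left (e12.cv_right e14)) (e35.cv_left e15),
      rInv_cv_left h5 e24 e25, rInv_cv_left h5 e13.symm e35]
    -- The legs are ad on f, left action on g, and `U`. Reordering brings the inverse R-matrix of
    -- the first two next to the R-matrix in the product of A, and they cancel.
    have y := rInv_yangBaxter (Q := Q) ha h3 h5 ea3 ea5 e35
    have c : rInv Q (sndR Q) (valU Q) * rOp Q (fstAd Q) (sndL Q) =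
        rOp Q (fstAd Q) (sndL Q) * rInv Q (sndR Q) (valU Q) :=
      rInv_commute (fun x => (rOp_commute (fun y => ea4 y x) (fun y => e34 y x)).symm)
        (fun x => (rOp_commute (fun y => ea5 y x) (fun y => e35 y x)).symm)
    simp only [← mul_assoc]
    rw [← c]
    simp only [mul_assoc] at y ⊢
    rw [y, ← mul_assoc (rOp Q _ _) (rInv Q _ _), rOp_mul_rInv ha h3 ea3, one_mul, fstAd, preAd,
      rInv_cv_left h5 e12 e15]
    simp only [mul_assoc]
  exact LinearMap.congr_fun (LinearMap.congr_fun h f) g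

end TwoVariables

end DUAlg

/-! ### The right derivatives and the adjoint map -/

section Derivatives

variable {U : Type u} [Ring U] [HopfAlgebra ℂ U] (Q : QuasiTriangular U)

/-- The element of `F ⊗ U` whose image in `D_U` is `∂_▷(y)`. -/
def coadInv (U : Type u) [Ring U] [HopfAlgebra ℂ U] : locFin U →ₗ[ℂ] RDual U ⊗[ℂ] U :=
  (antipodeInv U).lTensor (RDual U) ∘ₗ coad U

theorem rightDer_apply (y : locFin U) : rightDer Q y = xiInv Q (coadInv U y) := rfl

/-- Applying S removes the S⁻¹ in the definition; by injectivity of S this characterises the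
element, and S⁻¹ is never computed. -/
theorem anti_evalAt_coadInv (Q : QuasiTriangular U) (y : locFin U) (h : U) :
    anti U (evalAt U h (coadInv U y)) = adj U h y := by
  rw [coadInv, LinearMap.comp_apply, evalAt_lTensor, anti_antipodeInv Q, evalAt_eq_evalHom,
    evalHom_coad]

theorem eq_of_anti_evalAt (Q : QuasiTriangular U) {s t : RDual U ⊗[ℂ] U}
    (h : ∀ x : U, anti U (evalAt U x s) = anti U (evalAt U x t)) : s = t :=
  eq_of_evalAt fun x => (anti_bijective Q).1 (h x)

/-- `a ⊗ b` acts on `F ⊗ U` by `f ⊗ z ↦ b f ⊗ a z`. -/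
def heisAct (U : Type u) [Ring U] [HopfAlgebra ℂ U] :
    U ⊗[ℂ] U →ₗ[ℂ] RDual U ⊗[ℂ] U →ₗ[ℂ] RDual U ⊗[ℂ] U :=
  TensorProduct.lift (LinearMap.mk₂ ℂ
    (fun a b => TensorProduct.map (actL U b) (LinearMap.mulLeft ℂ a))
    (by intros; ext; simp [add_mul, TensorProduct.tmul_add])
    (by intros; ext; simp)
    (by intros; ext; simp [TensorProduct.add_tmul])
    (by intros; ext; simp [TensorProduct.smul_tmul']))

theorem heisAct_tmul (a b : U) (f : RDual U) (z : U) :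
    heisAct U (a ⊗ₜ b) (f ⊗ₜ z) = (actL U b f) ⊗ₜ (a * z) := rfl

theorem iU_mul_xiInv (x : U) (t : RDual U ⊗[ℂ] U) :
    DU.iU Q x * xiInv Q t = xiInv Q (heisAct U (Coalgebra.comul x) t) := by
  induction t with
  | zero => simp
  | add s t hs ht => simp only [map_add, mul_add, hs, ht]
  | tmul f z =>
    rw [xiInv_tmul, ← mul_assoc, ← ract_postM, cross_xi, cv_apply]
    generalize (Coalgebra.comul (R := ℂ) x : U ⊗[ℂ] U) = t
    induction t with
    | zero => simp
    | add s t hs ht => simp only [map_add, add_mul, LinearMap.add_apply, hs, ht]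
    | tmul a b =>
      rw [pl_tmul, ract_mul, heisAct_tmul, xiInv_tmul, (iU_isHom Q).mul, ract_preActL, ract_postU,
        mul_assoc]

theorem xiInv_mul_iU (x : U) (t : RDual U ⊗[ℂ] U) :
    xiInv Q t * DU.iU Q x = xiInv Q ((LinearMap.mulRight ℂ x).lTensor _ t) := by
  induction t with
  | zero => simp
  | add s t hs ht => simp only [map_add, add_mul, hs, ht]
  | tmul f z => simp [xiInv_tmul, mul_assoc, (iU_isHom Q).mul]

/-- In the Heisenberg double, left multiplication by x acts on F ⊗ U through Δ(x). Evaluated at h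
and hit with S, it becomes ad(S(x)₁)(ad(h)y) · S(x)₂, which `cv_adj_id` contracts to S(x) · ad(h)y,
the value of right multiplication by x. -/
theorem iU_rightDer : Cm (DU.iU Q) (rightDer Q) := by
  intro x y
  rw [rightDer_apply, iU_mul_xiInv, xiInv_mul_iU]
  congr 1
  apply eq_of_anti_evalAt Q
  intro h
  have h1 : ∀ s : U ⊗[ℂ] U, anti U (evalAt U h (heisAct U s (coadInv U y))) =
      pl ((adj U).toLinearMap.flip (adj U h y)) LinearMap.id
        (TensorProduct.map (anti U) (anti U) (TensorProduct.comm ℂ U U s)) := by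
    intro s
    induction s with
    | zero => simp
    | add s t hs ht => simp only [map_add, LinearMap.add_apply, hs, ht]
    | tmul a b =>
      have h2 : ∀ t : RDual U ⊗[ℂ] U, evalAt U h (heisAct U (a ⊗ₜ b) t) =
          a * evalAt U (anti U b * h) t := by
        intro t
        induction t with
        | zero => simp
        | add s t hs ht => simp only [map_add, mul_add, hs, ht]
        | tmul f z => simp [heisAct_tmul]
      rw [h2, HopfAlgebra.antipode_mul_antidistrib, anti_evalAt_coadInv Q, map_mul]
      simp
  rw [h1, ← comul_anti, ← cv_apply, cv_adj_id, evalAt_lTensor, LinearMap.mulRight_apply,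
    LinearMap.mulRight_apply, HopfAlgebra.antipode_mul_antidistrib, anti_evalAt_coadInv Q]

/-- `g ⊗ z ↦ g * (z₂ f) ⊗ z₁`. -/
def heisMulRight (f : RDual U) : RDual U ⊗[ℂ] U →ₗ[ℂ] RDual U ⊗[ℂ] U :=
  TensorProduct.lift
    (LinearMap.compl₁₂ (LinearMap.mk₂ ℂ (fun g (t : U ⊗[ℂ] U) =>
      TensorProduct.comm ℂ U (RDual U) ((fMul U g ∘ₗ (actL U).flip f).lTensor U t))
      (by intros; simp [LinearMap.lTensor_add, LinearMap.add_comp])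
      (by intros; simp [LinearMap.lTensor_smul, LinearMap.smul_comp])
      (by intros; simp) (by intros; simp)) LinearMap.id Coalgebra.comul)

theorem heisMulRight_tmul (f g : RDual U) (z : U) : heisMulRight f (g ⊗ₜ z) =
    TensorProduct.comm ℂ U (RDual U) ((fMul U g ∘ₗ (actL U).flip f).lTensor U
      (Coalgebra.comul z)) := rfl

theorem xiInv_mul_xi (f : RDual U) (t : RDual U ⊗[ℂ] U) :
    xiInv Q t * xi Q f = xiInv Q (heisMulRight f t) := by
  induction t with
  | zero => simp
  | add s t hs ht => simp only [map_add, add_mul, hs, ht]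
  | tmul g z =>
    rw [xiInv_tmul, mul_assoc, ← ract_postM, cross_xi, cv_apply, heisMulRight_tmul]
    generalize (Coalgebra.comul (R := ℂ) z : U ⊗[ℂ] U) = t
    induction t with
    | zero => simp
    | add s t hs ht => simp only [map_add, mul_add, LinearMap.add_apply, hs, ht]
    | tmul a b =>
      rw [pl_tmul, ract_mul, ract_preActL, ract_postU, ← mul_assoc, xi_mul]
      simp [xiInv_tmul]

theorem xi_mul_xiInv (f : RDual U) (t : RDual U ⊗[ℂ] U) :
    xi Q f * xiInv Q t = xiInv Q ((fMul U f).rTensor U t) := by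
  induction t with
  | zero => simp
  | add s t hs ht => simp only [map_add, mul_add, hs, ht]
  | tmul g z => rw [xiInv_tmul, ← mul_assoc, xi_mul, LinearMap.rTensor_tmul, xiInv_tmul]

/-- `a ⊗ y ↦ f(· a) * coadInv(y)`. -/
def heisSplit (f : RDual U) : U ⊗[ℂ] locFin U →ₗ[ℂ] RDual U ⊗[ℂ] U :=
  TensorProduct.lift (LinearMap.compl₁₂ (LinearMap.rTensorHom U) (fMul U ∘ₗ (actR U).flip f)
    (coadInv U))

theorem heisSplit_tmul (f : RDual U) (a : U) (y : locFin U) :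
    heisSplit f (a ⊗ₜ y) = (fMul U (actR U a f)).rTensor U (coadInv U y) := rfl

/-- `a ⊗ b ↦ f(a) b`. -/
def evalLeft (f : RDual U) : U ⊗[ℂ] U →ₗ[ℂ] U :=
  (TensorProduct.lid ℂ U).toLinearMap ∘ₗ (f : Module.Dual ℂ U).rTensor U

@[simp] theorem evalLeft_tmul (f : RDual U) (a b : U) :
    evalLeft f (a ⊗ₜ b) = (f : Module.Dual ℂ U) a • b := rfl

/-- `x ↦ x ⊗ 1`. -/
abbrev inclL (U : Type u) [Ring U] [HopfAlgebra ℂ U] : U →ₗ[ℂ] U ⊗[ℂ] U :=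
  (Algebra.TensorProduct.includeLeft (R := ℂ) (S := ℂ) (A := U) (B := U)).toLinearMap

theorem anti_evalAt_heisMulRight (f : RDual U) (h : U) (t : RDual U ⊗[ℂ] U) :
    anti U (evalAt U h (heisMulRight f t)) =
      evalLeft f (cv (Coalgebra.comul ∘ₗ anti U ∘ₗ evalHom U t) (inclL U) h) := by
  induction t with
  | zero => simp [cv_apply]
  | add s t hs ht =>
    rw [map_add, map_add, map_add, hs, ht, map_add, LinearMap.comp_add, LinearMap.comp_add,
      cv_apply, cv_apply, cv_apply, pl_add_left, map_add]
  | tmul g z =>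
    -- The variable `s` does not occur in the equation; the value 1 given to it below is arbitrary.
    have h1 : ∀ s k : U ⊗[ℂ] U, pl (Coalgebra.comul ∘ₗ anti U ∘ₗ evalHom U (g ⊗ₜ z)) (inclL U) k =
        pl (LinearMap.toSpanSingleton ℂ _ (TensorProduct.map (anti U) (anti U)
          (TensorProduct.comm ℂ U U (Coalgebra.comul z))) ∘ₗ (g : Module.Dual ℂ U)) (inclL U) k := by
      intro s k
      congr 2
      ext a
      have h2 : evalHom U (g ⊗ₜ z) a = (g : Module.Dual ℂ U) a • z := rfl
      simp only [LinearMap.comp_apply, h2, map_smul, comul_anti, LinearMap.toSpanSingleton_apply]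
    rw [cv_apply, h1 1, heisMulRight_tmul]
    generalize (Coalgebra.comul (R := ℂ) z : U ⊗[ℂ] U) = s
    induction s with
    | zero => simp
    | add s t hs ht =>
      simp only [map_add, hs, ht, LinearMap.toSpanSingleton_add, LinearMap.add_comp, pl_add_left]
    | tmul a b =>
      simp only [LinearMap.lTensor_tmul, TensorProduct.comm_tmul, evalAt_tmul, map_smul,
        LinearMap.comp_apply, LinearMap.flip_apply, fMul_apply, TensorProduct.map_tmul]
      generalize (Coalgebra.comul (R := ℂ) h : U ⊗[ℂ] U) = k
      induction k with
      | zero => simp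
      | add s t hs ht => simp only [map_add, ← hs, ← ht, add_smul]
      | tmul a b => simp [mul_smul]

/-- `h ↦ (1 ⊗ ad(h)) t`. -/
def adSnd (t : U ⊗[ℂ] U) : U →ₗ[ℂ] U ⊗[ℂ] U :=
  LinearMap.applyₗ t ∘ₗ LinearMap.lTensorHom U ∘ₗ (adj U).toLinearMap

theorem anti_evalAt_heisSplit (Q : QuasiTriangular U) (f : RDual U) (h : U) (s : U ⊗[ℂ] locFin U) :
    anti U (evalAt U h (heisSplit f s)) =
      evalLeft f (cv (inclL U) (adSnd ((locFin U).subtype.lTensor U s)) h) := by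
  induction s with
  | zero => simp [cv_apply, adSnd]
  | add s t hs ht =>
    have h1 : ∀ s t : U ⊗[ℂ] U, adSnd (s + t) = adSnd s + adSnd t := by
      intros
      simp [adSnd, LinearMap.add_comp]
    rw [map_add, map_add, map_add, hs, ht, map_add, h1, cv_apply, cv_apply, cv_apply,
      pl_add_right, map_add]
  | tmul a y =>
    have h1 : ∀ t : RDual U ⊗[ℂ] U, evalAt U h ((fMul U (actR U a f)).rTensor U t) =
        evalLeft f (pl (inclL U) (TensorProduct.mk ℂ U U a ∘ₗ evalHom U t)
          (Coalgebra.comul h)) := by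
      intro t
      induction t with
      | zero => simp
      | add s t hs ht => rw [map_add, map_add, hs, ht, map_add, LinearMap.comp_add, pl_add_right,
          map_add]
      | tmul g z =>
        rw [LinearMap.rTensor_tmul, evalAt_tmul, fMul_apply]
        generalize (Coalgebra.comul (R := ℂ) h : U ⊗[ℂ] U) = k
        induction k with
        | zero => simp
        | add s t hs ht => simp only [map_add, ← hs, ← ht, add_smul]
        | tmul a b =>
          have h2 : evalHom U (g ⊗ₜ z) b = (g : Module.Dual ℂ U) b • z := rfl
          simp only [pl_tmul, h2, LinearMap.comp_apply, AlgHom.toLinearMap_apply,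
            Algebra.TensorProduct.includeLeft_apply, TensorProduct.mk_apply,
            Algebra.TensorProduct.tmul_mul_tmul, one_mul, evalLeft_tmul, actR_apply]
          rw [mul_smul, smul_comm]
    rw [heisSplit_tmul, h1, cv_apply]
    generalize (Coalgebra.comul (R := ℂ) h : U ⊗[ℂ] U) = k
    induction k with
    | zero => simp
    | add s t hs ht => simp only [map_add, ← hs, ← ht]
    | tmul c d =>
      have h2 := anti_evalAt_coadInv Q y d
      rw [evalAt_eq_evalHom] at h2
      simp only [pl_tmul, LinearMap.comp_apply, AlgHom.toLinearMap_apply, 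
        Algebra.TensorProduct.includeLeft_apply, TensorProduct.mk_apply,
        Algebra.TensorProduct.tmul_mul_tmul, one_mul, evalLeft_tmul, map_smul, h2]
      simp [adSnd]

/-- After evaluation at h and application of S, the two sides are f ⊗ id applied to the two sides of
`cv_comul_adj`. -/
theorem heisMulRight_coadInv (Q : QuasiTriangular U) (f : RDual U) (y : locFin U) :
    heisMulRight f (coadInv U y) = heisSplit f (comulLocFin U y) := by
  apply eq_of_anti_evalAt Q
  intro h
  rw [anti_evalAt_heisMulRight, anti_evalAt_heisSplit Q, lTensor_comulLocFin]
  have h1 : anti U ∘ₗ evalHom U (coadInv U y) = (adj U).toLinearMap.flip (y : U) := by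
    ext h
    rw [LinearMap.comp_apply, ← evalAt_eq_evalHom, anti_evalAt_coadInv Q]
    rfl
  rw [h1, cv_comul_adj]
  rfl

variable {Q}

/-- The Leibniz rule for right translations: ∂_▷(y)ξ(f) = ∑ ξ(f(· y₁))∂_▷(y₂). -/
theorem rightDer_cross (y : locFin U) : ract (xi Q) (postM Q (rightDer Q y)) =
    ract (xi Q) (cvL (preActR U _) (postR Q ∘ₗ rightDer Q) y) := by
  ext f
  rw [ract_postM, rightDer_apply, xiInv_mul_xi, heisMulRight_coadInv Q, cvL_apply]
  generalize comulLocFin U y = t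
  induction t with
  | zero => simp
  | add s t hs ht => simp only [map_add, LinearMap.add_apply, hs, ht]
  | tmul a z =>
    rw [heisSplit_tmul, ← xi_mul_xiInv, pl_tmul, ract_mul, LinearMap.comp_apply, ract_postR,
      ract_preActR, rightDer_apply]

theorem adD_apply (x : locFin U) : adD Q x = pl (DU.iU Q) (rightDer Q) (comulLocFin U x) := rfl

theorem rightDer_postU : Cm (postU Q) (postR Q ∘ₗ rightDer Q) := by
  intro a y
  have := iU_rightDer Q a y
  rw [postU, LinearMap.comp_apply, LinearMap.comp_apply, ← postR_isHom.mul, ← postR_isHom.mul,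
    this]

/-- The cross relations of ∂_◁ and ∂_▷ with ξ supply the left and the right action, which together
form ad. However, the factor from ∂_◁ takes the part of the coproduct before ad, the wrong order for
a module algebra; passing from F to A repairs this. -/
theorem adD_cross_xi (x : locFin U) : ract (xi Q) (postM Q (adD Q x)) =
    ract (xi Q) (cvL (cv (postU Q) (preAd U _)) (postR Q ∘ₗ rightDer Q) x) := by
  have hδ : ∀ y a, cvL (preActR U _) (postR Q ∘ₗ rightDer Q) y * postM Q a =
      postM Q a * cvL (preActR U _) (postR Q ∘ₗ rightDer Q) y :=
    preActR_postM.cvL_left (postM_postR.symm.comp_left (rightDer Q))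
  rw [preAd, ← cv_assoc, cvL_assoc, adD_apply, cvL_apply]
  generalize comulLocFin U x = t
  induction t with
  | zero => simp
  | add s t hs ht => simp only [map_add, hs, ht]
  | tmul a y => rw [pl_tmul, postM_mul, ract_mul, rightDer_cross, ← ract_mul, hδ, ract_mul,
      cross_xi, pl_tmul, ract_mul]

theorem postR_adD : postR Q ∘ₗ adD Q = cvL (postU Q) (postR Q ∘ₗ rightDer Q) := by
  ext y : 1
  rw [LinearMap.comp_apply, adD_apply, cvL_apply]
  generalize comulLocFin U y = t
  induction t with
  | zero => simp
  | add s t hs ht => simp only [map_add, hs, ht]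
  | tmul a y => rw [pl_tmul, pl_tmul, postR_isHom.mul]; rfl

/-- A differs from ξ(F) by R between ad and `U`, and R exchanges exactly the two legs that come in
the wrong order in `adD_cross_xi`. Hence A, and not F, is a module algebra for ad inside D_U. -/
theorem adD_cross (x : locFin U) : ract (DU.iA Q) (postM Q (adD Q x)) =
    ract (DU.iA Q) (cvL (preAd U _) (postR Q ∘ₗ adD Q) x) := by
  have hδ : Cm (preAd U (DU Q)) (postR Q ∘ₗ rightDer Q) :=
    (preActL_postR.comp_right _).cv_left (preActR_postR.comp_right _)
  have h2 : rOp Q (preAd U (DU Q)) (postU Q) * postM Q (adD Q x) =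
      postM Q (adD Q x) * rOp Q (preAd U (DU Q)) (postU Q) :=
    rOp_commute (fun y => preAd_postM y _) (fun y => (postM_postU _ y).symm)
  have h3 : rOp Q (preAd U (DU Q)) (postU Q) *
        cvL (cv (preAd U (DU Q)) (postU Q)) (postR Q ∘ₗ rightDer Q) x =
      cvL (cv (postU Q) (preAd U _)) (postR Q ∘ₗ rightDer Q) x *
        rOp Q (preAd U (DU Q)) (postU Q) :=
    rOp_mul_cvL preAd_isHom postU_isHom preAd_postU hδ rightDer_postU x
  rw [iA_eq_ract_xi, ← ract_mul, h2, ract_mul, adD_cross_xi, ← ract_mul, ← h3, ract_mul,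
    cvL_assoc, postR_adD]

end Derivatives

/-! ### Operators on the tensor space -/

section TensorOps

variable {V : Type v} [AddCommGroup V] [Module ℂ V] {n : ℕ}
  {M : Type w} [AddCommGroup M] [Module ℂ M]

theorem tensorSpace_ext {N : Type*} [AddCommGroup N] [Module ℂ N]
    {f g : TensorSpace V n M →ₗ[ℂ] N}
    (h : ∀ (v : Fin n → V) (m : M), f (PiTensorProduct.tprod ℂ v ⊗ₜ m) =
      g (PiTensorProduct.tprod ℂ v ⊗ₜ m)) : f = g := by
  apply TensorProduct.ext
  apply PiTensorProduct.ext
  ext v m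
  exact h v m

theorem legV_tmul (i : Fin n) (A : Module.End ℂ V) (v : Fin n → V) (m : M) :
    legV V n M i A (PiTensorProduct.tprod ℂ v ⊗ₜ m) =
      PiTensorProduct.tprod ℂ (Function.update v i (A (v i))) ⊗ₜ m := by
  classical
  have h : legV V n M i A = LinearMap.rTensor M (PiTensorProduct.map
      (Function.update (fun _ : Fin n => (LinearMap.id : V →ₗ[ℂ] V)) i A)) := rfl
  rw [h, LinearMap.rTensor_tmul, PiTensorProduct.map_tprod]
  congr 2
  ext j
  by_cases hj : j = i
  · subst hj
    simp
  · simp [hj]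

theorem swapV_tmul (i j : Fin n) (v : Fin n → V) (m : M) :
    swapV V n M i j (PiTensorProduct.tprod ℂ v ⊗ₜ m) =
      PiTensorProduct.tprod ℂ (v ∘ Equiv.swap i j) ⊗ₜ m := by
  have h : swapV V n M i j = LinearMap.rTensor M
    (PiTensorProduct.reindex ℂ (fun _ : Fin n => V) (Equiv.swap i j)).toLinearMap := rfl
  rw [h, LinearMap.rTensor_tmul]
  congr 1
  refine (PiTensorProduct.reindex_tprod (R := ℂ) (s := fun _ : Fin n => V)
    (Equiv.swap i j) v).trans ?_
  congr 1

theorem legV_isHom (i : Fin n) : IsHom (X := Module.End ℂ V)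
    (B := Module.End ℂ (TensorSpace V n M)) (legV V n M i) := by
  constructor
  · apply tensorSpace_ext
    intro v m
    simp [legV_tmul]
  · intro A A'
    apply tensorSpace_ext
    intro v m
    simp [legV_tmul]

theorem legV_legV {i j : Fin n} (h : i ≠ j) : Cm (B := Module.End ℂ (TensorSpace V n M))
    (legV V n M i) (legV V n M j) := by
  intro A A'
  apply tensorSpace_ext
  intro v m
  simp [legV_tmul, Function.update_of_ne h, Function.update_of_ne h.symm,
    Function.update_comm h]

theorem swapV_mul_self (i j : Fin n) : swapV V n M i j * swapV V n M i j = 1 := by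
  apply tensorSpace_ext
  intro v m
  simp [swapV_tmul, Function.comp_assoc, ← Equiv.coe_trans]

theorem swapV_comm (i j : Fin n) : swapV V n M i j = swapV V n M j i := by
  rw [swapV, Equiv.swap_comm]
  rfl

theorem swapV_legV_left (i j : Fin n) (A : Module.End ℂ V) :
    swapV V n M i j * legV V n M i A = legV V n M j A * swapV V n M i j := by
  apply tensorSpace_ext
  intro v m
  simp only [Module.End.mul_apply, legV_tmul, swapV_tmul]
  congr 2
  ext k
  rcases eq_or_ne k j with rfl | hk
  · simp
  · rw [Function.update_of_ne hk, Function.comp_apply, Function.comp_apply, Function.update_of_ne]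
    exact fun h => hk ((Equiv.swap i j).injective (h.trans (Equiv.swap_apply_right i j).symm))

theorem swapV_legV_right (i j : Fin n) (A : Module.End ℂ V) :
    swapV V n M i j * legV V n M j A = legV V n M i A * swapV V n M i j := by
  rw [swapV_comm, swapV_legV_left]

theorem swapV_legV_of_ne {i j k : Fin n} (hi : k ≠ i) (hj : k ≠ j) (A : Module.End ℂ V) :
    swapV V n M i j * legV V n M k A = legV V n M k A * swapV V n M i j := by
  apply tensorSpace_ext
  intro v m
  simp only [Module.End.mul_apply, legV_tmul, swapV_tmul]
  congr 2
  ext l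
  rcases eq_or_ne l k with rfl | hk
  · simp [Equiv.swap_apply_of_ne_of_ne hi hj]
  · rw [Function.update_of_ne hk, Function.comp_apply, Function.comp_apply, Function.update_of_ne]
    rw [← Equiv.swap_apply_of_ne_of_ne hi hj]
    exact fun h => hk ((Equiv.swap i j).injective h)

theorem swapV_braid {i j k : Fin n} (hij : i ≠ j) (hjk : j ≠ k) (hik : i ≠ k) :
    swapV V n M i j * swapV V n M j k * swapV V n M i j =
      swapV V n M j k * swapV V n M i j * swapV V n M j k := by
  have h : Equiv.swap i j * Equiv.swap j k * Equiv.swap i j =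
      Equiv.swap j k * Equiv.swap i j * Equiv.swap j k := by
    have h1 : Equiv.swap i j * Equiv.swap j k * Equiv.swap i j = Equiv.swap i k := by
      rw [Equiv.swap_comm i j, Equiv.swap_comm j k]
      exact Equiv.swap_mul_swap_mul_swap hjk.symm hik.symm
    rw [h1, Equiv.swap_comm i k]
    exact (Equiv.swap_mul_swap_mul_swap hij hik).symm
  apply tensorSpace_ext
  intro v m
  simp only [Module.End.mul_apply, swapV_tmul, Function.comp_assoc, ← Equiv.Perm.coe_mul]
  rw [h]

theorem swapV_swapV {i j k l : Fin n} (h1 : i ≠ k) (h2 : i ≠ l) (h3 : j ≠ k) (h4 : j ≠ l) :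
    swapV V n M i j * swapV V n M k l = swapV V n M k l * swapV V n M i j := by
  have h : Equiv.swap k l * Equiv.swap i j = Equiv.swap i j * Equiv.swap k l := by
    apply Equiv.Perm.Disjoint.commute
    intro x
    by_cases hx : x = i ∨ x = j
    · left
      rcases hx with rfl | rfl
      · exact Equiv.swap_apply_of_ne_of_ne h1 h2
      · exact Equiv.swap_apply_of_ne_of_ne h3 h4
    · right
      push Not at hx
      exact Equiv.swap_apply_of_ne_of_ne hx.1 hx.2
  apply tensorSpace_ext
  intro v m
  simp only [Module.End.mul_apply, swapV_tmul, Function.comp_assoc, ← Equiv.Perm.coe_mul]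
  rw [h]

variable {U : Type u} [Ring U] [HopfAlgebra ℂ U] {Q : QuasiTriangular U}
section

variable [Module (DU Q) M] [IsScalarTower ℂ (DU Q) M]

theorem legM_tmul (d : DU Q) (x : ⨂[ℂ] _ : Fin n, V) (m : M) :
    legM V n M Q d (x ⊗ₜ m) = x ⊗ₜ (d • m) := rfl

theorem legM_isHom : IsHom (B := Module.End ℂ (TensorSpace V n M)) (legM V n M Q) := by
  constructor
  · apply tensorSpace_ext
    intro v m
    simp [legM_tmul]
  · intro a b
    apply tensorSpace_ext
    intro v m
    simp [legM_tmul, mul_smul]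

theorem legV_legM (i : Fin n) : Cm (B := Module.End ℂ (TensorSpace V n M))
    (legV V n M i) (legM V n M Q) := by
  intro A d
  apply tensorSpace_ext
  intro v m
  simp [legM_tmul, legV_tmul]

theorem swapV_legM (i j : Fin n) (d : DU Q) :
    swapV V n M i j * legM V n M Q d = legM V n M Q d * swapV V n M i j := by
  apply tensorSpace_ext
  intro v m
  simp [legM_tmul, swapV_tmul]

variable (V n M Q) in
/-- `U` acting on the factor `M` of `V^{⊗n} ⊗ M` through `∂_◁`. -/
def legMU : U →ₗ[ℂ] Module.End ℂ (TensorSpace V n M) := legM V n M Q ∘ₗ DU.iU Q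

theorem legMU_isHom : IsHom (B := Module.End ℂ (TensorSpace V n M)) (legMU V n M Q) :=
  legM_isHom.comp (iU_isHom Q)

variable (V n M Q) in
/-- `∂_▷` acting on the factor `M` of `V^{⊗n} ⊗ M`. -/
def legMR : locFin U →ₗ[ℂ] Module.End ℂ (TensorSpace V n M) := legM V n M Q ∘ₗ rightDer Q

theorem legMU_legMR : Cm (B := Module.End ℂ (TensorSpace V n M))
    (legMU V n M Q) (legMR V n M Q) := by
  intro x y
  have := iU_rightDer Q x y
  have h := (legM_isHom (V := V) (n := n) (M := M) (Q := Q)).mul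
  rw [legMU, legMR, LinearMap.comp_apply, LinearMap.comp_apply, ← h, ← h, this]

end

/-! ### The actions of `U` on the factors and the braidings -/

variable [Module U V] [IsScalarTower ℂ U V]

theorem actV_isHom : IsHom (B := Module.End ℂ V) (actV U V).toLinearMap := isHom_algHom _

theorem legU_isHom (i : Fin n) : IsHom (B := Module.End ℂ (TensorSpace V n M))
    (legU U V n M i) := (legV_isHom i).comp (actV_isHom (U := U))

theorem legU_legU {i j : Fin n} (h : i ≠ j) : Cm (B := Module.End ℂ (TensorSpace V n M))
    (legU U V n M i) (legU U V n M j) :=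
  fun x y => legV_legV h (actV U V x) (actV U V y)

theorem swapV_legU_of_ne {i j k : Fin n} (hi : k ≠ i) (hj : k ≠ j) (x : U) :
    swapV V n M i j * legU U V n M k x = legU U V n M k x * swapV V n M i j :=
  swapV_legV_of_ne hi hj (actV U V x)

/-- `R` acting on the factors `i` and `j`. -/
def rLeg (Q : QuasiTriangular U) (V : Type v) [AddCommGroup V] [Module ℂ V] [Module U V]
    [IsScalarTower ℂ U V] (n : ℕ) (M : Type w) [AddCommGroup M] [Module ℂ M] (i j : Fin n) :
    Module.End ℂ (TensorSpace V n M) :=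
  rOp (B := Module.End ℂ (TensorSpace V n M)) Q (legU U V n M i) (legU U V n M j)

theorem opT_eq (i : ℕ) (h : i + 1 < n) : opT V n M Q i h =
    swapV V n M ⟨i, by omega⟩ ⟨i + 1, h⟩ * rLeg Q V n M ⟨i + 1, h⟩ ⟨i, by omega⟩ := rfl

theorem swapV_rLeg {i j k l k' l' : Fin n}
    (hk : ∀ A, swapV V n M i j * legV V n M k A = legV V n M k' A * swapV V n M i j)
    (hl : ∀ A, swapV V n M i j * legV V n M l A = legV V n M l' A * swapV V n M i j) :
    swapV V n M i j * rLeg Q V n M k l = rLeg Q V n M k' l' * swapV V n M i j :=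
  pl_conj (B := Module.End ℂ (TensorSpace V n M)) (fun x => hk (actV U V x))
    (fun x => hl (actV U V x)) _

theorem opT_commute {i : ℕ} {h : i + 1 < n} {c : Module.End ℂ (TensorSpace V n M)}
    (h1 : ∀ x, legU U V n M ⟨i, by omega⟩ x * c = c * legU U V n M ⟨i, by omega⟩ x)
    (h2 : ∀ x, legU U V n M ⟨i + 1, h⟩ x * c = c * legU U V n M ⟨i + 1, h⟩ x)
    (h3 : swapV V n M ⟨i, by omega⟩ ⟨i + 1, h⟩ * c = c * swapV V n M ⟨i, by omega⟩ ⟨i + 1, h⟩) :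
    opT V n M Q i h * c = c * opT V n M Q i h := by
  have h4 : rLeg Q V n M ⟨i + 1, h⟩ ⟨i, by omega⟩ * c =
    c * rLeg Q V n M ⟨i + 1, h⟩ ⟨i, by omega⟩ :=
    rOp_commute (B := Module.End ℂ (TensorSpace V n M)) h2 h1
  rw [opT_eq, mul_assoc, h4, ← mul_assoc, h3, mul_assoc]

theorem opT_legU {i : ℕ} {h : i + 1 < n} {k : Fin n} (h1 : (k : ℕ) ≠ i) (h2 : (k : ℕ) ≠ i + 1)
    (x : U) : opT V n M Q i h * legU U V n M k x = legU U V n M k x * opT V n M Q i h :=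
  opT_commute (fun y => legU_legU (fun e => h1 (Fin.ext_iff.1 e).symm) y x)
    (fun y => legU_legU (fun e => h2 (Fin.ext_iff.1 e).symm) y x)
    (swapV_legU_of_ne (fun e => h1 (Fin.ext_iff.1 e)) (fun e => h2 (Fin.ext_iff.1 e)) x)

theorem opT_swapV {i : ℕ} {h : i + 1 < n} {k l : Fin n} (h1 : (k : ℕ) ≠ i)
    (h2 : (k : ℕ) ≠ i + 1) (h3 : (l : ℕ) ≠ i) (h4 : (l : ℕ) ≠ i + 1) :
    opT V n M Q i h * swapV V n M k l = swapV V n M k l * opT V n M Q i h := by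
  have e1 : (⟨i, by omega⟩ : Fin n) ≠ k := fun e => h1 (Fin.ext_iff.1 e).symm
  have e2 : (⟨i + 1, h⟩ : Fin n) ≠ k := fun e => h2 (Fin.ext_iff.1 e).symm
  have e3 : (⟨i, by omega⟩ : Fin n) ≠ l := fun e => h3 (Fin.ext_iff.1 e).symm
  have e4 : (⟨i + 1, h⟩ : Fin n) ≠ l := fun e => h4 (Fin.ext_iff.1 e).symm
  exact opT_commute (fun x => (swapV_legU_of_ne e1 e3 x).symm)
    (fun x => (swapV_legU_of_ne e2 e4 x).symm) (swapV_swapV e1 e3 e2 e4)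

theorem opT_opT {i j : ℕ} (hi : i + 1 < n) (hj : j + 1 < n) (hij : i + 2 ≤ j) :
    opT V n M Q i hi * opT V n M Q j hj = opT V n M Q j hj * opT V n M Q i hi := by
  have e1 : i ≠ j := by omega
  have e2 : i ≠ j + 1 := by omega
  have e3 : i + 1 ≠ j := by omega
  have e4 : i + 1 ≠ j + 1 := by omega
  refine opT_commute (fun x => ?_) (fun x => ?_) ?_
  · exact (opT_legU (k := ⟨i, by omega⟩) e1 e2 x).symm
  · exact (opT_legU (k := ⟨i + 1, hi⟩) e3 e4 x).symm
  · exact (opT_swapV (k := ⟨i, by omega⟩) (l := ⟨i + 1, hi⟩) e1 e2 e3 e4).symm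

/-- Here s, t are transpositions and x, y, z the R-matrices of the three pairs. Collecting the
transpositions on the left splits the braid relation into that of s, t and the Yang–Baxter equation.
-/
theorem braid_of_yangBaxter {G : Type*} [Monoid G] {s t x y z : G} (h1 : s * t * s = t * s * t)
    (h2 : x * t = t * y) (h3 : y * s = s * z) (h4 : z * s = s * y) (h5 : y * t = t * x)
    (h6 : z * y * x = x * y * z) :
    (s * x) * (t * z) * (s * x) = (t * z) * (s * x) * (t * z) := by
  calc (s * x) * (t * z) * (s * x) = s * (x * t) * (z * s) * x := by simp only [mul_assoc]
    _ = s * t * (y * s) * (y * x) := by rw [h2, h4]; simp only [mul_assoc]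
    _ = t * s * t * (z * y * x) := by rw [h3, ← h1]; simp only [mul_assoc]
    _ = t * s * (t * x) * (y * z) := by rw [h6]; simp only [mul_assoc]
    _ = t * (s * y) * (t * y) * z := by rw [← h5]; simp only [mul_assoc]
    _ = t * z * s * (x * t) * z := by rw [← h4, h2]; simp only [mul_assoc]
    _ = _ := by simp only [mul_assoc]

theorem opT_braid (i : ℕ) (h : i + 2 < n) :
    opT V n M Q i (by omega) * opT V n M Q (i + 1) h * opT V n M Q i (by omega) =
      opT V n M Q (i + 1) h * opT V n M Q i (by omega) * opT V n M Q (i + 1) h := by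
  have hab : (⟨i, by omega⟩ : Fin n) ≠ ⟨i + 1, by omega⟩ := by simp
  have hac : (⟨i, by omega⟩ : Fin n) ≠ ⟨i + 2, h⟩ := by simp
  have hbc : (⟨i + 1, by omega⟩ : Fin n) ≠ ⟨i + 2, h⟩ := by simp
  refine braid_of_yangBaxter (swapV_braid hab hbc hac)
    (swapV_rLeg (swapV_legV_right _ _) (swapV_legV_of_ne hab hac)).symm
    (swapV_rLeg (swapV_legV_of_ne hac.symm hbc.symm) (swapV_legV_right _ _)).symm
    (swapV_rLeg (swapV_legV_of_ne hac.symm hbc.symm) (swapV_legV_left _ _)).symm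
    (swapV_rLeg (swapV_legV_left _ _) (swapV_legV_of_ne hab hac)).symm
    (rOp_yangBaxter (B := Module.End ℂ (TensorSpace V n M)) (legU_isHom _) (legU_isHom _)
      (legU_isHom _) (legU_legU hbc.symm) (legU_legU hac.symm) (legU_legU hab.symm))

theorem isUnit_swapV (i j : Fin n) : IsUnit (swapV V n M i j) :=
  ⟨⟨_, _, swapV_mul_self i j, swapV_mul_self i j⟩, rfl⟩

theorem isUnit_rOp {B : Type*} [Ring B] [Algebra ℂ B] {α β : U →ₗ[ℂ] B} (hα : IsHom α)
    (hβ : IsHom β) (h : Cm α β) : IsUnit (rOp Q α β) :=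
  ⟨⟨_, _, rOp_mul_rInv hα hβ h, rInv_mul_rOp hα hβ h⟩, rfl⟩

theorem isUnit_opT (i : ℕ) (h : i + 1 < n) : IsUnit (opT V n M Q i h) :=
  (isUnit_swapV _ _).mul (isUnit_rOp (B := Module.End ℂ (TensorSpace V n M)) (legU_isHom _)
    (legU_isHom _) (legU_legU (by simp)))

section

variable [Module (DU Q) M] [IsScalarTower ℂ (DU Q) M]

theorem legU_legM (i : Fin n) : Cm (B := Module.End ℂ (TensorSpace V n M))
    (legU U V n M i) (legM V n M Q) := (legV_legM i).comp_left _

theorem legU_legMU (i : Fin n) : Cm (B := Module.End ℂ (TensorSpace V n M))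
    (legU U V n M i) (legMU V n M Q) := (legU_legM i).comp_right _

theorem legU_legMR (i : Fin n) : Cm (B := Module.End ℂ (TensorSpace V n M))
    (legU U V n M i) (legMR V n M Q) := (legU_legM i).comp_right _

theorem opT_legM {i : ℕ} {h : i + 1 < n} (d : DU Q) :
    opT V n M Q i h * legM V n M Q d = legM V n M Q d * opT V n M Q i h :=
  opT_commute (fun y => legU_legM _ y d) (fun y => legU_legM _ y d) (swapV_legM _ _ d)

end

end TensorOps

/-! ### Braid operators for a family of commuting representations -/

section Legs

variable {U : Type u} [Ring U] [HopfAlgebra ℂ U] {Q : QuasiTriangular U}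
  {B : Type*} [Ring B] [Algebra ℂ B]

/-- Pairwise commuting representations of `U` in an algebra. -/
structure IsLegs (ρ : ℕ → U →ₗ[ℂ] B) : Prop where
  hom : ∀ i, IsHom (ρ i)
  comm : ∀ i j, i ≠ j → Cm (ρ i) (ρ j)

/-- The action `x ↦ ρ_k(x₁) ⋯ ρ_0(x_{k+1})`. -/
def gam (ρ : ℕ → U →ₗ[ℂ] B) : ℕ → U →ₗ[ℂ] B
  | 0 => ρ 0
  | k + 1 => cv (ρ (k + 1)) (gam ρ k)

theorem cv_commute {α β : U →ₗ[ℂ] B} {c : B} (hα : ∀ x, α x * c = c * α x)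
    (hβ : ∀ y, β y * c = c * β y) (x : U) : cv α β x * c = c * cv α β x := pl_commute hα hβ _

theorem gam_commute_of_le {ρ : ℕ → U →ₗ[ℂ] B} {c : B} {j k : ℕ} (hjk : j ≤ k)
    (hj : ∀ x, gam ρ j x * c = c * gam ρ j x)
    (h : ∀ i, j < i → i ≤ k → ∀ x, ρ i x * c = c * ρ i x) (x : U) :
    gam ρ k x * c = c * gam ρ k x := by
  induction k, hjk using Nat.le_induction generalizing x with
  | base => exact hj x
  | succ k hk ih =>
    exact cv_commute (h (k + 1) (by omega) le_rfl) (ih fun i h1 h2 => h i h1 (by omega)) x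

theorem gam_commute {ρ : ℕ → U →ₗ[ℂ] B} {c : B} {k : ℕ}
    (h : ∀ i ≤ k, ∀ x, ρ i x * c = c * ρ i x) (x : U) : gam ρ k x * c = c * gam ρ k x :=
  gam_commute_of_le (Nat.zero_le k) (h 0 (Nat.zero_le k)) (fun i _ hi => h i hi) x

variable {ρ : ℕ → U →ₗ[ℂ] B}

theorem IsLegs.gam_right (hρ : IsLegs ρ) {j k : ℕ} (h : k < j) : Cm (ρ j) (gam ρ k) := fun x y =>
  (gam_commute (fun i hi z => hρ.comm i j (by omega) z x) y).symm

theorem IsLegs.gam_isHom (hρ : IsLegs ρ) (k : ℕ) : IsHom (gam ρ k) := by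
  induction k with
  | zero => exact hρ.hom 0
  | succ k ih => exact cv_isHom (hρ.hom _) ih (hρ.gam_right (Nat.lt_succ_self k))

variable (Q ρ) in
/-- The double braiding of the representation `ρ_{k+1}` with the representations
`ρ_k, …, ρ_0`. -/
def yOp (k : ℕ) : B := rOp Q (gam ρ k) (ρ (k + 1)) * rOp Q (ρ (k + 1)) (gam ρ k)

theorem yOp_commute {c : B} {k : ℕ} (h : ∀ i ≤ k + 1, ∀ x, ρ i x * c = c * ρ i x) :
    yOp Q ρ k * c = c * yOp Q ρ k := by
  have h1 := gam_commute fun i hi => h i (Nat.le_succ_of_le hi)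
  have h2 := h (k + 1) le_rfl
  rw [yOp, mul_assoc, rOp_commute h2 h1, ← mul_assoc, rOp_commute h1 h2, mul_assoc]

theorem IsLegs.yOp_leg (hρ : IsLegs ρ) {j k : ℕ} (h : k + 1 < j) (x : U) :
    ρ j x * yOp Q ρ k = yOp Q ρ k * ρ j x :=
  (yOp_commute fun i _ z => hρ.comm i j (by omega) z x).symm

/-- The double braiding R₂₁R commutes with Δ(x); the further legs of the longer tensor product do
not meet it. -/
theorem IsLegs.yOp_gam (hρ : IsLegs ρ) {j k : ℕ} (h : k < j) (x : U) :
    gam ρ j x * yOp Q ρ k = yOp Q ρ k * gam ρ j x := by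
  refine gam_commute_of_le (j := k + 1) h (fun z => ?_) (fun i hi _ => hρ.yOp_leg hi) x
  have h1 := rOp_mul_cv (Q := Q) (hρ.hom (k + 1)) (hρ.gam_isHom k)
    (hρ.gam_right (Nat.lt_succ_self k)) z
  have h2 := rOp_mul_cv (Q := Q) (hρ.gam_isHom k) (hρ.hom (k + 1))
    (hρ.gam_right (Nat.lt_succ_self k)).symm z
  rw [gam, yOp, ← mul_assoc, ← h2, mul_assoc, mul_assoc, h1]

/-- The later double braiding is built from the total action of the legs 0, …, j and from leg j + 1,
and the earlier one commutes with both. -/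
theorem IsLegs.yOp_yOp (hρ : IsLegs ρ) {j k : ℕ} (h : k < j) :
    yOp Q ρ j * yOp Q ρ k = yOp Q ρ k * yOp Q ρ j := by
  have h1 := hρ.yOp_gam (Q := Q) h
  have h2 := hρ.yOp_leg (Q := Q) (show k + 1 < j + 1 by omega)
  have h3 : yOp Q ρ j = rOp Q (gam ρ j) (ρ (j + 1)) * rOp Q (ρ (j + 1)) (gam ρ j) := rfl
  rw [h3, mul_assoc, rOp_commute h2 h1, ← mul_assoc, rOp_commute h1 h2, mul_assoc]

/-- An operator exchanging the representations `ρ_{k+1}` and `ρ_{k+2}`. -/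
structure IsSwap (ρ : ℕ → U →ₗ[ℂ] B) (k : ℕ) (P : B) : Prop where
  sq : P * P = 1
  left : ∀ x, P * ρ (k + 1) x = ρ (k + 2) x * P
  right : ∀ x, P * ρ (k + 2) x = ρ (k + 1) x * P
  far : ∀ i, i ≠ k + 1 → i ≠ k + 2 → ∀ x, P * ρ i x = ρ i x * P

variable (Q ρ) in
/-- The braiding of `ρ_{k+2}` and `ρ_{k+1}`. -/
def tOp (P : B) (k : ℕ) : B := P * rOp Q (ρ (k + 2)) (ρ (k + 1))

variable {P : B} {k : ℕ}

theorem IsSwap.gam_of_le (hP : IsSwap ρ k P) {j : ℕ} (h : j ≤ k) (x : U) :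
    P * gam ρ j x = gam ρ j x * P :=
  (gam_commute (fun i hi z => (hP.far i (by omega) (by omega) z).symm) x).symm

/-- Carrying the first transposition through turns the braiding with leg k + 1 into one with leg k +
2 and cancels the second transposition; the hexagon recognises the four R-matrices left over as a
double braiding with one leg more. -/
theorem IsLegs.tOp_yOp_tOp (hρ : IsLegs ρ) (hP : IsSwap ρ k P) :
    tOp Q ρ P k * yOp Q ρ k * tOp Q ρ P k = yOp Q ρ (k + 1) := by
  have hg := hP.gam_of_le le_rfl
  have ha := hρ.hom (k + 1)
  have hb := hρ.hom (k + 2)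
  have hag : Cm (ρ (k + 1)) (gam ρ k) := hρ.gam_right (by omega)
  have hbg : Cm (ρ (k + 2)) (gam ρ k) := hρ.gam_right (by omega)
  have hba : Cm (ρ (k + 2)) (ρ (k + 1)) := hρ.comm _ _ (by omega)
  have e1 : P * rOp Q (ρ (k + 2)) (ρ (k + 1)) = rOp Q (ρ (k + 1)) (ρ (k + 2)) * P :=
    pl_conj hP.right hP.left _
  have e2 : P * rOp Q (gam ρ k) (ρ (k + 1)) = rOp Q (gam ρ k) (ρ (k + 2)) * P :=
    pl_conj hg hP.left _
  have e3 : P * rOp Q (ρ (k + 1)) (gam ρ k) = rOp Q (ρ (k + 2)) (gam ρ k) * P :=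
    pl_conj hP.left hg _
  have e4 : yOp Q ρ (k + 1) = rOp Q (ρ (k + 1)) (ρ (k + 2)) * rOp Q (gam ρ k) (ρ (k + 2)) *
      (rOp Q (ρ (k + 2)) (gam ρ k) * rOp Q (ρ (k + 2)) (ρ (k + 1))) := by
    rw [yOp, gam, rOp_cv_left hb hbg.symm, rOp_cv_right hb hbg hag]
  calc tOp Q ρ P k * yOp Q ρ k * tOp Q ρ P k
      = P * rOp Q (ρ (k + 2)) (ρ (k + 1)) * (rOp Q (gam ρ k) (ρ (k + 1)) *
          rOp Q (ρ (k + 1)) (gam ρ k)) * (P * rOp Q (ρ (k + 2)) (ρ (k + 1))) := rfl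
    _ = rOp Q (ρ (k + 1)) (ρ (k + 2)) * (P * rOp Q (gam ρ k) (ρ (k + 1))) *
          rOp Q (ρ (k + 1)) (gam ρ k) * P * rOp Q (ρ (k + 2)) (ρ (k + 1)) := by
        nth_rewrite 1 [e1]; simp only [mul_assoc]
    _ = rOp Q (ρ (k + 1)) (ρ (k + 2)) * rOp Q (gam ρ k) (ρ (k + 2)) *
          (P * rOp Q (ρ (k + 1)) (gam ρ k)) * P * rOp Q (ρ (k + 2)) (ρ (k + 1)) := by
        rw [e2]; simp only [mul_assoc]
    _ = rOp Q (ρ (k + 1)) (ρ (k + 2)) * rOp Q (gam ρ k) (ρ (k + 2)) *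
          rOp Q (ρ (k + 2)) (gam ρ k) * (P * P) * rOp Q (ρ (k + 2)) (ρ (k + 1)) := by
        rw [e3]; simp only [mul_assoc]
    _ = yOp Q ρ (k + 1) := by
        rw [hP.sq, e4]; simp only [mul_assoc, one_mul]

theorem IsLegs.tOp_sq (_hρ : IsLegs ρ) (hP : IsSwap ρ k P) :
    tOp Q ρ P k * tOp Q ρ P k =
      rOp Q (ρ (k + 1)) (ρ (k + 2)) * rOp Q (ρ (k + 2)) (ρ (k + 1)) := by
  have e1 : P * rOp Q (ρ (k + 2)) (ρ (k + 1)) = rOp Q (ρ (k + 1)) (ρ (k + 2)) * P :=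
    pl_conj hP.right hP.left _
  rw [tOp]
  nth_rewrite 1 [e1]
  rw [mul_assoc, ← mul_assoc P, hP.sq, one_mul]

theorem tOp_commute {c : B} (hP : P * c = c * P) (h1 : ∀ x, ρ (k + 1) x * c = c * ρ (k + 1) x)
    (h2 : ∀ x, ρ (k + 2) x * c = c * ρ (k + 2) x) : tOp Q ρ P k * c = c * tOp Q ρ P k := by
  rw [tOp, mul_assoc, rOp_commute h2 h1, ← mul_assoc, hP, mul_assoc]

theorem IsLegs.tOp_leg (hρ : IsLegs ρ) (hP : IsSwap ρ k P) {i : ℕ} (h1 : i ≠ k + 1)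
    (h2 : i ≠ k + 2) (x : U) : tOp Q ρ P k * ρ i x = ρ i x * tOp Q ρ P k :=
  tOp_commute (hP.far i h1 h2 x) (fun z => hρ.comm _ _ h1.symm z x)
    (fun z => hρ.comm _ _ h2.symm z x)

theorem IsLegs.tOp_gam_of_le (hρ : IsLegs ρ) (hP : IsSwap ρ k P) {j : ℕ} (h : j ≤ k) (x : U) :
    tOp Q ρ P k * gam ρ j x = gam ρ j x * tOp Q ρ P k :=
  (gam_commute (fun _ _ z => (hρ.tOp_leg hP (by omega) (by omega) z).symm) x).symm

/-- τR is an endomorphism of the tensor product of legs k + 2 and k + 1, which by coassociativity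
sits as one block in the total action. -/
theorem IsLegs.tOp_gam_of_lt (hρ : IsLegs ρ) (hP : IsSwap ρ k P) {j : ℕ} (h : k + 2 ≤ j) (x : U) :
    tOp Q ρ P k * gam ρ j x = gam ρ j x * tOp Q ρ P k := by
  refine (gam_commute_of_le h (fun z => ?_)
    (fun i hi _ z => (hρ.tOp_leg hP (by omega) (by omega) z).symm) x).symm
  have hba : Cm (ρ (k + 2)) (ρ (k + 1)) := hρ.comm _ _ (by omega)
  have e1 : ∀ z, rOp Q (ρ (k + 2)) (ρ (k + 1)) * cv (ρ (k + 2)) (ρ (k + 1)) z =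
      cv (ρ (k + 1)) (ρ (k + 2)) z * rOp Q (ρ (k + 2)) (ρ (k + 1)) :=
    rOp_mul_cv (hρ.hom _) (hρ.hom _) hba
  have e2 : ∀ z, tOp Q ρ P k * cv (ρ (k + 2)) (ρ (k + 1)) z =
      cv (ρ (k + 2)) (ρ (k + 1)) z * tOp Q ρ P k := by
    intro z
    have e3 : P * cv (ρ (k + 1)) (ρ (k + 2)) z = cv (ρ (k + 2)) (ρ (k + 1)) z * P :=
      pl_conj hP.left hP.right _
    rw [tOp, mul_assoc, e1, ← mul_assoc, e3, mul_assoc]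
  have e4 : gam ρ (k + 2) = cv (cv (ρ (k + 2)) (ρ (k + 1))) (gam ρ k) := by
    rw [cv_assoc]
    rfl
  rw [e4]
  exact cv_commute (fun y => (e2 y).symm) (fun y => (hρ.tOp_gam_of_le hP le_rfl y).symm) z

theorem IsLegs.tOp_yOp_of_lt (hρ : IsLegs ρ) (hP : IsSwap ρ k P) {j : ℕ} (h : j < k) :
    tOp Q ρ P k * yOp Q ρ j = yOp Q ρ j * tOp Q ρ P k :=
  (yOp_commute fun i _ z => (hρ.tOp_leg hP (by omega) (by omega) z).symm).symm

theorem IsLegs.tOp_yOp_of_gt (hρ : IsLegs ρ) (hP : IsSwap ρ k P) {j : ℕ} (h : k + 2 ≤ j) :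
    tOp Q ρ P k * yOp Q ρ j = yOp Q ρ j * tOp Q ρ P k := by
  have h1 : ∀ x, gam ρ j x * tOp Q ρ P k = tOp Q ρ P k * gam ρ j x :=
    fun x => (hρ.tOp_gam_of_lt hP h x).symm
  have h2 : ∀ x, ρ (j + 1) x * tOp Q ρ P k = tOp Q ρ P k * ρ (j + 1) x :=
    fun x => (hρ.tOp_leg hP (by omega) (by omega) x).symm
  rw [yOp, mul_assoc, rOp_commute h2 h1, ← mul_assoc (rOp Q (gam ρ j) _), rOp_commute h1 h2,
    mul_assoc]

/-! #### The total action of `U'` and the ribbon element -/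

variable {δ : locFin U →ₗ[ℂ] B}

theorem IsLegs.tOp_cvL_gam (hρ : IsLegs ρ) (hP : IsSwap ρ k P)
    (hδ : ∀ x, tOp Q ρ P k * δ x = δ x * tOp Q ρ P k) {j : ℕ} (h : k + 2 ≤ j) (x : locFin U) :
    tOp Q ρ P k * cvL (gam ρ j) δ x = cvL (gam ρ j) δ x * tOp Q ρ P k :=
  (pl_commute (fun y => (hρ.tOp_gam_of_lt hP h y).symm) (fun y => (hδ y).symm) _).symm

theorem IsLegs.yOp_cvL_gam (hρ : IsLegs ρ) (hδ : ∀ i, Cm (ρ i) δ) {j : ℕ} (h : k < j)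
    (x : locFin U) : yOp Q ρ k * cvL (gam ρ j) δ x = cvL (gam ρ j) δ x * yOp Q ρ k :=
  (pl_commute (fun y => hρ.yOp_gam h y)
    (fun y => (yOp_commute fun i _ z => hδ i z y).symm) _).symm

theorem cvL_gam_commute {c : B} {j : ℕ}
    (h0 : ∀ x, cvL (gam ρ 1) δ x * c = c * cvL (gam ρ 1) δ x)
    (h : ∀ i, 2 ≤ i → ∀ x, ρ i x * c = c * ρ i x) (hj : 1 ≤ j) (x : locFin U) :
    cvL (gam ρ j) δ x * c = c * cvL (gam ρ j) δ x := by
  induction j, hj using Nat.le_induction generalizing x with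
  | base => exact h0 x
  | succ k hk ih =>
    rw [gam, cvL_assoc]
    exact pl_commute (h (k + 1) (by omega)) ih _

/-- The ribbon axiom R₂₁RΔ(ν) = ν ⊗ ν, with leg k + 1 as first and all lower legs together as second
factor. -/
theorem IsLegs.yOp_mul_gam_ribbon (hρ : IsLegs ρ) (ν : RibbonElement Q) (k : ℕ) :
    yOp Q ρ k * gam ρ (k + 1) ν.ν = ρ (k + 1) ν.ν * gam ρ k ν.ν := by
  have hag : Cm (ρ (k + 1)) (gam ρ k) := hρ.gam_right (by omega)
  have ha := hρ.hom (k + 1)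
  have hg := hρ.gam_isHom k
  have e1 : rOp Q (gam ρ k) (ρ (k + 1)) =
      pl (ρ (k + 1)) (gam ρ k) (TensorProduct.comm ℂ U U (Q.R : U ⊗[ℂ] U)) := (pl_comm hag _).symm
  rw [yOp, e1, rOp, gam, cv_apply, ← pl_mul ha hg hag, ← pl_mul ha hg hag, ν.comul_eq, pl_tmul]

variable (Q ρ) in
/-- The product of the first `k` of the operators `yOp`. -/
def yProd (k : ℕ) : B := (List.ofFn fun i : Fin k => yOp Q ρ i).prod

/-- The product `ρ_k(x) ⋯ ρ_1(x)`. -/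
def legProd (ρ : ℕ → U →ₗ[ℂ] B) (x : U) : ℕ → B
  | 0 => 1
  | k + 1 => ρ (k + 1) x * legProd ρ x k

theorem yProd_succ (k : ℕ) : yProd Q ρ (k + 1) = yProd Q ρ k * yOp Q ρ k := by
  rw [yProd, yProd, List.ofFn_succ', List.concat_eq_append, List.prod_append]
  simp

theorem yProd_commute {c : B} {k : ℕ} (h : ∀ i < k, yOp Q ρ i * c = c * yOp Q ρ i) :
    yProd Q ρ k * c = c * yProd Q ρ k := by
  induction k with
  | zero => simp [yProd]
  | succ k ih =>
    rw [yProd_succ, mul_assoc, h k (by omega), ← mul_assoc, ih fun i hi => h i (by omega),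
      mul_assoc]

/-- Telescoping: each double braiding splits the action of ν on one more leg off the total action,
and the earlier ones commute with that leg. -/
theorem IsLegs.yProd_mul_gam_ribbon (hρ : IsLegs ρ) (ν : RibbonElement Q) (k : ℕ) :
    yProd Q ρ k * gam ρ k ν.ν = legProd ρ (ν.ν : U) k * ρ 0 ν.ν := by
  induction k with
  | zero => simp [yProd, legProd, gam]
  | succ k ih =>
    rw [yProd_succ, mul_assoc, hρ.yOp_mul_gam_ribbon, ← mul_assoc,
      yProd_commute fun i hi => (hρ.yOp_leg (by omega) _).symm, mul_assoc, ih, legProd, mul_assoc]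

theorem legProd_commute {c : B} {x : U} {k : ℕ}
    (h : ∀ i, 1 ≤ i → i ≤ k → ρ i x * c = c * ρ i x) :
    legProd ρ x k * c = c * legProd ρ x k := by
  induction k with
  | zero => simp [legProd]
  | succ k ih =>
    rw [legProd, mul_assoc, ih fun i h1 h2 => h i h1 (by omega), ← mul_assoc,
      h (k + 1) (by omega) le_rfl, mul_assoc]

theorem IsLegs.central_commute (hρ : IsLegs ρ) {x : U} (hx : ∀ y, x * y = y * x) (i j : ℕ) (y : U) :
    ρ j y * ρ i x = ρ i x * ρ j y := by
  rcases eq_or_ne j i with rfl | h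
  · rw [← (hρ.hom j).mul, ← (hρ.hom j).mul, hx]
  · exact hρ.comm j i h y x

/-- R commutes with a central element on either leg, and the transposition merely permutes two
factors of the product. -/
theorem IsLegs.tOp_legProd (hρ : IsLegs ρ) (hP : IsSwap ρ k P) {x : U}
    (hx : ∀ y, x * y = y * x) {j : ℕ} (h : k + 2 ≤ j) :
    tOp Q ρ P k * legProd ρ x j = legProd ρ x j * tOp Q ρ P k := by
  induction j, h using Nat.le_induction with
  | base =>
    have h1 : legProd ρ x k * tOp Q ρ P k = tOp Q ρ P k * legProd ρ x k :=
      legProd_commute fun i _ _ => (hρ.tOp_leg hP (by omega) (by omega) x).symm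
    have h2 : rOp Q (ρ (k + 2)) (ρ (k + 1)) * (ρ (k + 2) x * ρ (k + 1) x) =
        ρ (k + 2) x * ρ (k + 1) x * rOp Q (ρ (k + 2)) (ρ (k + 1)) := by
      rw [← mul_assoc, rOp_commute (hρ.central_commute hx _ _) (hρ.central_commute hx _ _),
        mul_assoc, rOp_commute (hρ.central_commute hx _ _) (hρ.central_commute hx _ _), mul_assoc]
    have h3 : P * (ρ (k + 2) x * ρ (k + 1) x) = ρ (k + 2) x * ρ (k + 1) x * P := by
      rw [← mul_assoc, hP.right, mul_assoc, hP.left, ← mul_assoc,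
        hρ.comm (k + 2) (k + 1) (by omega) x x]
    have h4 : tOp Q ρ P k * (ρ (k + 2) x * ρ (k + 1) x) =
        ρ (k + 2) x * ρ (k + 1) x * tOp Q ρ P k := by
      rw [tOp, mul_assoc, h2, ← mul_assoc, h3, mul_assoc]
    rw [legProd, legProd, ← mul_assoc (ρ (k + 2) x), mul_assoc _ (legProd ρ x k), h1,
      ← mul_assoc, h4, mul_assoc]
  | succ j hj ih =>
    rw [legProd, ← mul_assoc, hρ.tOp_leg hP (by omega) (by omega), mul_assoc, ih, mul_assoc]

end Legs

/-! #### Invariant vectors -/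

section Invariant

variable {U : Type u} [Ring U] [HopfAlgebra ℂ U] {Q : QuasiTriangular U}
  {Z : Type*} [AddCommGroup Z] [Module ℂ Z]

/-- Since δ = (g ∘ S) * (g * δ) for convolution, and g * δ acts on z by ε, only g ∘ S remains. -/
theorem apply_eq_of_invariant {g : U →ₗ[ℂ] Module.End ℂ Z} {δ : locFin U →ₗ[ℂ] Module.End ℂ Z}
    (hg : IsHom (B := Module.End ℂ Z) g) {z : Z}
    (hz : ∀ x, cvL (B := Module.End ℂ Z) g δ x z = Coalgebra.counit (R := ℂ) (x : U) • z)
    (x : locFin U) : δ x z = g (anti U x) z := by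
  have h1 : cvL (B := Module.End ℂ Z) (g ∘ₗ anti U) (cvL (B := Module.End ℂ Z) g δ) = δ := by
    rw [← cvL_assoc, cv_anti_left hg, cvOne_cvL]
  have h2 : ∀ t : U ⊗[ℂ] locFin U,
      pl (B := Module.End ℂ Z) (g ∘ₗ anti U) (cvL (B := Module.End ℂ Z) g δ) t z =
      pl (B := Module.End ℂ Z) (g ∘ₗ anti U)
        (cvOne U (Module.End ℂ Z) ∘ₗ (locFin U).subtype) t z := by
    intro t
    induction t with
    | zero => simp
    | add a b ha hb => simp only [map_add, LinearMap.add_apply, ha, hb]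
    | tmul a b =>
      rw [pl_tmul, pl_tmul, Module.End.mul_apply, hz, Module.End.mul_apply]
      simp [Algebra.algebraMap_eq_smul_one]
  rw [← h1, cvL_apply, h2, ← cvL_apply, cvL_subtype, cv_cvOne]
  rfl

/-- Invariance and S(ν) = ν replace the total action of ν on z by δ(ν), which is the action on leg
0. The telescoped ribbon identity then has the invertible operator ρ₀(ν) on both sides, where it
cancels. -/
theorem yProd_apply_of_invariant {ρ : ℕ → U →ₗ[ℂ] Module.End ℂ Z}
    {δ : locFin U →ₗ[ℂ] Module.End ℂ Z} (hρ : IsLegs (B := Module.End ℂ Z) ρ)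
    (ν : RibbonElement Q) (hν : (ν.ν : U) ∈ locFin U) (hδν : δ ⟨ν.ν, hν⟩ = ρ 0 ν.ν) {k : ℕ} {z : Z}
    (hz : ∀ x, cvL (B := Module.End ℂ Z) (gam (B := Module.End ℂ Z) ρ k) δ x z =
      Coalgebra.counit (R := ℂ) (x : U) • z) :
    yProd (B := Module.End ℂ Z) Q ρ k z = legProd (B := Module.End ℂ Z) ρ ν.ν k z := by
  have h1 := apply_eq_of_invariant (hρ.gam_isHom k) hz ⟨ν.ν, hν⟩
  have h2 : gam (B := Module.End ℂ Z) ρ k ν.ν z = ρ 0 ν.ν z := by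
    rw [← hδν, h1]
    change _ = gam (B := Module.End ℂ Z) ρ k (HopfAlgebra.antipode ℂ (ν.ν : U)) z
    rw [ν.antipode_eq]
  have h3 := LinearMap.congr_fun (hρ.yProd_mul_gam_ribbon ν k) z
  have h4 : yProd (B := Module.End ℂ Z) Q ρ k * ρ 0 ν.ν =
      ρ 0 ν.ν * yProd (B := Module.End ℂ Z) Q ρ k :=
    yProd_commute fun i _ => yOp_commute fun j _ y => hρ.central_commute ν.central 0 j y
  have h5 : legProd (B := Module.End ℂ Z) ρ (ν.ν : U) k * ρ 0 ν.ν =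
      ρ 0 ν.ν * legProd (B := Module.End ℂ Z) ρ (ν.ν : U) k :=
    legProd_commute fun i _ _ => hρ.central_commute ν.central 0 i _
  have h6 : ρ 0 (ν.ν⁻¹ : Uˣ) * ρ 0 ν.ν = 1 := by
    rw [← (hρ.hom 0).mul, Units.inv_mul, (hρ.hom 0).one]
  rw [Module.End.mul_apply, h2, ← Module.End.mul_apply, h4, h5] at h3
  have h7 := congrArg (ρ 0 (ν.ν⁻¹ : Uˣ)) h3
  rwa [← Module.End.mul_apply, ← Module.End.mul_apply, ← mul_assoc, ← mul_assoc, h6, one_mul,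
    one_mul] at h7

end Invariant

/-! ### Canonical elements -/

section Canonical

variable {U : Type u} [Ring U] [HopfAlgebra ℂ U] {Q : QuasiTriangular U}
  {B : Type*} [Ring B] [Algebra ℂ B]

/-- An element of `F ⊗ B`, read as a map `U → B`, is equal to `α`. -/
def Represents (t : RDual U ⊗[ℂ] B) (α : U →ₗ[ℂ] B) : Prop := ∀ h, evalAt B h t = α h

theorem evalAt_rTensor_actL (p h : U) (t : RDual U ⊗[ℂ] B) :
    evalAt B h ((actL U p).rTensor B t) = evalAt B (anti U p * h) t := by
  induction t with
  | zero => simp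
  | add a b ha hb => simp only [map_add, ha, hb]
  | tmul f e => simp

theorem evalAt_rTensor_actR (q h : U) (t : RDual U ⊗[ℂ] B) :
    evalAt B h ((actR U q).rTensor B t) = evalAt B (h * q) t := by
  induction t with
  | zero => simp
  | add a b ha hb => simp only [map_add, ha, hb]
  | tmul f e => simp

variable {t : RDual U ⊗[ℂ] B} {α : U →ₗ[ℂ] B}

/-- The action on F is translation of the argument by S(p), and α is multiplicative, so translation
becomes multiplication by α(S(p)). This is how a canonical element trades actions on F for
operators. -/
theorem Represents.actL (ht : Represents t α) (hα : IsHom α) (p : U) :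
    (actL U p).rTensor B t = (LinearMap.mulLeft ℂ (α (anti U p))).lTensor _ t :=
  eq_of_evalAt fun h => by
    rw [evalAt_rTensor_actL, evalAt_lTensor, ht, ht, hα.mul]
    rfl

theorem Represents.actR (ht : Represents t α) (hα : IsHom α) (q : U) :
    (actR U q).rTensor B t = (LinearMap.mulRight ℂ (α q)).lTensor _ t :=
  eq_of_evalAt fun h => by
    rw [evalAt_rTensor_actR, evalAt_lTensor, ht, ht, hα.mul]
    rfl

theorem Represents.commute (ht : Represents t α) {c : B} (hc : ∀ x, α x * c = c * α x) :
    (LinearMap.mulLeft ℂ c).lTensor _ t = (LinearMap.mulRight ℂ c).lTensor _ t :=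
  eq_of_evalAt fun h => by
    rw [evalAt_lTensor, evalAt_lTensor, ht]
    exact (hc h).symm

/-! ### Contraction of a canonical element with a map on `F` -/

section Lam

variable {D : Type*} [AddCommGroup D] [Module ℂ D] (θ : D →ₗ[ℂ] B)

/-- For `t = ∑ f ⊗ e` in `F ⊗ B`, the map `m ↦ ∑ e θ(m(f))`. -/
def lam : RDual U ⊗[ℂ] B →ₗ[ℂ] (RDual U →ₗ[ℂ] D) →ₗ[ℂ] B :=
  TensorProduct.lift (LinearMap.mk₂ ℂ
    (fun f e => LinearMap.mulLeft ℂ e ∘ₗ θ ∘ₗ LinearMap.applyₗ f)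
    (by intros; ext; simp [mul_add]) (by intros; ext; simp)
    (by intros; ext; simp [add_mul]) (by intros; ext; simp))

@[simp] theorem lam_tmul (f : RDual U) (e : B) (m : RDual U →ₗ[ℂ] D) :
    lam θ (f ⊗ₜ e) m = e * θ (m f) := rfl

variable {θ}

theorem lam_rTensor (φ : Module.End ℂ (RDual U)) (t : RDual U ⊗[ℂ] B) (m : RDual U →ₗ[ℂ] D) :
    lam θ (φ.rTensor B t) m = lam θ t (m ∘ₗ φ) := by
  induction t with
  | zero => simp
  | add a b ha hb => simp only [map_add, LinearMap.add_apply, ha, hb]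
  | tmul f e => simp

theorem lam_mulLeft (c : B) (t : RDual U ⊗[ℂ] B) (m : RDual U →ₗ[ℂ] D) :
    lam θ ((LinearMap.mulLeft ℂ c).lTensor _ t) m = c * lam θ t m := by
  induction t with
  | zero => simp
  | add a b ha hb => simp only [map_add, LinearMap.add_apply, ha, hb, mul_add]
  | tmul f e => simp [mul_assoc]

theorem lam_mulRight {c : B} (hc : ∀ d, c * θ d = θ d * c) (t : RDual U ⊗[ℂ] B)
    (m : RDual U →ₗ[ℂ] D) :
    lam θ ((LinearMap.mulRight ℂ c).lTensor _ t) m = lam θ t m * c := by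
  induction t with
  | zero => simp
  | add a b ha hb => simp only [map_add, LinearMap.add_apply, ha, hb, add_mul]
  | tmul f e => simp [mul_assoc, hc]

theorem lam_commute (ht : Represents t α) {c : B} (hc : ∀ x, α x * c = c * α x)
    (hc' : ∀ d, c * θ d = θ d * c) (m : RDual U →ₗ[ℂ] D) : c * lam θ t m = lam θ t m * c := by
  rw [← lam_mulLeft, ht.commute hc, lam_mulRight hc']

theorem lam_preActL (ht : Represents t α) (hα : IsHom α) (m : RDual U →ₗ[ℂ] D) (p : U) :
    lam θ t (ract m (preActL U D p)) = α (anti U p) * lam θ t m := by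
  rw [← lam_mulLeft, ← ht.actL hα, lam_rTensor]
  rfl

theorem lam_preActR (ht : Represents t α) (hα : IsHom α) (hθ : Cm α θ) (m : RDual U →ₗ[ℂ] D)
    (q : U) : lam θ t (ract m (preActR U D q)) = lam θ t m * α q := by
  rw [← lam_mulRight (hθ q), ← ht.actR hα, lam_rTensor]
  rfl

theorem lam_postL_right {b : ROp D} {c : B} (hb : ∀ d, θ (ract d b) = θ d * c)
    (t : RDual U ⊗[ℂ] B) (m : RDual U →ₗ[ℂ] D) :
    lam θ t (ract m (postL (RDual U) D b)) = lam θ t m * c := by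
  induction t with
  | zero => simp
  | add a b ha hb => simp only [map_add, LinearMap.add_apply, ha, hb, add_mul]
  | tmul f e => rw [lam_tmul, lam_tmul, mul_assoc, ← hb]; rfl

theorem lam_postL_left {b : ROp D} {c : B} (hb : ∀ d, θ (ract d b) = c * θ d)
    (ht : Represents t α) (hc : ∀ x, α x * c = c * α x) (m : RDual U →ₗ[ℂ] D) :
    lam θ t (ract m (postL (RDual U) D b)) = c * lam θ t m := by
  rw [← lam_mulLeft, ht.commute hc]
  clear ht
  induction t with
  | zero => simp
  | add a b ha hb => simp only [map_add, LinearMap.add_apply, ha, hb]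
  | tmul f e =>
    rw [lam_tmul, LinearMap.lTensor_tmul, lam_tmul, LinearMap.mulRight_apply, mul_assoc, ← hb]
    rfl

end Lam

/-! #### Intertwining of iterated operators -/

section Intertwine

variable {H X Y : Type*} [AddCommGroup H] [Module ℂ H] [AddCommGroup X] [Module ℂ X]
  [AddCommGroup Y] [Module ℂ Y] {Λ : H →ₗ[ℂ] B} {β : X →ₗ[ℂ] ROp H} {β' : Y →ₗ[ℂ] ROp H}
  {γ : X →ₗ[ℂ] B} {γ' : Y →ₗ[ℂ] B}

theorem map_ract_pl_right (h : ∀ m x, Λ (ract m (β x)) = Λ m * γ x)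
    (h' : ∀ m y, Λ (ract m (β' y)) = Λ m * γ' y) (m : H) (s : X ⊗[ℂ] Y) :
    Λ (ract m (pl β β' s)) = Λ m * pl γ γ' s := by
  induction s with
  | zero => simp
  | add a b ha hb => simp only [map_add, ha, hb, mul_add]
  | tmul x y => rw [pl_tmul, pl_tmul, ract_mul, h', h, mul_assoc]

/-- Successive right operators pile up on the left in reverse order, so γ and γ' have to commute,
unlike in the right-handed version. -/
theorem map_ract_pl_left (h : ∀ m x, Λ (ract m (β x)) = γ x * Λ m)
    (h' : ∀ m y, Λ (ract m (β' y)) = γ' y * Λ m) (hc : Cm γ γ') (m : H) (s : X ⊗[ℂ] Y) :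
    Λ (ract m (pl β β' s)) = pl γ γ' s * Λ m := by
  induction s with
  | zero => simp
  | add a b ha hb => simp only [map_add, ha, hb, add_mul]
  | tmul x y => rw [pl_tmul, pl_tmul, ract_mul, h', h, ← mul_assoc, hc]

theorem map_ract_pl_both (h : ∀ m x, Λ (ract m (β x)) = γ x * Λ m)
    (h' : ∀ m y, Λ (ract m (β' y)) = Λ m * γ' y) (m : H) (s : X ⊗[ℂ] Y) :
    Λ (ract m (pl β β' s)) = pl γ (LinearMap.mulLeft ℂ (Λ m) ∘ₗ γ') s := by
  induction s with
  | zero => simp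
  | add a b ha hb => simp only [map_add, ha, hb]
  | tmul x y => rw [pl_tmul, pl_tmul, ract_mul, h', h, mul_assoc]; rfl

theorem pl_mulRight_right (c : B) (s : X ⊗[ℂ] Y) :
    pl γ (LinearMap.mulRight ℂ c ∘ₗ γ') s = pl γ γ' s * c := by
  induction s with
  | zero => simp
  | add a b ha hb => simp only [map_add, ha, hb, add_mul]
  | tmul x y => simp [mul_assoc]

end Intertwine

/-! #### The canonical element of `A` -/

section CanonicalA

variable {θ : DU Q →ₗ[ℂ] B}

theorem lam_postR (hθ : IsHom θ) (t : RDual U ⊗[ℂ] B) (m : RDual U →ₗ[ℂ] DU Q) (d : DU Q) :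
    lam θ t (ract m (postR Q d)) = lam θ t m * θ d :=
  lam_postL_right (b := mulR (DU Q) d) (fun d' => hθ.mul d' d) t m

theorem lam_postM (hθ : IsHom θ) (ht : Represents t α) (hαθ : Cm α θ) (m : RDual U →ₗ[ℂ] DU Q)
    (d : DU Q) : lam θ t (ract m (postM Q d)) = θ d * lam θ t m :=
  lam_postL_left (b := mulL (DU Q) d) (fun d' => hθ.mul d d') ht (fun x => hαθ x d) m

variable (θ) in
/-- `U` acting through `∂_◁`. -/
abbrev baseU : U →ₗ[ℂ] B := θ ∘ₗ DU.iU Q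

theorem lam_postU (hθ : IsHom θ) (t : RDual U ⊗[ℂ] B) (m : RDual U →ₗ[ℂ] DU Q) (x : U) :
    lam θ t (ract m (postU Q x)) = lam θ t m * baseU θ x := lam_postR hθ t m _

/-- Contracting `adD_cross` with the canonical element gives ad(y)L = ∑ α(S(y₁)) L α(y₂) ad(y₃);
convolution with α on the left cancels the antipode. Hence X₁ commutes with U'. -/
theorem cvL_mul_lam_iA (hθ : IsHom θ) (ht : Represents t α) (hα : IsHom α)
    (hαθ : Cm α θ) (x : locFin U) :
    cvL α (θ ∘ₗ adD Q) x * lam θ t (DU.iA Q) = lam θ t (DU.iA Q) * cvL α (θ ∘ₗ adD Q) x := by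
  set L := lam θ t (DU.iA Q) with hL
  have hR : ∀ m (s : U ⊗[ℂ] locFin U), lam θ t (ract m (pl (preActR U _) (postR Q ∘ₗ adD Q) s)) =
      lam θ t m * pl α (θ ∘ₗ adD Q) s :=
    map_ract_pl_right (fun m q => lam_preActR ht hα hαθ m q) fun m y => lam_postR hθ t m (adD Q y)
  have h1 : LinearMap.mulRight ℂ L ∘ₗ θ ∘ₗ adD Q =
      cvL (α ∘ₗ anti U) (LinearMap.mulLeft ℂ L ∘ₗ cvL α (θ ∘ₗ adD Q)) := by
    ext y
    have h2 : θ (adD Q y) * L = _ := (lam_postM hθ ht hαθ (DU.iA Q) (adD Q y)).symm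
    refine h2.trans ?_
    rw [adD_cross, preAd, cvL_assoc, cvL_apply]
    exact map_ract_pl_both (γ := α ∘ₗ anti U) (γ' := cvL α (θ ∘ₗ adD Q))
      (fun m p => lam_preActL ht hα m p) (fun m z => hR m (comulLocFin U z)) _ _
  have h3 := congrArg (fun η => cvL α η x) h1
  rw [← cvL_assoc, cv_anti_right hα, cvOne_cvL, cvL_apply, pl_mulRight_right] at h3
  exact h3

/-- The same contraction applied to the cross relation of ∂_◁. The conjugation by R does not
disappear now: L carries the action of `U` on M alone, conjugated by R, into the action on V ⊗ M. -/
theorem cv_mul_lam_iA (hθ : IsHom θ) (ht : Represents t α) (hα : IsHom α)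
    (hαθ : Cm α θ) (x : U) : cv α (baseU θ) x * lam θ t (DU.iA Q) = lam θ t (DU.iA Q) *
    (rInv Q α (baseU θ) * baseU θ x * rOp Q α (baseU θ)) := by
  set L := lam θ t (DU.iA Q) with hL
  have hR : ∀ m (s : U ⊗[ℂ] U), lam θ t (ract m (pl (preActR U _) (postU Q) s)) =
      lam θ t m * pl α (baseU θ) s :=
    map_ract_pl_right (fun m q => lam_preActR ht hα hαθ m q) fun m y => lam_postU hθ t m y
  have h1 : LinearMap.mulRight ℂ L ∘ₗ baseU θ =
      LinearMap.mulRight ℂ (rOp Q α (baseU θ)) ∘ₗ cv (α ∘ₗ anti U)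
        (LinearMap.mulLeft ℂ (L * rInv Q α (baseU θ)) ∘ₗ baseU θ) := by
    ext y
    have h2 : baseU θ y * L = _ := (lam_postM hθ ht hαθ (DU.iA Q) (DU.iU Q y)).symm
    refine h2.trans ?_
    rw [cross_iA, ract_mul, ract_mul, rOp, hR]
    have h4 := map_ract_pl_both (Λ := lam θ t) (γ := α ∘ₗ anti U) (γ' := baseU θ)
      (fun m p => lam_preActL ht hα m p) (fun m z => lam_postU hθ t m z)
      (ract (DU.iA Q) (rInv Q (preActR U (DU Q)) (postU Q))) (Coalgebra.comul y)
    rw [rInv, hR] at h4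
    rw [rInv, cv_apply, h4]
    rfl
  have h3 := congrArg (fun η => cv α η x) h1
  rw [cv_apply, pl_mulRight_right] at h3
  rw [cv_apply, h3, cv_apply, pl_mulRight_right, ← cv_apply, ← cv_assoc, cv_anti_right hα, cvOne_cv]
  simp only [LinearMap.comp_apply, LinearMap.mulLeft_apply, mul_assoc]

end CanonicalA

end Canonical

section CanonicalMul

variable {U : Type u} [Ring U] [HopfAlgebra ℂ U] {Q : QuasiTriangular U}
  {B : Type*} [Ring B] [Algebra ℂ B]

/-! #### Products of canonical elements -/

/-- The product of `F ⊗ B`. -/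
def convMul (s t : RDual U ⊗[ℂ] B) : RDual U ⊗[ℂ] B :=
  TensorProduct.map₂ (fMul U) (LinearMap.mul ℂ B) s t

@[simp] theorem convMul_tmul (f g : RDual U) (d e : B) :
    convMul (f ⊗ₜ[ℂ] d) (g ⊗ₜ[ℂ] e) = fMul U f g ⊗ₜ (d * e) := rfl

/-- An element of `F ⊗ B`, read as a linear map. -/
def toMap : RDual U ⊗[ℂ] B →ₗ[ℂ] (U →ₗ[ℂ] B) :=
  dualTensorHom ℂ U B ∘ₗ (RDual U).subtype.rTensor B

theorem toMap_tmul (f : RDual U) (d : B) (h : U) :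
    toMap (f ⊗ₜ[ℂ] d) h = (f : Module.Dual ℂ U) h • d := rfl

theorem toMap_apply (t : RDual U ⊗[ℂ] B) (h : U) : toMap t h = evalAt B h t := by
  induction t with
  | zero => simp
  | add a b ha hb => simp only [map_add, LinearMap.add_apply, ha, hb]
  | tmul f e => rfl

theorem evalAt_convMul (s t : RDual U ⊗[ℂ] B) (h : U) :
    evalAt B h (convMul s t) = cv (toMap s) (toMap t) h := by
  rw [cv_apply]
  induction s with
  | zero => simp [convMul]
  | add a b ha hb =>
    rw [map_add, pl_add_left, ← ha, ← hb, ← map_add]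
    simp [convMul]
  | tmul f d =>
    induction t with
    | zero => simp [convMul]
    | add a b ha hb =>
      rw [map_add, pl_add_right, ← ha, ← hb, ← map_add]
      simp [convMul]
    | tmul g e =>
      rw [convMul_tmul, evalAt_tmul, fMul_apply]
      generalize (Coalgebra.comul (R := ℂ) h : U ⊗[ℂ] U) = r
      induction r with
      | zero => simp
      | add a b ha hb => simp only [map_add, add_smul, ha, hb]
      | tmul x y => simp [toMap_tmul, smul_smul, mul_comm]

variable {s t : RDual U ⊗[ℂ] B} {α β : U →ₗ[ℂ] B}

theorem Represents.convMul (hs : Represents s α) (ht : Represents t β) :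
    Represents (convMul s t) (cv α β) := by
  have h1 : toMap s = α := LinearMap.ext fun h => (toMap_apply s h).trans (hs h)
  have h2 : toMap t = β := LinearMap.ext fun h => (toMap_apply t h).trans (ht h)
  intro h
  rw [evalAt_convMul, h1, h2]

theorem lam_lam_mulPair {θ : DU Q →ₗ[ℂ] B} (φ : RDual U →ₗ[ℂ] DU Q) :
    lam (lam θ t) s (mulPair Q φ) = lam θ (convMul s t) φ := by
  induction s with
  | zero => simp [convMul]
  | add a b ha hb =>
    rw [map_add, LinearMap.add_apply, ha, hb, ← LinearMap.add_apply, ← map_add]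
    simp [convMul]
  | tmul f d =>
    induction t with
    | zero => simp [convMul]
    | add a b ha hb =>
      have h1 : convMul (f ⊗ₜ[ℂ] d) (a + b) = convMul (f ⊗ₜ d) a + convMul (f ⊗ₜ d) b := by
        simp [convMul]
      rw [lam_tmul] at ha hb ⊢
      rw [h1, map_add, map_add, LinearMap.add_apply, LinearMap.add_apply, mul_add, ha, hb]
    | tmul g e => simp [mul_assoc]

/-- The coefficients of the second canonical element pass θ of the first factor because β commutes
with θ. Together with `lam_lam_mulPair`, this turns a product formula in D_U into one for operators.
-/
theorem lam_lam_prodPair {θ : DU Q →ₗ[ℂ] B} (hθ : IsHom θ) (ht : Represents t β) (hβθ : Cm β θ)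
    (φ ψ : RDual U →ₗ[ℂ] DU Q) :
    lam (lam θ t) s (prodPair Q φ ψ) = lam θ s φ * lam θ t ψ := by
  induction s with
  | zero => simp
  | add a b ha hb => simp only [map_add, LinearMap.add_apply, ha, hb, add_mul]
  | tmul f d =>
    rw [lam_tmul, lam_tmul, mul_assoc, ← lam_postM hθ ht hβθ]
    rfl

theorem lam_one {θ : DU Q →ₗ[ℂ] B} (hθ : IsHom θ) (ht : Represents t (cvOne U B)) :
    lam θ t (xi Q) = 1 := by
  have h : t = fOne U ⊗ₜ[ℂ] (1 : B) := eq_of_evalAt fun h => by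
    rw [ht, evalAt_tmul, cvOne_apply, Algebra.algebraMap_eq_smul_one]
    rfl
  rw [h, lam_tmul, xi_one, hθ.one, one_mul]

/-! #### Invertibility -/

theorem prodPair_xi_xi : prodPair Q (xi Q) (xi Q) = mulPair Q (xi Q) :=
  LinearMap.ext₂ xi_mul

/-- As ξ is multiplicative on F, contraction with ξ takes convolution to products, and α ∘ S is the
convolution inverse of α. -/
theorem isUnit_lam_xi {θ : DU Q →ₗ[ℂ] B} (hθ : IsHom θ) (hs : Represents s α)
    (hα : IsHom α) (hαθ : Cm α θ) (ht : Represents t (α ∘ₗ anti U)) : IsUnit (lam θ s (xi Q)) := by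
  have h1 : lam θ s (xi Q) * lam θ t (xi Q) = 1 := by
    rw [← lam_lam_prodPair hθ ht (hαθ.comp_left _), prodPair_xi_xi, lam_lam_mulPair]
    refine lam_one hθ ?_
    rw [← cv_anti_right hα]
    exact hs.convMul ht
  have h2 : lam θ t (xi Q) * lam θ s (xi Q) = 1 := by
    rw [← lam_lam_prodPair hθ hs hαθ, prodPair_xi_xi, lam_lam_mulPair]
    refine lam_one hθ ?_
    rw [← cv_anti_left hα]
    exact ht.convMul hs
  exact ⟨⟨_, _, h1, h2⟩, rfl⟩

theorem pl_op {X Y : Type*} [AddCommGroup X] [Module ℂ X] [AddCommGroup Y] [Module ℂ Y]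
    (f : X →ₗ[ℂ] B) (g : Y →ₗ[ℂ] B) (r : X ⊗[ℂ] Y) :
    pl ((MulOpposite.opLinearEquiv ℂ).toLinearMap ∘ₗ f)
      ((MulOpposite.opLinearEquiv ℂ).toLinearMap ∘ₗ g) r =
      MulOpposite.op (pl g f (TensorProduct.comm ℂ X Y r)) := by
  induction r with
  | zero => simp
  | add a b ha hb => simp only [map_add, ha, hb, MulOpposite.op_add]
  | tmul x y => simp

/-- The hypothesis f(x) = ∑ α(S(x₂))g(x₁) is a convolution in the opposite algebra, where α ∘ S is
multiplicative; its inverse there is α ∘ S². -/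
theorem eq_pl_anti_anti (hα : IsHom α) {f g : U →ₗ[ℂ] B}
    (h : ∀ x, f x = pl (α ∘ₗ anti U) g (TensorProduct.comm ℂ U U (Coalgebra.comul x))) (x : U) :
    g x = pl (α ∘ₗ anti U ∘ₗ anti U) f (TensorProduct.comm ℂ U U (Coalgebra.comul x)) := by
  set o := (MulOpposite.opLinearEquiv ℂ (M := B)).toLinearMap with ho
  have hβ : IsHom (o ∘ₗ α ∘ₗ anti U) :=
    ⟨by simp [o, hα.one], fun x y => by
      simp [o, HopfAlgebra.antipode_mul_antidistrib, hα.mul]⟩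
  have h1 : o ∘ₗ f = cv (o ∘ₗ g) (o ∘ₗ α ∘ₗ anti U) := by
    ext y
    rw [cv_apply, ho, pl_op, ← h]
    rfl
  have h2 : cv (o ∘ₗ f) ((o ∘ₗ α ∘ₗ anti U) ∘ₗ anti U) = o ∘ₗ g := by
    rw [h1, cv_assoc, cv_anti_right hβ, cv_cvOne]
  have h3 := LinearMap.congr_fun h2.symm x
  rw [cv_apply, LinearMap.comp_assoc, LinearMap.comp_assoc, ho, pl_op] at h3
  exact MulOpposite.op_injective h3

/-- Under (id ⊗ Δ)R = R₁₃R₁₂ the factor R₁₃ has both of its legs in α and contracts to α(S(u)), with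
u the Drinfeld element. -/
theorem pl_anti_cv_anti_anti (hα : IsHom α) {γ : U →ₗ[ℂ] B} (hαγ : Cm α γ) (hγ : IsHom γ) :
    rOp Q (α ∘ₗ anti U) (cv γ (α ∘ₗ anti U ∘ₗ anti U)) =
      rInv Q α γ * α (anti U (drinfeld Q)) := by
  have key : ∀ s t : U ⊗[ℂ] U, pl (α ∘ₗ anti U) (pl γ (α ∘ₗ anti U ∘ₗ anti U))
      (leg13 U s * leg12 U t) = pl (α ∘ₗ anti U) γ t * α (anti U (sandwich 1 s)) := by
    intro s t
    induction s with
    | zero => simp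
    | add a b ha hb => simp only [map_add, add_mul, mul_add, ha, hb]
    | tmul a b =>
      induction t with
      | zero => simp
      | add c d hc hd => simp only [map_add, add_mul, mul_add, hc, hd]
      | tmul c d =>
        have e1 : sandwich 1 (a ⊗ₜ[ℂ] b) = anti U b * a := by simp [sandwich]
        have e2 := hαγ (anti U a * anti U (anti U b)) d
        simp only [hα.mul] at e2
        simp only [leg13, leg12, Algebra.TensorProduct.map_tmul, AlgHom.id_apply,
          Algebra.TensorProduct.includeLeft_apply, Algebra.TensorProduct.includeRight_apply,
          Algebra.TensorProduct.tmul_mul_tmul, one_mul, mul_one, pl_tmul, LinearMap.comp_apply, e1,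
          HopfAlgebra.antipode_mul_antidistrib, hα.mul]
        rw [mul_assoc, mul_assoc, ← e2, mul_assoc, hαγ]
  rw [rOp, pl_cv_right, Q.comul_right, key, drinfeld, ← rOp_anti_left hα hγ hαγ]
  rfl

/-- A is ξ(F) twisted by R between ad = L ⊗ R and `U`. The R-part contracts to multiplication by R
on the right. In the L-part the `U`-leg must be carried past the contraction of ξ, which doubles it
and produces the Drinfeld element. All factors besides the contraction of ξ are invertible, and so
is X₁. -/
theorem lam_iA_eq {θ : DU Q →ₗ[ℂ] B} (hθ : IsHom θ) (ht : Represents t α) (hα : IsHom α)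
    (hαθ : Cm α θ) : lam θ t (DU.iA Q) = rInv Q α (baseU θ) * α (anti U (drinfeld Q)) *
      lam θ t (xi Q) * rOp Q α (baseU θ) := by
  set X := lam θ t (xi Q) with hX
  have hαU : Cm α (baseU θ) := hαθ.comp_right _
  have hU : IsHom (baseU θ) := hθ.comp (iU_isHom Q)
  -- The Heisenberg rule contracted with t: U(x)X = ∑ α(S(x₂)) X U(x₁). It is then solved for X
  -- U(x).
  have hf : ∀ x, (LinearMap.mulRight ℂ X ∘ₗ baseU θ) x = pl (α ∘ₗ anti U)
      (LinearMap.mulLeft ℂ X ∘ₗ baseU θ) (TensorProduct.comm ℂ U U (Coalgebra.comul x)) := by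
    intro x
    have h2 : baseU θ x * X = _ := (lam_postM hθ ht hαθ (xi Q) (DU.iU Q x)).symm
    refine h2.trans ?_
    rw [cross_xi, cv_apply]
    generalize (Coalgebra.comul (R := ℂ) x : U ⊗[ℂ] U) = r
    induction r with
    | zero => simp
    | add a b ha hb => simp only [map_add, ha, hb]
    | tmul a b =>
      rw [pl_tmul, ract_mul, lam_preActL ht hα, lam_postU hθ]
      rfl
  have hg : LinearMap.mulLeft ℂ X ∘ₗ baseU θ =
      LinearMap.mulRight ℂ X ∘ₗ cv (baseU θ) (α ∘ₗ anti U ∘ₗ anti U) := by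
    ext x
    rw [eq_pl_anti_anti hα hf, pl_mulRight_right, pl_comm (hαU.comp_left _)]
    rfl
  rw [iA_eq_ract_xi, preAd, rOp_cv_left postU_isHom preActR_postU, ract_mul]
  have h1 := map_ract_pl_right (Λ := lam θ t) (γ := α) (γ' := baseU θ)
    (fun m q => lam_preActR ht hα hαθ m q) (fun m z => lam_postU hθ t m z)
    (ract (xi Q) (rOp Q (preActL U (DU Q)) (postU Q))) (Q.R : U ⊗[ℂ] U)
  have h2 := map_ract_pl_both (Λ := lam θ t) (γ := α ∘ₗ anti U) (γ' := baseU θ)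
    (fun m p => lam_preActL ht hα m p) (fun m z => lam_postU hθ t m z) (xi Q) (Q.R : U ⊗[ℂ] U)
  rw [← hX, hg, pl_mulRight_right] at h2
  have h3 := pl_anti_cv_anti_anti (Q := Q) hα hαU hU
  rw [rOp] at h1 h3
  rw [rOp, rOp, h1, h2, h3]
  rfl

theorem isUnit_lam_iA {θ : DU Q →ₗ[ℂ] B} (hθ : IsHom θ) (hs : Represents s α)
    (hα : IsHom α) (hαθ : Cm α θ) (ht : Represents t (α ∘ₗ anti U)) :
    IsUnit (lam θ s (DU.iA Q)) := by
  have hαU : Cm α (baseU θ) := hαθ.comp_right _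
  have hU : IsHom (baseU θ) := hθ.comp (iU_isHom Q)
  have h1 : α (anti U (drinfeld Q)) * α (anti U (drinfeldInv Q)) = 1 := by
    rw [← hα.mul, ← HopfAlgebra.antipode_mul_antidistrib, drinfeldInv_mul,
      HopfAlgebra.antipode_one, hα.one]
  have h2 : α (anti U (drinfeldInv Q)) * α (anti U (drinfeld Q)) = 1 := by
    rw [← hα.mul, ← HopfAlgebra.antipode_mul_antidistrib, drinfeld_mul_inv,
      HopfAlgebra.antipode_one, hα.one]
  have h3 : IsUnit (rInv Q α (baseU θ)) :=
    ⟨⟨_, _, rInv_mul_rOp hα hU hαU, rOp_mul_rInv hα hU hαU⟩, rfl⟩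
  have h4 : IsUnit (α (anti U (drinfeld Q))) := ⟨⟨_, _, h1, h2⟩, rfl⟩
  rw [lam_iA_eq hθ hs hα hαθ]
  exact ((h3.mul h4).mul (isUnit_lam_xi hθ hs hα hαθ ht)).mul (isUnit_rOp hα hU hαU)

/-! #### The reflection equation -/

/-- The product of A is that of F twisted by R between ad on the first and the left action on the
second variable. Its part in the right action contracts to the R between the two canonical elements,
since (id ⊗ S)R⁻¹ = R; its part in the left action comes out in front, since (S ⊗ S)R = R. -/
theorem lam_mul_rOp_mul_lam {θ : DU Q →ₗ[ℂ] B} (hθ : IsHom θ) (hs : Represents s α)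
    (ht : Represents t β) (hα : IsHom α) (hβ : IsHom β) (hαβ : Cm α β) (hαθ : Cm α θ)
    (hβθ : Cm β θ) :
    lam θ s (DU.iA Q) * rOp Q α β * lam θ t (DU.iA Q) =
      rOp Q α β * lam θ (convMul s t) (DU.iA Q) := by
  set L := lam θ s (DU.iA Q) with hL
  set L' := lam θ t (DU.iA Q) with hL'
  have hαlam : Cm α (lam θ t) := fun x m =>
    lam_commute ht (fun y => (hαβ x y).symm) (fun d => hαθ x d) m
  have hL1 : ∀ m x, lam (lam θ t) s (ract m (fstL Q x)) =
      (α ∘ₗ anti U) x * lam (lam θ t) s m := fun m x => lam_preActL hs hα m x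
  have hR1 : ∀ m x, lam (lam θ t) s (ract m (fstR Q x)) = lam (lam θ t) s m * α x :=
    fun m x => lam_preActR hs hα hαlam m x
  have hL2 : ∀ m x, lam (lam θ t) s (ract m (sndL Q x)) =
      (β ∘ₗ anti U) x * lam (lam θ t) s m := fun m x =>
    lam_postL_left (b := preActL U (DU Q) x) (fun d => lam_preActL ht hβ d x) hs
      (fun y => hαβ y (anti U x)) m
  have h1 : ∀ r : U ⊗[ℂ] U, lam (lam θ t) s
      (ract (prodPair Q (DU.iA Q) (DU.iA Q)) (pl (fstR Q) (sndL Q) r)) =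
      L * pl α (β ∘ₗ anti U) r * L' := by
    intro r
    induction r with
    | zero => simp
    | add a b ha hb => simp only [map_add, ha, hb, mul_add, add_mul]
    | tmul a b =>
      have e1 : β (anti U b) * L = L * β (anti U b) :=
        lam_commute hs (fun x => hαβ x _) (fun d => hβθ _ d) _
      have e2 : α a * L' = L' * α a :=
        lam_commute ht (fun x => (hαβ a x).symm) (fun d => hαθ _ d) _
      rw [pl_tmul, ract_mul, hL2, hR1, lam_lam_prodPair hθ ht hβθ, pl_tmul, mul_assoc, ← e2,
        ← mul_assoc, LinearMap.comp_apply, e1, mul_assoc, ← mul_assoc _ (α a), ← hαβ]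
      simp only [mul_assoc]
  have h2 := h1 ((Q.R⁻¹ : (U ⊗[ℂ] U)ˣ) : U ⊗[ℂ] U)
  have e3 : Cm (fstL Q) (sndL Q) := fstL_snd2 _
  have e4 : Cm (fstR Q) (sndL Q) := fstR_snd2 _
  have e5 : IsHom (sndL Q) := snd2_isHom preActL_isHom
  have e6 : IsHom (fstR Q) := preActR_isHom
  have h3 : rOp Q (fstAd Q) (sndL Q) * rInv Q (fstR Q) (sndL Q) = rOp Q (fstL Q) (sndL Q) := by
    rw [fstAd, preAd, rOp_cv_left e5 e4, mul_assoc, rOp_mul_rInv e6 e5 e4, mul_one]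
  have h4 := map_ract_pl_left (Λ := lam (lam θ t) s) (γ := α ∘ₗ anti U)
    (γ' := β ∘ₗ anti U) hL1 hL2 (fun x y => hαβ _ _)
    (mulPair Q (DU.iA Q)) (Q.R : U ⊗[ℂ] U)
  rw [← rOp, ← rOp, rOp_anti_anti, lam_lam_mulPair] at h4
  rw [prodPair_iA, ← rInv, ← ract_mul, h3, h4, ← rInv, rInv_anti_right hα hβ hαβ] at h2
  exact h2.symm

/-- By the previous formula both sides are contractions of canonical elements of tensor products, of
α ⊗ β on one side and β ⊗ α on the other, and R intertwines these two representations. -/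
theorem reflection_equation {θ : DU Q →ₗ[ℂ] B} (hθ : IsHom θ) (hs : Represents s α)
    (ht : Represents t β) (hα : IsHom α) (hβ : IsHom β) (hαβ : Cm α β) (hαθ : Cm α θ)
    (hβθ : Cm β θ) :
    lam θ s (DU.iA Q) * (rOp Q α β * lam θ t (DU.iA Q) * rOp Q β α) =
      rOp Q α β * lam θ t (DU.iA Q) * rOp Q β α * lam θ s (DU.iA Q) := by
  have h1 := lam_mul_rOp_mul_lam hθ hs ht hα hβ hαβ hαθ hβθ
  have h2 := lam_mul_rOp_mul_lam hθ ht hs hβ hα hαβ.symm hβθ hαθ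
  have h3 : (LinearMap.mulLeft ℂ (rOp Q β α)).lTensor _ (convMul t s) =
      (LinearMap.mulRight ℂ (rOp Q β α)).lTensor _ (convMul s t) :=
    eq_of_evalAt fun h => by
      rw [evalAt_lTensor, evalAt_lTensor, hs.convMul ht, ht.convMul hs]
      exact rOp_mul_cv hβ hα hαβ.symm h
  have h4 : rOp Q β α * lam θ (convMul t s) (DU.iA Q) =
      lam θ (convMul s t) (DU.iA Q) * rOp Q β α := by
    rw [← lam_mulLeft, h3, lam_mulRight]
    exact fun d => rOp_commute (fun x => hβθ x d) (fun x => hαθ x d)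
  calc lam θ s (DU.iA Q) * (rOp Q α β * lam θ t (DU.iA Q) * rOp Q β α)
      = rOp Q α β * (lam θ (convMul s t) (DU.iA Q) * rOp Q β α) := by
        rw [← mul_assoc, ← mul_assoc, h1, mul_assoc]
    _ = _ := by
        rw [← h4, ← h2]
        simp only [mul_assoc]

/-! #### The mixed relation -/

/-- By `cv_mul_lam_iA`, the operator LR⁻¹ carries the action on M to that on V ⊗ M, hence the double
braiding of β with M to that with V ⊗ M. Two Yang–Baxter moves bring the R-matrices into this form;
the double braiding of α with β is left over. -/
theorem lam_mul_doubleBraiding {θ : DU Q →ₗ[ℂ] B} (hθ : IsHom θ) (hs : Represents s α)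
    (hα : IsHom α) (hβ : IsHom β) (hαβ : Cm α β) (hαθ : Cm α θ) (hβθ : Cm β θ) :
    lam θ s (DU.iA Q) * (rOp Q (cv α (baseU θ)) β * rOp Q β (cv α (baseU θ))) =
      rOp Q (cv α (baseU θ)) β * rOp Q β (cv α (baseU θ)) * lam θ s (DU.iA Q) *
        (rOp Q α β * rOp Q β α) := by
  set L := lam θ s (DU.iA Q) with hL
  set γ := baseU θ with hγ'
  have hγ : IsHom γ := hθ.comp (iU_isHom Q)
  have hαγ : Cm α γ := hαθ.comp_right _
  have hβγ : Cm β γ := hβθ.comp_right _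
  have hβL : ∀ x, β x * L = L * β x := fun x =>
    lam_commute hs (fun y => hαβ y x) (fun d => hβθ x d) _
  set c : B := rOp Q α γ with hc
  set c' : B := rInv Q α γ with hc'
  have hcc' : c * c' = 1 := rOp_mul_rInv hα hγ hαγ
  have hc'c : c' * c = 1 := rInv_mul_rOp hα hγ hαγ
  have hβc : ∀ x, β x * c = c * β x := fun x =>
    (rOp_commute (fun y => hαβ y x) (fun y => (hβγ x y).symm)).symm
  have hcv : ∀ x, cv α γ x * (L * c') = L * c' * γ x := by
    intro x
    rw [← mul_assoc, cv_mul_lam_iA hθ hs hα hαθ, ← hL, ← hγ', mul_assoc, mul_assoc, mul_assoc]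
    rw [hcc', mul_one, mul_assoc]
  have hβLc : ∀ x, β x * (L * c') = L * c' * β x := by
    intro x
    have h1 : β x * c' = c' * β x :=
      (rInv_commute (fun y => hαβ y x) (fun y => (hβγ x y).symm)).symm
    rw [← mul_assoc, hβL, mul_assoc, h1, mul_assoc]
  have h1 : rOp Q (cv α γ) β * (L * c') = L * c' * rOp Q γ β :=
    (pl_conj (fun x => (hcv x).symm) (fun x => (hβLc x).symm) _).symm
  have h2 : rOp Q β (cv α γ) * (L * c') = L * c' * rOp Q β γ :=
    (pl_conj (fun x => (hβLc x).symm) (fun x => (hcv x).symm) _).symm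
  have y1 : rOp Q α β * rOp Q α γ * rOp Q β γ = rOp Q β γ * rOp Q α γ * rOp Q α β :=
    rOp_yangBaxter hα hβ hγ hαβ hαγ hβγ
  have y2 : rOp Q α γ * rOp Q α β * rOp Q γ β = rOp Q γ β * rOp Q α β * rOp Q α γ :=
    rOp_yangBaxter hα hγ hβ hαγ hαβ hβγ.symm
  have e1 : rOp Q (cv α γ) β = rOp Q α β * rOp Q γ β := rOp_cv_left hβ hβγ.symm
  have e2 : rOp Q β (cv α γ) = rOp Q β γ * rOp Q β α := rOp_cv_right hβ hβγ hαγ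
  calc L * (rOp Q (cv α γ) β * rOp Q β (cv α γ))
      = L * c' * (c * rOp Q α β * rOp Q γ β) * rOp Q β γ * rOp Q β α := by
        rw [e1, e2]
        simp only [← mul_assoc]
        rw [mul_assoc L c' c, hc'c, mul_one]
    _ = L * c' * rOp Q γ β * (rOp Q β γ * c * rOp Q α β) * rOp Q β α := by
        rw [hc, y2, ← y1]
        simp only [mul_assoc]
    _ = rOp Q (cv α γ) β * (L * c' * rOp Q β γ) * c * rOp Q α β * rOp Q β α := by
        rw [← h1]
        simp only [mul_assoc]
    _ = rOp Q (cv α γ) β * rOp Q β (cv α γ) * L * (c' * c) * rOp Q α β * rOp Q β α := by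
        rw [← h2]
        simp only [mul_assoc]
    _ = _ := by
        rw [hc'c, mul_one]
        simp only [mul_assoc]

end CanonicalMul

/-! ### Canonical elements of finite-dimensional representations -/

section CanonicalV

variable {U : Type u} [Ring U] [HopfAlgebra ℂ U]

theorem comp_anti_mem {φ : Module.Dual ℂ U} (h : φ ∈ RDual U) : φ ∘ₗ anti U ∈ RDual U := by
  induction h using Submodule.span_induction with
  | zero => simp
  | add a b _ _ ha hb => simpa [LinearMap.add_comp] using add_mem ha hb
  | smul c a _ ha => simpa [LinearMap.smul_comp] using Submodule.smul_mem _ c ha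
  | mem φ h =>
    obtain ⟨k, ρ, f, e, rfl⟩ := h
    -- The dual representation: composing a matrix coefficient with S gives a coefficient of it,
    -- with vector and functional exchanged.
    let ρ' : U →ₐ[ℂ] Module.End ℂ (Module.Dual ℂ (Fin k → ℂ)) := AlgHom.ofLinearMap
      (Module.Dual.transpose (R := ℂ) (M := Fin k → ℂ) (M' := Fin k → ℂ) ∘ₗ
        ρ.toLinearMap ∘ₗ anti U)
      (by ext; simp; rfl)
      (by intro x y; ext; simp [HopfAlgebra.antipode_mul_antidistrib]; rfl)
    exact coeff_mem ρ' (Module.Dual.eval ℂ _ e) f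

variable {V : Type v} [AddCommGroup V] [Module ℂ V] [FiniteDimensional ℂ V]

/-- A linear map to `End V` whose matrix coefficients belong to `F` is given by an element of
`F ⊗ End V`. -/
theorem exists_represents {α : U →ₗ[ℂ] Module.End ℂ V}
    (h : ∀ (f : Module.Dual ℂ V) (e : V), f ∘ₗ LinearMap.applyₗ e ∘ₗ α ∈ RDual U) :
    Represents (B := Module.End ℂ V) (∑ k, ∑ l,
      (⟨_, h ((Module.finBasis ℂ V).coord k) (Module.finBasis ℂ V l)⟩ : RDual U) ⊗ₜ[ℂ]
        ((Module.finBasis ℂ V).coord l).smulRight (Module.finBasis ℂ V k)) α := by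
  intro x
  set b := Module.finBasis ℂ V
  refine b.ext fun j => ?_
  have h1 : ∀ k l, ((⟨_, h (b.coord k) (b l)⟩ : RDual U) : Module.Dual ℂ U) x =
      b.repr (α x (b l)) k := fun k l => rfl
  simp only [map_sum, evalAt_tmul, h1, LinearMap.sum_apply, LinearMap.smul_apply,
    LinearMap.smulRight_apply, Module.Basis.coord_apply, Module.Basis.repr_self]
  conv_rhs => rw [← b.sum_repr (α x (b j))]
  refine Finset.sum_congr rfl fun k _ => ?_
  rw [Finset.sum_eq_single j]
  · simp
  · intro l _ hl
    simp [Finsupp.single_eq_of_ne hl]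
  · simp

variable [Module U V] [IsScalarTower ℂ U V]

variable (U V) in
/-- The canonical element `∑ c_{eₖ*, eₗ} ⊗ E_{kl}` of a finite-dimensional representation. -/
def canV : RDual U ⊗[ℂ] Module.End ℂ V :=
  ∑ k, ∑ l, fCoeff U ((Module.finBasis ℂ V).coord k) (Module.finBasis ℂ V l) ⊗ₜ[ℂ]
    ((Module.finBasis ℂ V).coord l).smulRight (Module.finBasis ℂ V k)

theorem canV_represents : Represents (B := Module.End ℂ V) (canV U V) (actV U V).toLinearMap :=
  exists_represents (α := (actV U V).toLinearMap) fun f e => (fCoeff U f e).2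

theorem exists_represents_anti : ∃ t : RDual U ⊗[ℂ] Module.End ℂ V,
    Represents (B := Module.End ℂ V) t ((actV U V).toLinearMap ∘ₗ anti U) :=
  ⟨_, exists_represents (α := (actV U V).toLinearMap ∘ₗ anti U)
    fun f e => comp_anti_mem (fCoeff U f e).2⟩

theorem Represents.map {A B : Type*} [Ring A] [Algebra ℂ A] [Ring B] [Algebra ℂ B]
    {t : RDual U ⊗[ℂ] A} {α : U →ₗ[ℂ] A} (h : Represents t α) (f : A →ₗ[ℂ] B) :
    Represents (f.lTensor _ t) (f ∘ₗ α) := fun x => by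
  rw [evalAt_lTensor, h]
  rfl

theorem lam_conj {A B D : Type*} [Ring A] [Algebra ℂ A] [Ring B] [Algebra ℂ B] [AddCommGroup D]
    [Module ℂ D] {θ : D →ₗ[ℂ] B} {f g : A →ₗ[ℂ] B} {c : B} (hc : ∀ e, c * f e = g e * c)
    (hθ : ∀ d, c * θ d = θ d * c) (t : RDual U ⊗[ℂ] A) (m : RDual U →ₗ[ℂ] D) :
    c * lam θ (f.lTensor _ t) m = lam θ (g.lTensor _ t) m * c := by
  induction t with
  | zero => simp
  | add a b ha hb => simp only [map_add, LinearMap.add_apply, ha, hb, mul_add, add_mul]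
  | tmul f e =>
    rw [LinearMap.lTensor_tmul, LinearMap.lTensor_tmul, lam_tmul, lam_tmul, ← mul_assoc, hc,
      mul_assoc, hθ, mul_assoc]

end CanonicalV

/-! ### The ribbon element -/

section Ribbon

variable {U : Type u} [Ring U] [HopfAlgebra ℂ U] {Q : QuasiTriangular U}

theorem adj_central {x : U} (hx : ∀ y, x * y = y * x) (h : U) :
    adj U h x = Coalgebra.counit (R := ℂ) h • x := by
  have e1 : (LinearMap.mulRight ℂ x ∘ₗ cvOne U U) h = (LinearMap.mulRight ℂ x ∘ₗ
      cv (B := U) LinearMap.id (LinearMap.id ∘ₗ anti U)) h := by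
    rw [cv_anti_right ⟨rfl, fun _ _ => rfl⟩]
  have e2 : ∀ t : U ⊗[ℂ] U, Algebra.TensorProduct.lift (Algebra.lmul ℂ U) (mulRightAntipode U)
      (fun a b => by ext y; simp [mulRightAntipode, mul_assoc]) t x =
      pl (B := U) LinearMap.id (LinearMap.id ∘ₗ anti U) t * x := by
    intro t
    induction t with
    | zero => simp
    | add a b ha hb => simp only [map_add, LinearMap.add_apply, ha, hb, add_mul]
    | tmul a b => simp [mulRightAntipode, mul_assoc, hx]
  refine (e2 _).trans (e1.symm.trans ?_)
  simp [Algebra.algebraMap_eq_smul_one]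

theorem central_mem_locFin {x : U} (hx : ∀ y, x * y = y * x) : x ∈ locFin U := by
  refine Submodule.finiteDimensional_of_le (S₂ := ℂ ∙ x) ?_
  rintro _ ⟨h, rfl⟩
  change adj U h x ∈ _
  rw [adj_central hx]
  exact Submodule.smul_mem _ _ (Submodule.mem_span_singleton_self x)

/-- Centrality gives ad(h)ν = ε(h)ν, so the coadjoint element is ε ⊗ S⁻¹(ν) = ε ⊗ ν. -/
theorem rightDer_ribbon (ν : RibbonElement Q) (hν : (ν.ν : U) ∈ locFin U) :
    rightDer Q ⟨ν.ν, hν⟩ = DU.iU Q ν.ν := by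
  have h1 : coadInv U ⟨ν.ν, hν⟩ = fOne U ⊗ₜ[ℂ] (ν.ν : U) := by
    apply eq_of_anti_evalAt Q
    intro h
    rw [anti_evalAt_coadInv Q, adj_central ν.central, evalAt_tmul, map_smul]
    change _ = _ • HopfAlgebra.antipode ℂ (ν.ν : U)
    rw [ν.antipode_eq]
    rfl
  rw [rightDer_apply, h1, xiInv_tmul, xi_one, one_mul]

end Ribbon

/-! ### The operators on the tensor space -/

section TensorOps

variable {V : Type v} [AddCommGroup V] [Module ℂ V] {n : ℕ}
  {M : Type w} [AddCommGroup M] [Module ℂ M]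
  {U : Type u} [Ring U] [HopfAlgebra ℂ U] {Q : QuasiTriangular U}
  [Module U V] [IsScalarTower ℂ U V] [Module (DU Q) M] [IsScalarTower ℂ (DU Q) M]

variable (V n M Q) in
/-- The actions of `U` on the factors of `V^{⊗n} ⊗ M`. -/
def legs : ℕ → U →ₗ[ℂ] Module.End ℂ (TensorSpace V n M)
  | 0 => legMU V n M Q
  -- Beyond the n factors `U` acts trivially, so that the family is indexed by all of ℕ and remains
  -- pairwise commuting.
  | k + 1 => if h : k < n then legU U V n M ⟨k, h⟩ else cvOne U (Module.End ℂ (TensorSpace V n M))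

theorem legs_succ {k : ℕ} (h : k < n) : legs V n M Q (k + 1) = legU U V n M ⟨k, h⟩ := dif_pos h

theorem legs_of_le {k : ℕ} (h : n ≤ k) :
    legs V n M Q (k + 1) = cvOne U (Module.End ℂ (TensorSpace V n M)) := dif_neg (by omega)

theorem legs_commute {k : ℕ} {c : Module.End ℂ (TensorSpace V n M)}
    (h : ∀ h : k < n, ∀ x, legU U V n M ⟨k, h⟩ x * c = c * legU U V n M ⟨k, h⟩ x) (x : U) :
    legs V n M Q (k + 1) x * c = c * legs V n M Q (k + 1) x := by
  by_cases hk : k < n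
  · rw [legs_succ hk]
    exact h hk x
  · rw [legs_of_le (not_lt.1 hk)]
    exact (cm_cvOne (B := Module.End ℂ (TensorSpace V n M)) LinearMap.id c x).symm

theorem legs_isLegs : IsLegs (B := Module.End ℂ (TensorSpace V n M)) (legs V n M Q) := by
  have h0 : ∀ k, Cm (B := Module.End ℂ (TensorSpace V n M)) (legs V n M Q (k + 1))
      (legs V n M Q 0) := fun k x y => legs_commute (fun h z => legU_legMU ⟨k, h⟩ z y) x
  refine ⟨fun i => ?_, fun i j hij => ?_⟩
  · rcases i with _ | k
    · exact legMU_isHom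
    · by_cases hk : k < n
      · rw [legs_succ hk]
        exact legU_isHom _
      · rw [legs_of_le (not_lt.1 hk)]
        exact cvOne_isHom
  · rcases i with _ | k
    · rcases j with _ | l
      · exact absurd rfl hij
      · exact (h0 l).symm
    · rcases j with _ | l
      · exact h0 k
      · intro x y
        refine legs_commute (fun hk z => ?_) x
        refine (legs_commute (fun hl z' => ?_) y).symm
        exact legU_legU (fun e => hij (congrArg (· + 1) (Fin.ext_iff.1 e).symm)) z' z

theorem legs_legMR (i : ℕ) : Cm (B := Module.End ℂ (TensorSpace V n M)) (legs V n M Q i)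
    (legMR V n M Q) := by
  rcases i with _ | k
  · exact legMU_legMR
  · exact fun x y => legs_commute (fun h z => legU_legMR ⟨k, h⟩ z y) x

theorem legs_legM (i : ℕ) : Cm (B := Module.End ℂ (TensorSpace V n M)) (legs V n M Q (i + 1))
    (legM V n M Q) := fun x y => legs_commute (fun h z => legU_legM ⟨i, h⟩ z y) x

theorem swapV_isSwap {k : ℕ} (h : k + 1 < n) : IsSwap (B := Module.End ℂ (TensorSpace V n M))
    (legs V n M Q) k (swapV V n M ⟨k, by omega⟩ ⟨k + 1, h⟩) := by
  refine ⟨swapV_mul_self _ _, fun x => ?_, fun x => ?_, fun i h1 h2 x => ?_⟩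
  · rw [legs_succ h, legs_succ (by omega)]
    exact swapV_legV_left _ _ (actV U V x)
  · rw [legs_succ h, legs_succ (by omega)]
    exact swapV_legV_right _ _ (actV U V x)
  · rcases i with _ | i
    · exact swapV_legM _ _ _
    · refine (legs_commute (fun hi z => (swapV_legU_of_ne ?_ ?_ z).symm) x).symm
      · exact fun e => h1 (congrArg (· + 1) (Fin.ext_iff.1 e))
      · exact fun e => h2 (congrArg (· + 1) (Fin.ext_iff.1 e))

theorem opT_eq_tOp {k : ℕ} (h : k + 1 < n) : opT V n M Q k h =
    tOp (B := Module.End ℂ (TensorSpace V n M)) Q (legs V n M Q)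
      (swapV V n M ⟨k, by omega⟩ ⟨k + 1, h⟩) k := by
  rw [tOp, legs_succ h, legs_succ (by omega)]
  rfl

/-- The recursion Y ↦ TYT adds one leg to a double braiding; this closed form makes the relations of
the Y's accessible. -/
theorem opY_eq_yOp {k : ℕ} (h : k < n) : opY V n M Q k h =
    yOp (B := Module.End ℂ (TensorSpace V n M)) Q (legs V n M Q) k := by
  induction k with
  | zero =>
    rw [yOp, legs_succ h]
    rfl
  | succ k ih =>
    rw [opY, ih, opT_eq_tOp h]
    exact (legs_isLegs (V := V) (n := n) (M := M) (Q := Q)).tOp_yOp_tOp (swapV_isSwap h)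

/-- Splitting ad into ∂_◁ and ∂_▷ puts ∂_◁ at leg 0 of the family and leaves ∂_▷ as a separate last
factor, which commutes with all legs. -/
theorem totalAd_eq {k : ℕ} (h : k ≤ n) : totalAd V n M Q k h =
    cvL (B := Module.End ℂ (TensorSpace V n M))
      (gam (B := Module.End ℂ (TensorSpace V n M)) (legs V n M Q) k) (legMR V n M Q) := by
  induction k with
  | zero =>
    ext1 x
    rw [totalAd, LinearMap.comp_apply, adD_apply, cvL_apply, gam]
    generalize comulLocFin U x = t
    induction t with
    | zero => simp
    | add a b ha hb => simp only [map_add, ha, hb]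
    | tmul a b =>
      exact (legM_isHom (V := V) (n := n) (M := M) (Q := Q)).mul _ _
  | succ k ih =>
    rw [totalAd, ih, gam, cvL_assoc, legs_succ h]
    rfl

end TensorOps

/-! ### Consequences of the braid relations -/

section AbstractBraid

variable {G : Type*} [Monoid G] {n : ℕ} {T x : ℕ → G}

theorem braid_reflection_step {a b x : G} (hbx : b * x = x * b) (hab : a * b * a = b * a * b)
    (h : x * a * x * a = a * x * a * x) :
    (a * x * a) * b * (a * x * a) * b = b * (a * x * a) * b * (a * x * a) := by
  have e1 : (a * x * a) * b * (a * x * a) * b = a * b * (x * a * x * a) * b * a := by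
    calc (a * x * a) * b * (a * x * a) * b = a * x * (a * b * a) * x * a * b := by
          simp only [mul_assoc]
      _ = a * (x * b) * a * (b * x) * a * b := by rw [hab]; simp only [mul_assoc]
      _ = a * (b * x) * a * (x * b) * a * b := by rw [hbx]
      _ = a * b * x * a * x * (a * b * a) := by rw [hab]; simp only [mul_assoc]
      _ = _ := by simp only [mul_assoc]
  have e2 : b * (a * x * a) * b * (a * x * a) = a * b * (a * x * a * x) * b * a := by
    calc b * (a * x * a) * b * (a * x * a) = b * a * x * (a * b * a) * x * a := by
          simp only [mul_assoc]
      _ = b * a * (x * b) * a * (b * x) * a := by rw [hab]; simp only [mul_assoc]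
      _ = (b * a * b) * x * a * x * b * a := by
          rw [← hbx]
          nth_rewrite 2 [hbx]
          simp only [mul_assoc]
      _ = _ := by rw [← hab]; simp only [mul_assoc]
  rw [e1, e2, h]

theorem braid_shift_step {a b x : G} (hbx : b * x = x * b) (hab : a * b * a = b * a * b) :
    a * (b * (a * x * a) * b) = b * (a * x * a) * b * a := by
  calc a * (b * (a * x * a) * b) = (a * b * a) * x * a * b := by simp only [mul_assoc]
    _ = b * a * (b * x) * a * b := by rw [hab]; simp only [mul_assoc]
    _ = b * a * x * (b * a * b) := by rw [hbx]; simp only [mul_assoc]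
    _ = _ := by rw [← hab]; simp only [mul_assoc]

theorem conj_commute {c t x : G} (ht : c * t = t * c) (hx : c * x = x * c) :
    c * (t * x * t) = t * x * t * c := by
  rw [← mul_assoc, ← mul_assoc, ht, mul_assoc t c, hx, ← mul_assoc, mul_assoc _ c, ht,
    ← mul_assoc]

theorem braid_commute_of_lt (hx : ∀ i, i + 1 < n → x (i + 1) = T i * x i * T i)
    (hfar : ∀ i j, i + 2 ≤ j → j + 1 < n → T i * T j = T j * T i)
    (h0 : ∀ i, 1 ≤ i → i + 1 < n → T i * x 0 = x 0 * T i) {i j : ℕ} (hi : i + 1 < n)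
    (hj : j < i) : T i * x j = x j * T i := by
  induction j with
  | zero => exact h0 i hj hi
  | succ j ih =>
    rw [hx j (by omega)]
    exact conj_commute (hfar j i (by omega) hi).symm (ih (by omega))

theorem braid_commute_of_gt (hx : ∀ i, i + 1 < n → x (i + 1) = T i * x i * T i)
    (hbraid : ∀ i, i + 2 < n → T i * T (i + 1) * T i = T (i + 1) * T i * T (i + 1))
    (hfar : ∀ i j, i + 2 ≤ j → j + 1 < n → T i * T j = T j * T i)
    (h0 : ∀ i, 1 ≤ i → i + 1 < n → T i * x 0 = x 0 * T i) {i j : ℕ} (hj : j < n)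
    (hij : i + 2 ≤ j) : T i * x j = x j * T i := by
  induction j, hij using Nat.le_induction with
  | base =>
    rw [hx (i + 1) hj, hx i (by omega)]
    exact braid_shift_step (braid_commute_of_lt hx hfar h0 hj (by omega)) (hbraid i hj)
  | succ j hij ih =>
    rw [hx j hj]
    exact conj_commute (hfar i j hij hj) (ih (by omega))

/-- Braid moves carry the reflection equation from x₀ to every x_i; only the case i = 0 is an input.
-/
theorem braid_reflection (hx : ∀ i, i + 1 < n → x (i + 1) = T i * x i * T i)
    (hbraid : ∀ i, i + 2 < n → T i * T (i + 1) * T i = T (i + 1) * T i * T (i + 1))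
    (hfar : ∀ i j, i + 2 ≤ j → j + 1 < n → T i * T j = T j * T i)
    (h0 : ∀ i, 1 ≤ i → i + 1 < n → T i * x 0 = x 0 * T i)
    (hR : 1 < n → x 0 * T 0 * x 0 * T 0 = T 0 * x 0 * T 0 * x 0) {i : ℕ} (hi : i + 1 < n) :
    x i * T i * x i * T i = T i * x i * T i * x i := by
  induction i with
  | zero => exact hR hi
  | succ i ih =>
    have h1 : T (i + 1) * x i = x i * T (i + 1) := braid_commute_of_lt hx hfar h0 hi (by omega)
    rw [hx i (by omega)]
    exact braid_reflection_step h1 (hbraid i hi) (ih (by omega))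

/-- For neighbours the commutation is the reflection equation; further apart, conjugation by a T
commuting with the smaller element propagates it. -/
theorem braid_commute (hx : ∀ i, i + 1 < n → x (i + 1) = T i * x i * T i)
    (hbraid : ∀ i, i + 2 < n → T i * T (i + 1) * T i = T (i + 1) * T i * T (i + 1))
    (hfar : ∀ i j, i + 2 ≤ j → j + 1 < n → T i * T j = T j * T i)
    (h0 : ∀ i, 1 ≤ i → i + 1 < n → T i * x 0 = x 0 * T i)
    (hR : 1 < n → x 0 * T 0 * x 0 * T 0 = T 0 * x 0 * T 0 * x 0) {i j : ℕ} (hij : i < j)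
    (hj : j < n) : x i * x j = x j * x i := by
  induction j, hij using Nat.le_induction with
  | base =>
    change x i * x (i + 1) = x (i + 1) * x i
    rw [hx i hj, ← mul_assoc, ← mul_assoc]
    exact braid_reflection hx hbraid hfar h0 hR hj
  | succ j hij ih =>
    rw [hx j hj]
    exact conj_commute (braid_commute_of_lt hx hfar h0 hj hij).symm (ih (by omega))

end AbstractBraid

/-! ### Relations between the operators on the tensor space -/

section TensorOps

variable {V : Type v} [AddCommGroup V] [Module ℂ V] {n : ℕ}
  {M : Type w} [AddCommGroup M] [Module ℂ M]
  {U : Type u} [Ring U] [HopfAlgebra ℂ U] {Q : QuasiTriangular U}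
  [Module U V] [IsScalarTower ℂ U V] [Module (DU Q) M] [IsScalarTower ℂ (DU Q) M]

theorem legMR_commute_opT {k : ℕ} (h : k + 1 < n) (x : locFin U) :
    opT V n M Q k h * legMR V n M Q x = legMR V n M Q x * opT V n M Q k h := opT_legM _

theorem opT_totalAd {k : ℕ} (h : k + 1 < n) (x : locFin U) :
    opT V n M Q k h * totalAd V n M Q n le_rfl x = totalAd V n M Q n le_rfl x * opT V n M Q k h := by
  have h1 := legMR_commute_opT (V := V) (M := M) (Q := Q) h
  rw [opT_eq_tOp h] at h1
  rw [totalAd_eq, opT_eq_tOp h]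
  exact legs_isLegs.tOp_cvL_gam (B := Module.End ℂ (TensorSpace V n M)) (swapV_isSwap h) h1
    (by omega) x

theorem opY_totalAd {k : ℕ} (h : k < n) (x : locFin U) :
    opY V n M Q k h * totalAd V n M Q n le_rfl x = totalAd V n M Q n le_rfl x * opY V n M Q k h := by
  rw [totalAd_eq, opY_eq_yOp h]
  exact legs_isLegs.yOp_cvL_gam (B := Module.End ℂ (TensorSpace V n M)) legs_legMR h x

theorem opY_opY {j k : ℕ} (hj : j < n) (hk : k < n) :
    opY V n M Q j hj * opY V n M Q k hk = opY V n M Q k hk * opY V n M Q j hj := by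
  rw [opY_eq_yOp, opY_eq_yOp]
  rcases lt_trichotomy j k with h | rfl | h
  · exact (legs_isLegs.yOp_yOp (B := Module.End ℂ (TensorSpace V n M)) h).symm
  · rfl
  · exact legs_isLegs.yOp_yOp (B := Module.End ℂ (TensorSpace V n M)) h

theorem opT_opY {j k : ℕ} (hk : k + 1 < n) (hj : j < n) (h1 : j ≠ k) (h2 : j ≠ k + 1) :
    opT V n M Q k hk * opY V n M Q j hj = opY V n M Q j hj * opT V n M Q k hk := by
  rw [opY_eq_yOp, opT_eq_tOp]
  rcases Nat.lt_or_ge j k with h | h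
  · exact legs_isLegs.tOp_yOp_of_lt (B := Module.End ℂ (TensorSpace V n M)) (swapV_isSwap hk) h
  · exact legs_isLegs.tOp_yOp_of_gt (B := Module.End ℂ (TensorSpace V n M)) (swapV_isSwap hk)
      (by omega)

theorem isUnit_opY {k : ℕ} (h : k < n) : IsUnit (opY V n M Q k h) := by
  induction k with
  | zero =>
    exact (isUnit_rOp (B := Module.End ℂ (TensorSpace V n M)) legMU_isHom (legU_isHom _)
      (legU_legMU _).symm).mul (isUnit_rOp (B := Module.End ℂ (TensorSpace V n M)) (legU_isHom _)
      legMU_isHom (legU_legMU _))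
  | succ k ih => exact ((isUnit_opT k h).mul (ih (by omega))).mul (isUnit_opT k h)

variable [FiniteDimensional ℂ V]

variable (V n M Q) in
/-- The canonical element of `V`, acting on the factor `i` of `V^{⊗n} ⊗ M`. -/
def canLeg (i : Fin n) : Module.End ℂ (TensorSpace V n M) :=
  lam (B := Module.End ℂ (TensorSpace V n M)) (legM V n M Q)
    ((legV V n M i).lTensor _ (canV U V)) (DU.iA Q)

theorem opX_zero (h : 0 < n) : opX V n M Q 0 h = canLeg V n M Q ⟨0, h⟩ := by
  rw [opX, canLeg, canV]
  simp only [map_sum, LinearMap.lTensor_tmul, LinearMap.sum_apply, lam_tmul]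

theorem canLeg_represents (i : Fin n) : Represents (B := Module.End ℂ (TensorSpace V n M))
    ((legV V n M i).lTensor _ (canV U V)) (legU U V n M i) := canV_represents.map _

theorem isUnit_canLeg (i : Fin n) : IsUnit (canLeg V n M Q i) := by
  obtain ⟨t, ht⟩ := exists_represents_anti (U := U) (V := V)
  have h : Represents (B := Module.End ℂ (TensorSpace V n M)) ((legV V n M i).lTensor _ t)
    (legU U V n M i ∘ₗ anti U) := ht.map _
  exact isUnit_lam_iA (B := Module.End ℂ (TensorSpace V n M)) legM_isHom (canLeg_represents i)
    (legU_isHom i) (legU_legM i) h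

theorem isUnit_opX {k : ℕ} (h : k < n) : IsUnit (opX V n M Q k h) := by
  induction k with
  | zero =>
    rw [opX_zero]
    exact isUnit_canLeg _
  | succ k ih => exact ((isUnit_opT k h).mul (ih (by omega))).mul (isUnit_opT k h)

theorem canLeg_commute {i : Fin n} {c : Module.End ℂ (TensorSpace V n M)}
    (h1 : ∀ x, legU U V n M i x * c = c * legU U V n M i x)
    (h2 : ∀ d, c * legM V n M Q d = legM V n M Q d * c) :
    c * canLeg V n M Q i = canLeg V n M Q i * c :=
  lam_commute (B := Module.End ℂ (TensorSpace V n M)) (canLeg_represents i) h1 h2 _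

theorem opT_canLeg {i : Fin n} {k : ℕ} (hk : k + 1 < n) (h1 : (i : ℕ) ≠ k)
    (h2 : (i : ℕ) ≠ k + 1) :
    opT V n M Q k hk * canLeg V n M Q i = canLeg V n M Q i * opT V n M Q k hk :=
  canLeg_commute (fun x => (opT_legU h1 h2 x).symm) opT_legM

theorem legs_canLeg {i : Fin n} {k : ℕ} (h : (i : ℕ) ≠ k) (x : U) :
    legs V n M Q (k + 1) x * canLeg V n M Q i = canLeg V n M Q i * legs V n M Q (k + 1) x :=
  canLeg_commute (fun y => (legs_commute
    (fun _ z => legU_legU (fun e => h (Fin.ext_iff.1 e).symm) z y) x).symm)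
    (fun d => legs_legM k x d)

theorem canLeg_totalAd (h : 0 < n) (x : locFin U) :
    totalAd V n M Q n le_rfl x * canLeg V n M Q ⟨0, h⟩ =
      canLeg V n M Q ⟨0, h⟩ * totalAd V n M Q n le_rfl x := by
  rw [totalAd_eq]
  refine cvL_gam_commute (B := Module.End ℂ (TensorSpace V n M)) (fun y => ?_)
    (fun i hi y => ?_) h x
  -- With a single factor V the total action unfolds to α(x₁)ad(x₂), the form for which
  -- `cvL_mul_lam_iA` is stated.
  · rw [← totalAd_eq h]
    exact cvL_mul_lam_iA (B := Module.End ℂ (TensorSpace V n M)) legM_isHom (canLeg_represents _)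
      (legU_isHom _) (legU_legM _) y
  · obtain ⟨k, rfl⟩ : ∃ k, i = k + 1 := ⟨i - 1, by omega⟩
    exact legs_canLeg (i := ⟨0, h⟩) (show 0 ≠ k by omega) y

theorem opX_totalAd {k : ℕ} (h : k < n) (x : locFin U) :
    opX V n M Q k h * totalAd V n M Q n le_rfl x =
      totalAd V n M Q n le_rfl x * opX V n M Q k h := by
  induction k with
  | zero => rw [opX_zero, canLeg_totalAd]
  | succ k ih => exact (conj_commute (opT_totalAd h x).symm (ih (by omega)).symm).symm

theorem legProd_opX {x : U} (hx : ∀ y, x * y = y * x) {k : ℕ} (h : k < n) :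
    legProd (B := Module.End ℂ (TensorSpace V n M)) (legs V n M Q) x n * opX V n M Q k h =
      opX V n M Q k h * legProd (B := Module.End ℂ (TensorSpace V n M)) (legs V n M Q) x n := by
  induction k with
  | zero =>
    rw [opX_zero]
    refine legProd_commute (B := Module.End ℂ (TensorSpace V n M)) fun i h1 h2 => ?_
    obtain ⟨k, rfl⟩ : ∃ k, i = k + 1 := ⟨i - 1, by omega⟩
    rcases Nat.eq_zero_or_pos k with rfl | hk
    · refine canLeg_commute (fun y => ?_) (fun d => legs_legM 0 x d)
      rw [← legs_succ (M := M) (Q := Q) h]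
      exact legs_isLegs.central_commute (B := Module.End ℂ (TensorSpace V n M)) hx _ _ y
    · exact legs_canLeg (i := ⟨0, h⟩) (show 0 ≠ k by omega) x
  | succ k ih =>
    refine conj_commute ?_ (ih (by omega))
    rw [opT_eq_tOp h]
    exact (legs_isLegs.tOp_legProd (B := Module.End ℂ (TensorSpace V n M)) (swapV_isSwap h) hx
      (by omega)).symm

/-- Conjugation by the flip moves the canonical element to the second factor, so T₁X₁T₁ is R L R
with L on that factor, and the claim is the reflection equation. -/
theorem opX_opT_opX_opT (h : 0 + 1 < n) :
    opX V n M Q 0 (by omega) * opT V n M Q 0 h * opX V n M Q 0 (by omega) * opT V n M Q 0 h =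
      opT V n M Q 0 h * opX V n M Q 0 (by omega) * opT V n M Q 0 h * opX V n M Q 0 (by omega) := by
  set P := swapV V n M ⟨0, by omega⟩ ⟨0 + 1, h⟩ with hP
  set r := rLeg Q V n M ⟨0 + 1, h⟩ ⟨0, by omega⟩ with hr
  set r' := rLeg Q V n M ⟨0, by omega⟩ ⟨0 + 1, h⟩ with hr'
  have e1 : P * r = r' * P := swapV_rLeg (swapV_legV_right _ _) (swapV_legV_left _ _)
  have e2 : P * canLeg V n M Q ⟨0, by omega⟩ = canLeg V n M Q ⟨0 + 1, h⟩ * P :=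
    lam_conj (B := Module.End ℂ (TensorSpace V n M)) (swapV_legV_left _ _) (swapV_legM _ _) _ _
  have e3 : P * P = 1 := swapV_mul_self _ _
  have e4 : opT V n M Q 0 h * canLeg V n M Q ⟨0, by omega⟩ * opT V n M Q 0 h =
      r' * canLeg V n M Q ⟨0 + 1, h⟩ * r := by
    rw [opT_eq, ← hP, ← hr]
    calc P * r * canLeg V n M Q ⟨0, by omega⟩ * (P * r)
        = r' * (P * canLeg V n M Q ⟨0, by omega⟩) * P * r := by
          nth_rewrite 1 [e1]
          simp only [mul_assoc]
      _ = r' * canLeg V n M Q ⟨0 + 1, h⟩ * (P * P) * r := by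
          rw [e2]
          simp only [mul_assoc]
      _ = _ := by rw [e3, mul_one]
  have h01 : (⟨0, by omega⟩ : Fin n) ≠ ⟨0 + 1, h⟩ := by simp
  have e5 := reflection_equation (B := Module.End ℂ (TensorSpace V n M)) (Q := Q)
    (legM_isHom (V := V) (n := n) (M := M) (Q := Q)) (canLeg_represents ⟨0, by omega⟩)
    (canLeg_represents ⟨0 + 1, h⟩) (legU_isHom _) (legU_isHom _) (legU_legU h01) (legU_legM _)
    (legU_legM _)
  rw [opX_zero, e4, mul_assoc, mul_assoc, ← mul_assoc (opT V n M Q 0 h) (canLeg _ _ _ _ _), e4]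
  exact e5

/-- Y₂ is the double braiding of the second factor with V ⊗ M, and T₁² that of the two factors V. -/
theorem opX_opY (h : 0 + 1 < n) : opX V n M Q 0 (by omega) * opY V n M Q 1 h =
    opY V n M Q 1 h * opX V n M Q 0 (by omega) * opT V n M Q 0 h ^ 2 := by
  have h01 : (⟨0, by omega⟩ : Fin n) ≠ ⟨0 + 1, h⟩ := by simp
  have e1 := lam_mul_doubleBraiding (B := Module.End ℂ (TensorSpace V n M)) (Q := Q)
    (legM_isHom (V := V) (n := n) (M := M) (Q := Q)) (canLeg_represents ⟨0, by omega⟩)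
    (legU_isHom _) (legU_isHom _) (legU_legU h01) (legU_legM _) (legU_legM _)
  have e2 := legs_isLegs.tOp_sq (B := Module.End ℂ (TensorSpace V n M)) (Q := Q)
    (swapV_isSwap (V := V) (M := M) (Q := Q) h)
  rw [← opT_eq_tOp h, ← pow_two, legs_succ h, legs_succ (by omega)] at e2
  rw [e2, opX_zero, opY_eq_yOp, yOp, gam, gam, legs_succ h, legs_succ (by omega)]
  exact e1

end TensorOps

/-! ### The Hecke relation -/

section Hecke

variable {V : Type v} [AddCommGroup V] [Module ℂ V] {n : ℕ}
  {M : Type w} [AddCommGroup M] [Module ℂ M]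
  {U : Type u} [Ring U] [HopfAlgebra ℂ U] {Q : QuasiTriangular U}
  [Module U V] [IsScalarTower ℂ U V]

/-- The insertion of two vectors at the positions `i` and `j`. -/
def insertPair {i j : Fin n} (hij : i ≠ j) (v : Fin n → V) (m : M) :
    V ⊗[ℂ] V →ₗ[ℂ] TensorSpace V n M :=
  TensorProduct.lift (LinearMap.mk₂ ℂ (fun a b => PiTensorProduct.tprod ℂ
      (Function.update (Function.update v i a) j b) ⊗ₜ[ℂ] m)
    (by
      intro a a' b
      simp only [Function.update_comm hij, MultilinearMap.map_update_add, TensorProduct.add_tmul])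
    (by
      intro c a b
      simp only [Function.update_comm hij, MultilinearMap.map_update_smul,
        TensorProduct.smul_tmul'])
    (by
      intro a b b'
      simp only [MultilinearMap.map_update_add, TensorProduct.add_tmul])
    (by
      intro c a b
      simp only [MultilinearMap.map_update_smul, TensorProduct.smul_tmul']))

theorem insertPair_tmul {i j : Fin n} (hij : i ≠ j) (v : Fin n → V) (m : M) (a b : V) :
    insertPair hij v m (a ⊗ₜ b) = PiTensorProduct.tprod ℂ
      (Function.update (Function.update v i a) j b) ⊗ₜ[ℂ] m := rfl

theorem pl_legV_insertPair {i j : Fin n} (hij : i ≠ j) (v : Fin n → V) (m : M)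
    (t : U ⊗[ℂ] U) (z : V ⊗[ℂ] V) :
    pl (B := Module.End ℂ (TensorSpace V n M)) (legU U V n M i) (legU U V n M j) t
      (insertPair hij v m z) = insertPair hij v m (Module.endTensorEndAlgHom (R := ℂ) (S := ℂ)
        (A := ℂ) (M := V) (N := V) (Algebra.TensorProduct.map (actV U V) (actV U V) t) z) := by
  induction t with
  | zero => simp
  | add a b ha hb => simp only [map_add, LinearMap.add_apply, ha, hb]
  | tmul x y =>
    induction z with
    | zero => simp
    | add a b ha hb => simp only [map_add, ha, hb]
    | tmul a b =>
      rw [pl_tmul, Module.End.mul_apply, Algebra.TensorProduct.map_tmul,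
        Module.endTensorEndAlgHom_apply, TensorProduct.AlgebraTensorModule.map_tmul,
        insertPair_tmul, insertPair_tmul]
      have h1 : ∀ (k : Fin n) (x : U) (v : Fin n → V), legU U V n M k x
          (PiTensorProduct.tprod ℂ v ⊗ₜ m) =
          PiTensorProduct.tprod ℂ (Function.update v k (actV U V x (v k))) ⊗ₜ m :=
        fun k x v => legV_tmul k (actV U V x) v m
      rw [h1, h1]
      congr 2
      simp [Function.update_of_ne hij, Function.update_comm hij]

theorem swapV_insertPair {i j : Fin n} (hij : i ≠ j) (v : Fin n → V) (m : M) (z : V ⊗[ℂ] V) :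
    swapV V n M j i (insertPair hij v m z) =
      insertPair hij v m (TensorProduct.comm ℂ V V z) := by
  induction z with
  | zero => simp
  | add a b ha hb => simp only [map_add, ha, hb]
  | tmul a b =>
    rw [insertPair_tmul, TensorProduct.comm_tmul, insertPair_tmul, swapV_tmul]
    congr 2
    ext k
    rw [Function.comp_apply]
    rcases eq_or_ne k j with rfl | hj
    · simp [Function.update_of_ne hij]
    · rcases eq_or_ne k i with rfl | hi
      · simp [Function.update_of_ne hij]
      · simp [Equiv.swap_apply_of_ne_of_ne hj hi, hi, hj]

theorem opT_insertPair {k : ℕ} (h : k + 1 < n)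
    (hij : (⟨k + 1, h⟩ : Fin n) ≠ ⟨k, by omega⟩) (v : Fin n → V) (m : M) (z : V ⊗[ℂ] V) :
    opT V n M Q k h (insertPair hij v m z) = insertPair hij v m (braiding Q V z) := by
  rw [opT_eq, Module.End.mul_apply, rLeg, rOp, pl_legV_insertPair, swapV_insertPair]
  rfl

/-- Every pure tensor is an insertion of two vectors at neighbouring positions, and on insertions T
acts as the braiding of V ⊗ V. -/
theorem opT_hecke {c d : ℂ} (hσ : (braiding Q V - algebraMap ℂ _ c) *
    (braiding Q V + algebraMap ℂ _ d) = 0) {k : ℕ} (h : k + 1 < n) :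
    (opT V n M Q k h - algebraMap ℂ _ c) * (opT V n M Q k h + algebraMap ℂ _ d) = 0 := by
  have hij : (⟨k + 1, h⟩ : Fin n) ≠ ⟨k, by omega⟩ := by simp
  apply tensorSpace_ext
  intro v m
  have h1 : PiTensorProduct.tprod ℂ v ⊗ₜ[ℂ] m =
      insertPair hij v m (v ⟨k + 1, h⟩ ⊗ₜ v ⟨k, by omega⟩) := by
    rw [insertPair_tmul, Function.update_eq_self, Function.update_eq_self]
  have h2 : ∀ z, (opT V n M Q k h + algebraMap ℂ _ d) (insertPair hij v m z) =
      insertPair hij v m ((braiding Q V + algebraMap ℂ _ d) z) := by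
    intro z
    simp [Algebra.algebraMap_eq_smul_one, opT_insertPair h hij]
  have h3 : ∀ z, (opT V n M Q k h - algebraMap ℂ _ c) (insertPair hij v m z) =
      insertPair hij v m ((braiding Q V - algebraMap ℂ _ c) z) := by
    intro z
    simp [Algebra.algebraMap_eq_smul_one, opT_insertPair h hij]
  rw [h1, Module.End.mul_apply, h2, h3, ← Module.End.mul_apply, hσ]
  simp

end Hecke

/-! ### Functoriality of the operators -/

section Functoriality

variable {X Y Z Z' : Type*} [AddCommGroup X] [Module ℂ X] [AddCommGroup Y] [Module ℂ Y]
  [AddCommGroup Z] [Module ℂ Z] [AddCommGroup Z'] [Module ℂ Z']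

/-- Operators on two spaces are intertwined by a linear map. -/
def Intertwines (Φ : Z →ₗ[ℂ] Z') (a : Module.End ℂ Z) (a' : Module.End ℂ Z') : Prop :=
  ∀ z, Φ (a z) = a' (Φ z)

variable {Φ : Z →ₗ[ℂ] Z'}

theorem Intertwines.mul {a b : Module.End ℂ Z} {a' b' : Module.End ℂ Z'}
    (ha : Intertwines Φ a a') (hb : Intertwines Φ b b') : Intertwines Φ (a * b) (a' * b') :=
  fun z => by rw [Module.End.mul_apply, Module.End.mul_apply, ha, hb]

theorem Intertwines.sum {ι : Type*} {s : Finset ι} {a : ι → Module.End ℂ Z}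
    {a' : ι → Module.End ℂ Z'} (h : ∀ i ∈ s, Intertwines Φ (a i) (a' i)) :
    Intertwines Φ (∑ i ∈ s, a i) (∑ i ∈ s, a' i) := fun z => by
  rw [LinearMap.sum_apply, LinearMap.sum_apply, map_sum]
  exact Finset.sum_congr rfl fun i hi => h i hi z

theorem Intertwines.pl {α : X →ₗ[ℂ] Module.End ℂ Z} {β : Y →ₗ[ℂ] Module.End ℂ Z}
    {α' : X →ₗ[ℂ] Module.End ℂ Z'} {β' : Y →ₗ[ℂ] Module.End ℂ Z'}
    (hα : ∀ x, Intertwines Φ (α x) (α' x)) (hβ : ∀ y, Intertwines Φ (β y) (β' y))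
    (t : X ⊗[ℂ] Y) : Intertwines Φ (place α β t) (place α' β' t) := by
  induction t with
  | zero => intro z; simp
  | add a b ha hb =>
    intro z
    rw [map_add, map_add, LinearMap.add_apply, LinearMap.add_apply, map_add, ha, hb]
  | tmul x y => exact (hα x).mul (hβ y)

end Functoriality

section TensorFunctoriality

variable {V : Type v} [AddCommGroup V] [Module ℂ V] {n : ℕ}
  {M N : Type w} [AddCommGroup M] [Module ℂ M] [AddCommGroup N] [Module ℂ N]
  {U : Type u} [Ring U] [HopfAlgebra ℂ U] {Q : QuasiTriangular U} {f : M →ₗ[ℂ] N}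

theorem intertwines_legV (i : Fin n) (A : Module.End ℂ V) :
    Intertwines (f.lTensor (⨂[ℂ] _ : Fin n, V)) (legV V n M i A) (legV V n N i A) :=
  LinearMap.congr_fun (f := f.lTensor _ ∘ₗ legV V n M i A) (g := legV V n N i A ∘ₗ f.lTensor _)
    (tensorSpace_ext fun v m => by simp [legV_tmul])

theorem intertwines_swapV (i j : Fin n) :
    Intertwines (f.lTensor (⨂[ℂ] _ : Fin n, V)) (swapV V n M i j) (swapV V n N i j) :=
  LinearMap.congr_fun (f := f.lTensor _ ∘ₗ swapV V n M i j) (g := swapV V n N i j ∘ₗ f.lTensor _)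
    (tensorSpace_ext fun v m => by simp [swapV_tmul])

section

variable [Module (DU Q) M] [IsScalarTower ℂ (DU Q) M] [Module (DU Q) N] [IsScalarTower ℂ (DU Q) N]

theorem intertwines_legM (hf : ∀ (d : DU Q) m, f (d • m) = d • f m) (d : DU Q) :
    Intertwines (f.lTensor (⨂[ℂ] _ : Fin n, V)) (legM V n M Q d) (legM V n N Q d) :=
  LinearMap.congr_fun (f := f.lTensor _ ∘ₗ legM V n M Q d) (g := legM V n N Q d ∘ₗ f.lTensor _)
    (tensorSpace_ext fun v m => by simp [legM_tmul, hf])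

end

variable [Module U V] [IsScalarTower ℂ U V]

theorem intertwines_opT (k : ℕ) (h : k + 1 < n) :
    Intertwines (f.lTensor (⨂[ℂ] _ : Fin n, V)) (opT V n M Q k h) (opT V n N Q k h) :=
  (intertwines_swapV _ _).mul
    (.pl (fun x => intertwines_legV _ (actV U V x)) (fun x => intertwines_legV _ (actV U V x)) _)

variable [Module (DU Q) M] [IsScalarTower ℂ (DU Q) M] [Module (DU Q) N] [IsScalarTower ℂ (DU Q) N]

theorem intertwines_opY (hf : ∀ (d : DU Q) m, f (d • m) = d • f m) (k : ℕ) (h : k < n) :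
    Intertwines (f.lTensor (⨂[ℂ] _ : Fin n, V)) (opY V n M Q k h) (opY V n N Q k h) := by
  induction k with
  | zero =>
    exact .mul (.pl (fun x => intertwines_legM hf (DU.iU Q x))
      (fun x => intertwines_legV _ (actV U V x)) _)
      (.pl (fun x => intertwines_legV _ (actV U V x))
      (fun x => intertwines_legM hf (DU.iU Q x)) _)
  | succ k ih => exact ((intertwines_opT k h).mul (ih _)).mul (intertwines_opT k h)

theorem intertwines_totalAd (hf : ∀ (d : DU Q) m, f (d • m) = d • f m) (k : ℕ) (h : k ≤ n)
    (x : locFin U) : Intertwines (f.lTensor (⨂[ℂ] _ : Fin n, V)) (totalAd V n M Q k h x)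
      (totalAd V n N Q k h x) := by
  induction k generalizing x with
  | zero => exact intertwines_legM hf (adD Q x)
  | succ k ih => exact .pl (fun x => intertwines_legV _ (actV U V x)) (fun x => ih _ x) _

variable [FiniteDimensional ℂ V]

theorem intertwines_opX (hf : ∀ (d : DU Q) m, f (d • m) = d • f m) (k : ℕ) (h : k < n) :
    Intertwines (f.lTensor (⨂[ℂ] _ : Fin n, V)) (opX V n M Q k h) (opX V n N Q k h) := by
  induction k with
  | zero =>
    exact .sum fun i _ => .sum fun j _ => (intertwines_legV _ _).mul (intertwines_legM hf _)
  | succ k ih => exact ((intertwines_opT k h).mul (ih _)).mul (intertwines_opT k h)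

end TensorFunctoriality

/-! ### The representation of the elliptic braid group on the invariants -/

section Rep

variable {V : Type v} [AddCommGroup V] [Module ℂ V] {n : ℕ}
  {M : Type w} [AddCommGroup M] [Module ℂ M]
  {U : Type u} [Ring U] [HopfAlgebra ℂ U] {Q : QuasiTriangular U}
  [Module U V] [IsScalarTower ℂ U V] [Module (DU Q) M] [IsScalarTower ℂ (DU Q) M]

theorem apply_mem_invariants {c : Module.End ℂ (TensorSpace V n M)}
    (hc : ∀ x, c * totalAd V n M Q n le_rfl x = totalAd V n M Q n le_rfl x * c)
    {z : TensorSpace V n M} (hz : z ∈ invariants V n M Q) : c z ∈ invariants V n M Q := by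
  intro x
  rw [← Module.End.mul_apply, ← hc, Module.End.mul_apply, hz x, map_smul]

theorem yProd_apply_invariants (ν : RibbonElement Q) {z : TensorSpace V n M}
    (hz : z ∈ invariants V n M Q) :
    yProd (B := Module.End ℂ (TensorSpace V n M)) Q (legs V n M Q) n z =
      legProd (B := Module.End ℂ (TensorSpace V n M)) (legs V n M Q) (ν.ν : U) n z := by
  have hν := central_mem_locFin (U := U) ν.central
  refine yProd_apply_of_invariant (δ := legMR V n M Q) legs_isLegs ν hν ?_ (k := n) ?_
  · exact congrArg (legM V n M Q) (rightDer_ribbon ν hν)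
  · intro x
    rw [← totalAd_eq le_rfl]
    exact hz x

variable [FiniteDimensional ℂ V]

variable (V n M Q) in
/-- The operators by which the generators of the elliptic braid group act. -/
def genOp : EllGen n → Module.End ℂ (TensorSpace V n M)
  | .X i => opX V n M Q i i.2
  | .Y i => opY V n M Q i i.2
  | .T i h => opT V n M Q i h

theorem isUnit_genOp (g : EllGen n) : IsUnit (genOp V n M Q g) := by
  cases g with
  | X i => exact isUnit_opX i.2
  | Y i => exact isUnit_opY i.2
  | T i h => exact isUnit_opT i h

theorem genOp_totalAd (g : EllGen n) (x : locFin U) :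
    genOp V n M Q g * totalAd V n M Q n le_rfl x = totalAd V n M Q n le_rfl x * genOp V n M Q g := by
  cases g with
  | X i => exact opX_totalAd i.2 x
  | Y i => exact opY_totalAd i.2 x
  | T i h => exact opT_totalAd h x

/-- An invertible operator commuting with `U'`, restricted to the invariants. -/
def restrictUnit (c : (Module.End ℂ (TensorSpace V n M))ˣ)
    (hc : ∀ x, (c : Module.End ℂ (TensorSpace V n M)) * totalAd V n M Q n le_rfl x =
      totalAd V n M Q n le_rfl x * c) : (Module.End ℂ (invariants V n M Q))ˣ where
  val := (c : Module.End ℂ (TensorSpace V n M)).restrict fun _ hz => apply_mem_invariants hc hz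
  inv := ((c⁻¹ : (Module.End ℂ (TensorSpace V n M))ˣ) : Module.End ℂ (TensorSpace V n M)).restrict
    fun _ hz => apply_mem_invariants
      (fun x => (Units.inv_mul_eq_iff_eq_mul c).2 (by rw [← mul_assoc, hc, mul_assoc,
        Units.mul_inv, mul_one])) hz
  val_inv := LinearMap.ext fun z => Subtype.ext
    (LinearMap.congr_fun (Units.mul_inv c) (z : TensorSpace V n M))
  inv_val := LinearMap.ext fun z => Subtype.ext
    (LinearMap.congr_fun (Units.inv_mul c) (z : TensorSpace V n M))

variable (V n M Q) in
/-- The generators of the elliptic braid group, acting on the invariants. -/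
def genUnit (g : EllGen n) : (Module.End ℂ (invariants V n M Q))ˣ :=
  restrictUnit (isUnit_genOp g).unit (genOp_totalAd g)

theorem genUnit_apply (g : EllGen n) (z : invariants V n M Q) :
    ((genUnit V n M Q g : Module.End ℂ (invariants V n M Q)) z : TensorSpace V n M) =
      genOp V n M Q g z := rfl

/-- A word in the generators acts by the product of the operators. -/
theorem lift_genUnit_prod (l : List (EllGen n)) (z : invariants V n M Q) :
    ((FreeGroup.lift (genUnit V n M Q) (l.map FreeGroup.of).prod :
      Module.End ℂ (invariants V n M Q)) z : TensorSpace V n M) =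
      (l.map (genOp V n M Q)).prod (z : TensorSpace V n M) := by
  induction l with
  | nil => simp
  | cons g l ih =>
    rw [List.map_cons, List.prod_cons, map_mul, FreeGroup.lift_apply_of, List.map_cons,
      List.prod_cons, Units.val_mul, Module.End.mul_apply, genUnit_apply, ih, Module.End.mul_apply]

/-- Agreement on the invariants suffices; the relation between Ỹ and X_i is available only there. -/
theorem lift_genUnit_eq {l l' : List (EllGen n)}
    (h : ∀ z : invariants V n M Q, (l.map (genOp V n M Q)).prod (z : TensorSpace V n M) =
      (l'.map (genOp V n M Q)).prod (z : TensorSpace V n M)) :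
    FreeGroup.lift (genUnit V n M Q) (l.map FreeGroup.of).prod =
      FreeGroup.lift (genUnit V n M Q) (l'.map FreeGroup.of).prod := by
  apply Units.ext
  ext1 z
  apply Subtype.ext
  rw [lift_genUnit_prod, lift_genUnit_prod, h]

theorem lift_genUnit_eq_of_prod_eq (l l' : List (EllGen n))
    (h : (l.map (genOp V n M Q)).prod = (l'.map (genOp V n M Q)).prod) :
    FreeGroup.lift (genUnit V n M Q) (l.map FreeGroup.of).prod =
      FreeGroup.lift (genUnit V n M Q) (l'.map FreeGroup.of).prod :=
  lift_genUnit_eq fun z => by rw [h]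

variable (V n M Q) in
/-- The operators `T_i` and `X_i`, extended to all indices. -/
def opTX : (ℕ → Module.End ℂ (TensorSpace V n M)) × (ℕ → Module.End ℂ (TensorSpace V n M)) :=
  -- The value 1 out of range is harmless: the abstract braid lemmas use only indices within bounds.
  (fun i => if h : i + 1 < n then opT V n M Q i h else 1,
    fun i => if h : i < n then opX V n M Q i h else 1)

theorem opTX_fst {i : ℕ} (h : i + 1 < n) : (opTX V n M Q).1 i = opT V n M Q i h := dif_pos h

theorem opTX_snd {i : ℕ} (h : i < n) : (opTX V n M Q).2 i = opX V n M Q i h := dif_pos h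

theorem opTX_succ (i : ℕ) (h : i + 1 < n) : (opTX V n M Q).2 (i + 1) =
    (opTX V n M Q).1 i * (opTX V n M Q).2 i * (opTX V n M Q).1 i := by
  rw [opTX_snd h, opTX_fst h, opTX_snd (by omega)]
  rfl

theorem opTX_braid (i : ℕ) (h : i + 2 < n) :
    (opTX V n M Q).1 i * (opTX V n M Q).1 (i + 1) * (opTX V n M Q).1 i =
      (opTX V n M Q).1 (i + 1) * (opTX V n M Q).1 i * (opTX V n M Q).1 (i + 1) := by
  rw [opTX_fst h, opTX_fst (by omega)]
  exact opT_braid i h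

theorem opTX_far (i j : ℕ) (hij : i + 2 ≤ j) (hj : j + 1 < n) :
    (opTX V n M Q).1 i * (opTX V n M Q).1 j = (opTX V n M Q).1 j * (opTX V n M Q).1 i := by
  rw [opTX_fst hj, opTX_fst (by omega)]
  exact opT_opT _ hj hij

theorem opTX_zero (i : ℕ) (hi : 1 ≤ i) (h : i + 1 < n) :
    (opTX V n M Q).1 i * (opTX V n M Q).2 0 = (opTX V n M Q).2 0 * (opTX V n M Q).1 i := by
  rw [opTX_fst h, opTX_snd (by omega), opX_zero]
  exact opT_canLeg (i := ⟨0, by omega⟩) h (show 0 ≠ i by omega) (show 0 ≠ i + 1 by omega)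

theorem opTX_reflection (h : 1 < n) :
    (opTX V n M Q).2 0 * (opTX V n M Q).1 0 * (opTX V n M Q).2 0 * (opTX V n M Q).1 0 =
      (opTX V n M Q).1 0 * (opTX V n M Q).2 0 * (opTX V n M Q).1 0 * (opTX V n M Q).2 0 := by
  rw [opTX_fst (by omega), opTX_snd (by omega)]
  exact opX_opT_opX_opT h

theorem opX_opX {i j : ℕ} (hi : i < n) (hj : j < n) :
    opX V n M Q i hi * opX V n M Q j hj = opX V n M Q j hj * opX V n M Q i hi := by
  have key : ∀ {i j : ℕ}, i < j → j < n → (opTX V n M Q).2 i * (opTX V n M Q).2 j =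
      (opTX V n M Q).2 j * (opTX V n M Q).2 i := fun h hj =>
    braid_commute opTX_succ opTX_braid opTX_far opTX_zero opTX_reflection h hj
  rw [← opTX_snd hi, ← opTX_snd hj]
  rcases lt_trichotomy i j with h | rfl | h
  · exact key h hj
  · rfl
  · exact (key h hi).symm

theorem opT_opX {i j : ℕ} (hi : i + 1 < n) (hj : j < n) (h1 : j ≠ i) (h2 : j ≠ i + 1) :
    opT V n M Q i hi * opX V n M Q j hj = opX V n M Q j hj * opT V n M Q i hi := by
  rw [← opTX_snd hj, ← opTX_fst hi]
  rcases Nat.lt_or_ge j i with h | h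
  · exact braid_commute_of_lt opTX_succ opTX_far opTX_zero hi h
  · exact braid_commute_of_gt opTX_succ opTX_braid opTX_far opTX_zero hj (by omega)

theorem prod_genOp_Y : ((List.ofFn fun i : Fin n => EllGen.Y i).map (genOp V n M Q)).prod =
    yProd (B := Module.End ℂ (TensorSpace V n M)) Q (legs V n M Q) n := by
  rw [List.map_ofFn, yProd]
  congr 2
  ext1 i
  exact opY_eq_yOp i.2

theorem lift_genUnit_rel (ν : RibbonElement Q) {a b : FreeGroup (EllGen n)} (h : EllRel n a b) :
    FreeGroup.lift (genUnit V n M Q) a = FreeGroup.lift (genUnit V n M Q) b := by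
  have key := lift_genUnit_eq_of_prod_eq (V := V) (n := n) (M := M) (Q := Q)
  cases h with
  | XX i j =>
    have := key [.X i, .X j] [.X j, .X i] (by simpa [genOp] using opX_opX i.2 j.2)
    simpa [EllGen.fX, EllGen.fY, EllGen.fT] using this
  | YY i j =>
    have := key [.Y i, .Y j] [.Y j, .Y i] (by simpa [genOp] using opY_opY i.2 j.2)
    simpa [EllGen.fX, EllGen.fY, EllGen.fT] using this
  | braid i h =>
    have := key [.T i (by omega), .T (i + 1) h, .T i (by omega)]
      [.T (i + 1) h, .T i (by omega), .T (i + 1) h]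
      (by simpa [genOp, mul_assoc] using opT_braid i h)
    simpa [EllGen.fX, EllGen.fY, EllGen.fT, mul_assoc] using this
  | far i j hi hj hij =>
    have := key [.T i hi, .T j hj] [.T j hj, .T i hi] (by simpa [genOp] using opT_opT hi hj hij)
    simpa [EllGen.fX, EllGen.fY, EllGen.fT] using this
  | TXT i h =>
    have := key [.T i h, .X ⟨i, by omega⟩, .T i h] [.X ⟨i + 1, h⟩]
      (by simp [genOp, opX, mul_assoc])
    simpa [EllGen.fX, EllGen.fY, EllGen.fT, mul_assoc] using this
  | TYT i h =>
    have := key [.T i h, .Y ⟨i, by omega⟩, .T i h] [.Y ⟨i + 1, h⟩]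
      (by simp [genOp, opY, mul_assoc])
    simpa [EllGen.fX, EllGen.fY, EllGen.fT, mul_assoc] using this
  | TX i h j h1 h2 =>
    have := key [.T i h, .X j] [.X j, .T i h] (by simpa [genOp] using opT_opX h j.2 h1 h2)
    simpa [EllGen.fX, EllGen.fY, EllGen.fT] using this
  | TY i h j h1 h2 =>
    have := key [.T i h, .Y j] [.Y j, .T i h] (by simpa [genOp] using opT_opY h j.2 h1 h2)
    simpa [EllGen.fX, EllGen.fY, EllGen.fT] using this
  | XY h =>
    have := key [.X ⟨0, by omega⟩, .Y ⟨1, h⟩] [.Y ⟨1, h⟩, .X ⟨0, by omega⟩, .T 0 h, .T 0 h]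
      (by simpa [genOp, pow_two, mul_assoc] using opX_opY h)
    simpa [EllGen.fX, EllGen.fY, EllGen.fT, pow_two, mul_assoc] using this
  -- The one relation not proved on all of V^{⊗n} ⊗ M: Ỹ is replaced by ν ⊗ ⋯ ⊗ ν, both on z and on
  -- X_i z, which is again invariant.
  | YtotX i =>
    have e : EllGen.fYtot n = ((List.ofFn fun i : Fin n => EllGen.Y i).map FreeGroup.of).prod := by
      rw [List.map_ofFn]
      rfl
    have := lift_genUnit_eq (V := V) (M := M) (Q := Q)
      (l := (List.ofFn fun i : Fin n => EllGen.Y i) ++ [.X i])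
      (l' := .X i :: List.ofFn fun i : Fin n => EllGen.Y i) (fun z => by
        simp only [List.map_append, List.prod_append, List.map_cons, List.prod_cons, List.map_nil,
          List.prod_nil, mul_one, prod_genOp_Y, Module.End.mul_apply]
        rw [yProd_apply_invariants ν z.2,
          yProd_apply_invariants ν (apply_mem_invariants (genOp_totalAd (.X i)) z.2),
          ← Module.End.mul_apply, ← Module.End.mul_apply]
        exact LinearMap.congr_fun (legProd_opX ν.central i.2) _)
    rw [e]
    simpa [EllGen.fX, EllGen.fY, EllGen.fT] using this

variable (V n M) in
/-- The representation of the elliptic braid group on the invariants. -/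
def ellRep (ν : RibbonElement Q) : Representation ℂ (EllBraid n) (invariants V n M Q) :=
  (Units.coeHom _).comp (PresentedGroup.toGroup (f := genUnit V n M Q) (by
    rintro _ ⟨a, b, hab, rfl⟩
    rw [map_mul, map_inv, lift_genUnit_rel ν hab, mul_inv_cancel]))

theorem ellRep_of (ν : RibbonElement Q) (g : EllGen n) (z : invariants V n M Q) :
    (ellRep V n M ν (PresentedGroup.of g) z : TensorSpace V n M) = genOp V n M Q g z := by
  rw [ellRep, MonoidHom.comp_apply, PresentedGroup.toGroup.of]
  rfl

/-! ### The representation of the double affine Hecke algebra -/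

/-- The target is only assumed to be a semiring, so c is not subtracted there; −c is added instead.
-/
theorem algHom_hecke {A B : Type*} [Ring A] [Algebra ℂ A] [Semiring B] [Algebra ℂ B] (F : A →ₐ[ℂ] B)
    (x : A) (c d : ℂ) : F ((x - algebraMap ℂ A c) * (x + algebraMap ℂ A d)) =
      (F x + algebraMap ℂ B (-c)) * (F x + algebraMap ℂ B d) := by
  rw [sub_eq_add_neg, ← map_neg, map_mul, map_add, map_add, F.commutes, F.commutes]

theorem ellRep_hecke (ν : RibbonElement Q) {c d : ℂ}
    (hσ : (braiding Q V - algebraMap ℂ _ c) * (braiding Q V + algebraMap ℂ _ d) = 0)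
    (i : ℕ) (h : i + 1 < n) :
    ((ellRep V n M ν (EllBraid.T i h) : Module.End ℂ (invariants V n M Q)) +
        algebraMap ℂ (Module.End ℂ (invariants V n M Q)) (-c)) *
      ((ellRep V n M ν (EllBraid.T i h) : Module.End ℂ (invariants V n M Q)) +
        algebraMap ℂ (Module.End ℂ (invariants V n M Q)) d) = 0 := by
  ext1 z
  apply Subtype.ext
  have h1 : ∀ z : invariants V n M Q, (ellRep V n M ν (EllBraid.T i h) z : TensorSpace V n M) =
      opT V n M Q i h z := ellRep_of ν (.T i h)
  have h2 := LinearMap.congr_fun (opT_hecke (M := M) hσ h) (z : TensorSpace V n M)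
  simp only [Module.End.mul_apply, LinearMap.sub_apply, LinearMap.add_apply,
    Module.algebraMap_end_apply] at h2
  rw [sub_eq_add_neg, ← neg_smul] at h2
  simpa only [Module.End.mul_apply, LinearMap.add_apply, Module.algebraMap_end_apply,
    Submodule.coe_add, Submodule.coe_smul, h1, LinearMap.zero_apply, ZeroMemClass.coe_zero]
    using h2

variable (V n M) in
/-- The representation of the double affine Hecke algebra on the invariants. -/
def dahaRep (ν : RibbonElement Q) (q t : ℂ)
    (hσ : (braiding Q V - algebraMap ℂ _ (q⁻¹ * t)) *
      (braiding Q V + algebraMap ℂ _ (q⁻¹ * t⁻¹)) = 0) :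
    DAHA n q t →ₐ[ℂ] Module.End ℂ (invariants V n M Q) :=
  RingQuot.liftAlgHom ℂ (s := DAHARel n q t)
    ⟨MonoidAlgebra.lift ℂ (Module.End ℂ (invariants V n M Q)) (EllBraid n) (ellRep V n M ν), by
      rintro _ _ ⟨i, h⟩
      refine (algHom_hecke (B := Module.End ℂ (invariants V n M Q)) _ _ _ _).trans ?_
      rw [MonoidAlgebra.lift_of]
      exact (ellRep_hecke ν hσ i h).trans (map_zero _).symm⟩

theorem dahaRep_mk (ν : RibbonElement Q) (q t : ℂ)
    (hσ : (braiding Q V - algebraMap ℂ _ (q⁻¹ * t)) *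
      (braiding Q V + algebraMap ℂ _ (q⁻¹ * t⁻¹)) = 0) (g : EllBraid n) :
    dahaRep V n M ν q t hσ (DAHA.mk n q t (MonoidAlgebra.of ℂ _ g)) = ellRep V n M ν g :=
  (RingQuot.liftAlgHom_mkAlgHom_apply ℂ _ _ _).trans (MonoidAlgebra.lift_of _ _)

end Rep

/-! ### Functoriality -/

section Functor

variable {V : Type v} [AddCommGroup V] [Module ℂ V] {n : ℕ}
  {M N : Type w} [AddCommGroup M] [Module ℂ M] [AddCommGroup N] [Module ℂ N]
  {U : Type u} [Ring U] [HopfAlgebra ℂ U] {Q : QuasiTriangular U}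
  [Module U V] [IsScalarTower ℂ U V] [FiniteDimensional ℂ V]
  [Module (DU Q) M] [IsScalarTower ℂ (DU Q) M] [Module (DU Q) N] [IsScalarTower ℂ (DU Q) N]

variable (V n) in
/-- The map of invariants induced by a morphism of `D_U`-modules. -/
def invariantsMap (f : M →ₗ[ℂ] N) (hf : ∀ (d : DU Q) m, f (d • m) = d • f m) :
    invariants V n M Q →ₗ[ℂ] invariants V n N Q :=
  (f.lTensor (⨂[ℂ] _ : Fin n, V)).restrict fun z hz x => by
    rw [← intertwines_totalAd hf, hz x, map_smul]

theorem invariantsMap_ellRep (ν : RibbonElement Q) (f : M →ₗ[ℂ] N)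
    (hf : ∀ (d : DU Q) m, f (d • m) = d • f m) (g : EllBraid n) (z : invariants V n M Q) :
    invariantsMap V n f hf (ellRep V n M ν g z) =
      ellRep V n N ν g (invariantsMap V n f hf z) := by
  obtain ⟨g, rfl⟩ := PresentedGroup.mk_surjective _ g
  induction g using FreeGroup.induction_on generalizing z with
  | C1 => simp [map_one]
  | of g =>
    apply Subtype.ext
    refine (congrArg _ (ellRep_of ν g z)).trans (Eq.trans ?_ (ellRep_of ν g _).symm)
    cases g with
    | X i => exact intertwines_opX (V := V) hf i i.2 z.1
    | Y i => exact intertwines_opY (V := V) hf i i.2 z.1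
    | T i h => exact intertwines_opT (V := V) (f := f) i h z.1
  -- Intertwining of an invertible operator passes to its inverse, by applying the hypothesis to
  -- a⁻¹z.
  | inv_of g ih =>
    set a : EllBraid n := PresentedGroup.mk _ (FreeGroup.of g)
    have h1 : ∀ z, ellRep V n M ν a (ellRep V n M ν a⁻¹ z) = z := fun z => by
      rw [← Module.End.mul_apply, ← map_mul, mul_inv_cancel, map_one, Module.End.one_apply]
    have h2 : ∀ z, ellRep V n N ν a⁻¹ (ellRep V n N ν a z) = z := fun z => by
      rw [← Module.End.mul_apply, ← map_mul, inv_mul_cancel, map_one, Module.End.one_apply]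
    have h3 := ih (ellRep V n M ν a⁻¹ z)
    rw [h1] at h3
    rw [map_inv, h3, h2]
  | mul a b ha hb => rw [map_mul, map_mul, map_mul, Module.End.mul_apply, ha, hb]; rfl

theorem invariantsMap_dahaRep (ν : RibbonElement Q) (q t : ℂ)
    (hσ : (braiding Q V - algebraMap ℂ _ (q⁻¹ * t)) *
      (braiding Q V + algebraMap ℂ _ (q⁻¹ * t⁻¹)) = 0) (f : M →ₗ[ℂ] N)
    (hf : ∀ (d : DU Q) m, f (d • m) = d • f m) (a : DAHA n q t) (z : invariants V n M Q) :
    invariantsMap V n f hf (dahaRep V n M ν q t hσ a z) =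
      dahaRep V n N ν q t hσ a (invariantsMap V n f hf z) := by
  obtain ⟨a, rfl⟩ := RingQuot.mkAlgHom_surjective ℂ (DAHARel n q t) a
  change invariantsMap V n f hf (dahaRep V n M ν q t hσ (DAHA.mk n q t a) z) =
    dahaRep V n N ν q t hσ (DAHA.mk n q t a) (invariantsMap V n f hf z)
  induction a using MonoidAlgebra.induction_on with
  | of g =>
    rw [dahaRep_mk, dahaRep_mk, invariantsMap_ellRep]
  | add a b ha hb =>
    simp only [map_add, LinearMap.add_apply, ha, hb]
  | smul r a ha =>
    simp only [map_smul, LinearMap.smul_apply, ha]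

end Functor

/-! ### The functor between module categories -/

variable {U : Type u} [Ring U] [HopfAlgebra ℂ U] {Q : QuasiTriangular U}
  (V : Type v) [AddCommGroup V] [Module ℂ V] [Module U V] [IsScalarTower ℂ U V]
  [FiniteDimensional ℂ V] (n : ℕ)

/-- The invariants of a `D_U`-module, as a module over the double affine Hecke algebra. -/
def invariantsObj (ν : RibbonElement Q) (q t : ℂ)
    (hσ : (braiding Q V - algebraMap ℂ _ (q⁻¹ * t)) *
      (braiding Q V + algebraMap ℂ _ (q⁻¹ * t⁻¹)) = 0) (M : ModuleCat.{w} (DU Q)) :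
    ModuleCat.{max v w} (DAHA n q t) :=
  letI : Module (DAHA n q t) (invariants V n M Q) :=
    Module.compHom _ (dahaRep V n M ν q t hσ).toRingHom
  ModuleCat.of (DAHA n q t) (invariants V n M Q)

/-- The map of invariants induced by a morphism of `D_U`-modules, as a morphism of modules over
the double affine Hecke algebra. -/
def invariantsHom (ν : RibbonElement Q) (q t : ℂ)
    (hσ : (braiding Q V - algebraMap ℂ _ (q⁻¹ * t)) *
      (braiding Q V + algebraMap ℂ _ (q⁻¹ * t⁻¹)) = 0) {M N : ModuleCat.{w} (DU Q)} (f : M ⟶ N) :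
    invariantsObj V n ν q t hσ M →ₗ[DAHA n q t] invariantsObj V n ν q t hσ N where
  toFun := invariantsMap V n (f.hom.restrictScalars ℂ) fun d m => f.hom.map_smul d m
  map_add' x y := map_add (invariantsMap V n (f.hom.restrictScalars ℂ) _) x y
  map_smul' a x := invariantsMap_dahaRep ν q t hσ _ _ a x

/-- The functor of invariants from `D_U`-modules to modules over the double affine Hecke
algebra. -/
def invariantsFunctor (ν : RibbonElement Q) (q t : ℂ)
    (hσ : (braiding Q V - algebraMap ℂ _ (q⁻¹ * t)) *
      (braiding Q V + algebraMap ℂ _ (q⁻¹ * t⁻¹)) = 0) :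
    CategoryTheory.Functor (ModuleCat.{w} (DU Q)) (ModuleCat.{max v w} (DAHA n q t)) where
  obj := invariantsObj V n ν q t hσ
  map {M N} f := ModuleCat.ofHom (X := invariantsObj V n ν q t hσ M)
    (Y := invariantsObj V n ν q t hσ N) (invariantsHom V n ν q t hσ f)
  map_id M := ModuleCat.hom_ext (LinearMap.ext fun z => Subtype.ext
    (LinearMap.congr_fun (LinearMap.lTensor_id (⨂[ℂ] _ : Fin n, V) M) z.1))
  map_comp f g := ModuleCat.hom_ext (LinearMap.ext fun z => Subtype.ext
    (LinearMap.congr_fun (LinearMap.lTensor_comp (⨂[ℂ] _ : Fin n, V)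
      (g.hom.restrictScalars ℂ) (f.hom.restrictScalars ℂ)) z.1))

end QuantumD

end

/-! ### The main theorem -/

theorem mainTheorem2 {U : Type u} [Ring U] [HopfAlgebra ℂ U] (Q : QuantumD.QuasiTriangular U)
    (_ν : QuantumD.RibbonElement Q) (_hU : QuantumD.EnoughFinDimReps U)
    (V : Type v) [AddCommGroup V] [Module ℂ V] [Module U V] [IsScalarTower ℂ U V]
    [FiniteDimensional ℂ V] (n : ℕ) (q t : ℂ) (_hq : q ≠ 0) (_ht : t ≠ 0)
    (_hecke : (QuantumD.braiding Q V - algebraMap ℂ _ (q⁻¹ * t)) *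
      (QuantumD.braiding Q V + algebraMap ℂ _ (q⁻¹ * t⁻¹)) = 0) :
    ∃ (ρ : ∀ M : ModuleCat.{w} (QuantumD.DU Q),
          Representation ℂ (QuantumD.EllBraid n) (QuantumD.invariants V n M Q))
      (ρH : ∀ M : ModuleCat.{w} (QuantumD.DU Q),
          QuantumD.DAHA n q t →ₐ[ℂ] Module.End ℂ (QuantumD.invariants V n M Q)),
      -- the generators of the elliptic braid group act by the operators `T_i`, `X_i`, `Y_i`
      (∀ (M : ModuleCat.{w} (QuantumD.DU Q)) (z : QuantumD.invariants V n M Q),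
        (∀ (i : ℕ) (h : i + 1 < n), (ρ M (QuantumD.EllBraid.T i h) z : QuantumD.TensorSpace V n M) =
          QuantumD.opT V n M Q i h z) ∧
        (∀ i : Fin n, (ρ M (QuantumD.EllBraid.X i) z : QuantumD.TensorSpace V n M) =
          QuantumD.opX V n M Q i i.2 z) ∧
        (∀ i : Fin n, (ρ M (QuantumD.EllBraid.Y i) z : QuantumD.TensorSpace V n M) =
          QuantumD.opY V n M Q i i.2 z)) ∧
      -- the action descends to the double affine Hecke algebra
      (∀ (M : ModuleCat.{w} (QuantumD.DU Q)) (g : QuantumD.EllBraid n),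
        ρH M (QuantumD.DAHA.mk n q t (MonoidAlgebra.of ℂ _ g)) = ρ M g) ∧
      -- this gives a functor, acting on morphisms by `f ↦ id ⊗ f`
      ∃ (F : CategoryTheory.Functor (ModuleCat.{w} (QuantumD.DU Q))
            (ModuleCat.{max v w} (QuantumD.DAHA n q t)))
        (e : ∀ M : ModuleCat.{w} (QuantumD.DU Q), F.obj M ≃+ QuantumD.invariants V n M Q),
        (∀ (M : ModuleCat.{w} (QuantumD.DU Q)) (a : QuantumD.DAHA n q t) (x : F.obj M),
          e M (a • x) = ρH M a (e M x)) ∧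
        (∀ (M N : ModuleCat.{w} (QuantumD.DU Q)) (f : M ⟶ N) (x : F.obj M),
          (e N (F.map f x) : QuantumD.TensorSpace V n N) =
            LinearMap.lTensor (⨂[ℂ] _ : Fin n, V) (f.hom.restrictScalars ℂ)
              (e M x : QuantumD.TensorSpace V n M)) := by
  refine ⟨fun M => QuantumD.ellRep V n M _ν, fun M => QuantumD.dahaRep V n M _ν q t _hecke,
    fun M z => ⟨fun i h => QuantumD.ellRep_of _ν (.T i h) z,
      fun i => QuantumD.ellRep_of _ν (.X i) z, fun i => QuantumD.ellRep_of _ν (.Y i) z⟩,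
    fun M g => QuantumD.dahaRep_mk _ν q t _hecke g,
    -- The functor's value is the space of invariants itself, so the identification is the identity
    -- and both compatibilities hold by definition.
    QuantumD.invariantsFunctor V n _ν q t _hecke, fun M => AddEquiv.refl _,
    fun M a x => rfl, fun M N f x => rfl⟩
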